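/- Work in the two-sorted bounded arithmetic of Cook and Nguyen (numbers and strings, language $\mathcal L^2_A$). Let $\mathbf{V\#L}$ be the theory axiomatized by $2$-$\mathrm{BASIC}$, comprehension for $\Sigma^B_0$ formulas, the existence of the product $X\cdot Y$ of any two strings (as binary numbers), and the existence of every power $X^k$ of every square integer matrix $X$ (entries in binary). For a skew-symmetric integer matrix $A=(a_{ij})$ of order $2n$ write $A=\begin{pmatrix}0&a_{12}&R\\-a_{12}&0&-S^{t}\\-R^{t}&S&M\end{pmatrix}$, and let $J$ be the block-diagonal matrix of order $2n-2$ with blocks $\begin{pmatrix}0&1\\-1&0\end{pmatrix}$. The Pfaffian is formalized by the Berkowitz-type algorithm: the coefficient vector is $\bar p_A=(p_n,\dots,p_0)^t=P_A\,\bar p_M$, where $P_A$ is the $(n+1)\times n$ lower triangular Toeplitz matrix with first column $(1,\,a_{12},\,RJS,\,RJ(MJ)S,\dots,RJ(MJ)^{n-2}S)^t$, with $\bar p=(1)$ for the empty matrix; and $\mathrm{pf}(A)=p_0$. The determinant of an $n\times n$ matrix $A$ is defined by $\det(A)=(-1)^{n(n-1)/2}\,\mathrm{pf}\begin{pmatrix}0&A\\-A^{t}&0\end{pmatrix}$.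 Let (PCE) be the statement that for all $n\ge 1$, all skew-symmetric $A$ of order $2n$ and all $1\le i\le 2n$, $\mathrm{pf}(A)=\sum_{1\le j\le 2n,\ j\ne i}(-1)^{i+j+\Theta(j-i)}\,a_{ij}\,\mathrm{pf}(A\langle i,j\rangle)$, where $A\langle i,j\rangle$ is $A$ with rows $i,j$ and columns $i,j$ removed, $\Theta(k)=1$ for $k>0$ and $\Theta(k)=0$ for $k<0$. Theorem. $\mathbf{V\#L}$ proves that (PCE) implies Cayley's theorem: for all $n$ and all skew-symmetric $A$ of order $2n$, $\det(A)=\mathrm{pf}(A)^2$. Equivalently, every model of $\mathbf{V\#L}$ that satisfies (PCE) satisfies Cayley's theorem. -/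

import Mathlib

/-! Two-sorted bounded arithmetic: structures for the language `L²_A`, bounded formulas, the theory
`V#L`, and, inside an arbitrary model of it, integers, integer matrices and the Pfaffian.
All notions below that take a model `M` are first-order over `M`: every quantifier ranges over
`M.Num` or `M.Str`. -/

namespace VSharpL

universe u

/-- A structure for the two-sorted language `L²_A = [0, 1, +, ·, |·|; ∈, ≤, =₁, =₂]`, with a sort of
numbers and a sort of strings (finite sets of numbers). Both equalities are true equality. -/
structure TwoSorted : Type (u + 1) where
  Num : Type u
  Str : Type u
  zero : Num
  one : Num
  add : Num → Num → Num
  mul : Num → Num → Num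
  le : Num → Num → Prop
  len : Str → Num
  mem : Num → Str → Prop

variable {M : TwoSorted.{u}}

instance : Zero M.Num := ⟨M.zero⟩
instance : One M.Num := ⟨M.one⟩
instance : Add M.Num := ⟨M.add⟩
instance : Mul M.Num := ⟨M.mul⟩
instance : LE M.Num := ⟨M.le⟩
/-- `x < y` abbreviates `x ≤ y ∧ x ≠ y`. -/
instance : LT M.Num := ⟨fun x y => x ≤ y ∧ x ≠ y⟩

/-! ### Bounded formulas -/

/-- Number terms of `L²_A`; number variables and string variables are indexed by `ℕ`. -/
inductive NumTerm : Type
  | var (x : ℕ)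
  | zero
  | one
  | add (s t : NumTerm)
  | mul (s t : NumTerm)
  | len (X : ℕ)

/-- `Σ^B_0` formulas of `L²_A`: string variables occur only free, and every number quantifier is
bounded (`all x t φ` is `∀ x ≤ t, φ` and `ex x t φ` is `∃ x ≤ t, φ`). -/
inductive Sigma0B : Type
  | eqNum (s t : NumTerm)
  | eqStr (X Y : ℕ)
  | le (s t : NumTerm)
  | mem (t : NumTerm) (X : ℕ)
  | not (φ : Sigma0B)
  | and (φ ψ : Sigma0B)
  | or (φ ψ : Sigma0B)
  | all (x : ℕ) (t : NumTerm) (φ : Sigma0B)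
  | ex (x : ℕ) (t : NumTerm) (φ : Sigma0B)

def NumTerm.eval (ν : ℕ → M.Num) (σ : ℕ → M.Str) : NumTerm → M.Num
  | .var x => ν x
  | .zero => 0
  | .one => 1
  | .add s t => s.eval ν σ + t.eval ν σ
  | .mul s t => s.eval ν σ * t.eval ν σ
  | .len X => M.len (σ X)

/-- Truth of a bounded formula under an assignment. The bound of a quantifier is evaluated outside
of its scope. -/
def Sigma0B.Holds (ν : ℕ → M.Num) (σ : ℕ → M.Str) : Sigma0B → Prop
  | .eqNum s t => s.eval ν σ = t.eval ν σ
  | .eqStr X Y => σ X = σ Y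
  | .le s t => s.eval ν σ ≤ t.eval ν σ
  | .mem t X => M.mem (t.eval ν σ) (σ X)
  | .not φ => ¬ φ.Holds ν σ
  | .and φ ψ => φ.Holds ν σ ∧ ψ.Holds ν σ
  | .or φ ψ => φ.Holds ν σ ∨ ψ.Holds ν σ
  | .all x t φ => ∀ a : M.Num, a ≤ t.eval ν σ → φ.Holds (Function.update ν x a) σ
  | .ex x t φ => ∃ a : M.Num, a ≤ t.eval ν σ ∧ φ.Holds (Function.update ν x a) σ

/-! ### Natural numbers in binary -/

/-- A set of numbers of `M`, read as the sequence of binary digits of a natural number (the digit of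
`2 ^ i` is `1` iff `i` is in the set). -/
abbrev Bits (M : TwoSorted.{u}) : Type u := M.Num → Prop

/-- The natural number coded by a string. -/
def bits (X : M.Str) : Bits M := fun i => M.mem i X

/-- The pairing function `⟨x, y⟩ = (x + y)(x + y + 1) + 2y`. -/
def pair (x y : M.Num) : M.Num := (x + y) * (x + y + 1) + (y + y)

/-- Row `x` of the array coded by a string. -/
def row (W : M.Str) (x : M.Num) : Bits M := fun i => M.mem (pair x i) W

/-- The carry into position `i` when `p` and `q` are added. -/
def carry (p q : Bits M) (i : M.Num) : Prop :=
  ∃ k, k < i ∧ p k ∧ q k ∧ ∀ j, k < j → j < i → p j ∨ q j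

/-- Binary addition. -/
def bAdd (p q : Bits M) : Bits M := fun i => Xor (Xor (p i) (q i)) (carry p q i)

/-- `W` records the school multiplication of `p` by `q`, where `p < 2 ^ b`: row `i` of `W` is
`(p mod 2 ^ i) · q`. -/
def MulTrace (p q : Bits M) (b : M.Num) (W : M.Str) : Prop :=
  (∀ i, p i → i < b) ∧ (∀ j, ¬ row W 0 j) ∧
    ∀ i, i < b → row W (i + 1) = bAdd (row W i) (fun j => p i ∧ ∃ k, j = i + k ∧ q k)

/-- `r = p · q`. -/
def IsProd (p q r : Bits M) : Prop := ∃ b W, MulTrace p q b W ∧ r = row W b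

/-- Binary multiplication. -/
def bMul (p q : Bits M) : Bits M := fun j => ∃ r : M.Str, IsProd p q (bits r) ∧ bits r j

/-- `W` records the partial sums of `f 0 + ⋯ + f (d - 1)`. -/
def SumTrace (d : M.Num) (f : M.Num → Bits M) (W : M.Str) : Prop :=
  (∀ j, ¬ row W 0 j) ∧ ∀ i, i < d → row W (i + 1) = bAdd (row W i) (f i)

/-- The sum of `f i` over `i < d`. -/
def bSum (d : M.Num) (f : M.Num → Bits M) : Bits M := fun j => ∃ W, SumTrace d f W ∧ row W d j

/-! ### Integers and integer matrices -/

/-- An integer, coded as the difference `pos - neg` of two natural numbers in binary. -/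
@[ext]
structure IntCode (M : TwoSorted.{u}) where
  pos : Bits M
  neg : Bits M

/-- `a` and `b` code the same integer. -/
def IntCode.Same (a b : IntCode M) : Prop := bAdd a.pos b.neg = bAdd b.pos a.neg

def zZero : IntCode M := ⟨fun _ => False, fun _ => False⟩
def zOne : IntCode M := ⟨fun i => i = 0, fun _ => False⟩
def zNeg (a : IntCode M) : IntCode M := ⟨a.neg, a.pos⟩
def zMul (a b : IntCode M) : IntCode M :=
  ⟨bAdd (bMul a.pos b.pos) (bMul a.neg b.neg), bAdd (bMul a.pos b.neg) (bMul a.neg b.pos)⟩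
def zSum (d : M.Num) (f : M.Num → IntCode M) : IntCode M :=
  ⟨bSum d fun i => (f i).pos, bSum d fun i => (f i).neg⟩

/-- The integer in cell `i` of the array coded by `W`. -/
def cell (W : M.Str) (i : M.Num) : IntCode M := ⟨row W (pair i 0), row W (pair i 1)⟩

/-- Integer matrices; entries are indexed from `0`, and sizes are given separately. -/
abbrev Mat (M : TwoSorted.{u}) : Type u := M.Num → M.Num → IntCode M

/-- The integer matrix coded by a string. -/
def mat (X : M.Str) : Mat M := fun a b => cell X (pair a b)

def matOne : Mat M := fun a b => ⟨fun i => a = b ∧ i = 0, fun _ => False⟩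

/-- The product of `d × d` matrices. -/
def matMul (d : M.Num) (X Y : Mat M) : Mat M :=
  fun a b => zSum d fun l => zMul (X a l) (Y l b)

/-- Item `i` of the sequence of matrices coded by a string. -/
def matItem (W : M.Str) (i : M.Num) : Mat M := fun a b => cell W (pair (pair i a) b)

/-- `W` records the powers `X ^ 0, …, X ^ k` of the `d × d` matrix `X`. -/
def PowTrace (d : M.Num) (X : Mat M) (k : M.Num) (W : M.Str) : Prop :=
  (∀ a b, a < d → b < d → matItem W 0 a b = matOne a b) ∧
    ∀ i, i < k → ∀ a b, a < d → b < d → matItem W (i + 1) a b = matMul d (matItem W i) X a b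

/-- `Y = X ^ k` for `d × d` matrices. -/
def IsPow (d : M.Num) (X : Mat M) (k : M.Num) (Y : Mat M) : Prop :=
  ∃ W, PowTrace d X k W ∧ ∀ a b, a < d → b < d → Y a b = matItem W k a b

/-- The matrix power `X ^ k`. -/
def matPow (d : M.Num) (X : Mat M) (k : M.Num) : Mat M := fun a b =>
  ⟨fun j => ∃ W, PowTrace d X k W ∧ (matItem W k a b).pos j,
   fun j => ∃ W, PowTrace d X k W ∧ (matItem W k a b).neg j⟩

/-! ### The theory `V#L` -/

/-- The axioms `2-BASIC` for `L²_A`. -/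
structure TwoBasic (M : TwoSorted.{u}) : Prop where
  b1 : ∀ x : M.Num, x + 1 ≠ 0
  b2 : ∀ x y : M.Num, x + 1 = y + 1 → x = y
  b3 : ∀ x : M.Num, x + 0 = x
  b4 : ∀ x y : M.Num, x + (y + 1) = (x + y) + 1
  b5 : ∀ x : M.Num, x * 0 = 0
  b6 : ∀ x y : M.Num, x * (y + 1) = x * y + x
  b7 : ∀ x y : M.Num, x ≤ y → y ≤ x → x = y
  b8 : ∀ x y : M.Num, x ≤ x + y
  b9 : ∀ x : M.Num, 0 ≤ x
  b10 : ∀ x y : M.Num, x ≤ y ∨ y ≤ x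
  b11 : ∀ x y : M.Num, x ≤ y ↔ x < y + 1
  b12 : ∀ x : M.Num, x ≠ 0 → ∃ y, y ≤ x ∧ y + 1 = x
  l1 : ∀ (X : M.Str) (y : M.Num), M.mem y X → y < M.len X
  l2 : ∀ (X : M.Str) (y : M.Num), y + 1 = M.len X → M.mem y X
  se : ∀ X Y : M.Str, M.len X = M.len Y →
    (∀ i, i < M.len X → (M.mem i X ↔ M.mem i Y)) → X = Y

/-- `M` is a model of `V#L`: it satisfies `2-BASIC`, comprehension for all `Σ^B_0` formulas (with
parameters; the comprehended variable is number variable `0`), existence of products of strings in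
binary, and existence of powers of square integer matrices. -/
structure IsModel (M : TwoSorted.{u}) : Prop where
  basic : TwoBasic M
  comp : ∀ (φ : Sigma0B) (ν : ℕ → M.Num) (σ : ℕ → M.Str) (a : M.Num),
    ∃ Y : M.Str, M.len Y ≤ a ∧
      ∀ z, z < a → (M.mem z Y ↔ φ.Holds (Function.update ν 0 z) σ)
  string_mul : ∀ X Y : M.Str, ∃ Z : M.Str, IsProd (bits X) (bits Y) (bits Z)
  matrix_pow : ∀ (X : M.Str) (d k : M.Num), ∃ Y : M.Str, IsPow d (mat X) k (mat Y)

/-! ### The Pfaffian -/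

/-- The block diagonal matrix with blocks `(0 1; -1 0)`. -/
def matJ : Mat M := fun i j =>
  ⟨fun k => k = 0 ∧ ∃ h, i = h + h ∧ j = h + h + 1,
   fun k => k = 0 ∧ ∃ h, i = h + h + 1 ∧ j = h + h⟩

/-- The trailing part of a matrix, without its first `o` rows and columns. -/
def matTail (o : M.Num) (A : Mat M) : Mat M := fun i j => A (i + o) (j + o)

/-- `R J (M J) ^ k S` for a matrix `A` of order `2 (s + 1)` with block decomposition
`(0, a₁₂, R; -a₁₂, 0, -Sᵀ; -Rᵀ, S, M)`; here `R`, `S`, `M` have size `2 s`. -/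
def pbEntry (s : M.Num) (A : Mat M) (k : M.Num) : IntCode M :=
  let d := s + s
  let R : M.Num → IntCode M := fun j => A 0 (j + (1 + 1))
  let S : M.Num → IntCode M := fun i => A (i + (1 + 1)) 1
  let T : Mat M := matPow d (matMul d (matTail (1 + 1) A) matJ) k
  zSum d fun a => zMul (zSum d fun l => zMul (R l) (matJ l a)) (zSum d fun b => zMul (T a b) (S b))

/-- The Toeplitz matrix `P_A` of the Pfaffian Berkowitz algorithm for a matrix `A` of order
`2 (s + 1)`: below the zeros above the diagonal, its diagonals hold `1`, `a₁₂`, `R J S`, `R J (M J) S`,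
`R J (M J) ^ 2 S`, and so on. -/
def pbMatrix (s : M.Num) (A : Mat M) : Mat M := fun m l =>
  ⟨fun j => (m = l ∧ j = 0) ∨ (m = l + 1 ∧ (A 0 1).pos j) ∨
      ∃ k, m = l + (1 + 1) + k ∧ (pbEntry s A k).pos j,
   fun j => (m = l + 1 ∧ (A 0 1).neg j) ∨
      ∃ k, m = l + (1 + 1) + k ∧ (pbEntry s A k).neg j⟩

/-- `W` records the Pfaffian Berkowitz algorithm on `A` of order `2 n`. Its row `s ≤ n` holds the
Pfaffian coefficients `(p_s, …, p_0)`, in this order, of the trailing submatrix `A_s` of order `2 s`;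
this vector is `(1)` for `s = 0`, and for `s + 1` it is `P_{A_{s+1}}` times the vector for `s`. -/
def PfTrace (n : M.Num) (A : Mat M) (W : M.Str) : Prop :=
  cell W (pair 0 0) = zOne ∧
    ∀ s o, o + (s + 1) = n → ∀ m, m ≤ s + 1 →
      cell W (pair (s + 1) m) =
        zSum (s + 1) fun l => zMul (pbMatrix s (matTail (o + o) A) m l) (cell W (pair s l))

/-- The Pfaffian of a matrix `A` of order `2 n`: the last Pfaffian coefficient `p_0`. -/
def pf (n : M.Num) (A : Mat M) : IntCode M :=
  ⟨fun j => ∃ W, PfTrace n A W ∧ (cell W (pair n n)).pos j,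
   fun j => ∃ W, PfTrace n A W ∧ (cell W (pair n n)).neg j⟩

/-- `A` of order `d` is skew symmetric. -/
def Skew (d : M.Num) (A : Mat M) : Prop :=
  ∀ i j, i < d → j < d → (A i j).Same (zNeg (A j i))

/-- The block matrix `(0, A; -Aᵀ, 0)` of order `2 n`, for `A` of order `n`. -/
def matDouble (n : M.Num) (A : Mat M) : Mat M := fun i j =>
  ⟨fun k => (i < n ∧ ∃ c, j = n + c ∧ (A i c).pos k) ∨ (j < n ∧ ∃ r, i = n + r ∧ (A j r).neg k),
   fun k => (i < n ∧ ∃ c, j = n + c ∧ (A i c).neg k) ∨ (j < n ∧ ∃ r, i = n + r ∧ (A j r).pos k)⟩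

open scoped Classical in
/-- `(-1) ^ x · a`. -/
noncomputable def signed (x : M.Num) (a : IntCode M) : IntCode M :=
  if ∃ y, x = y + y then a else zNeg a

open scoped Classical in
/-- The determinant `(-1) ^ (n (n - 1) / 2) · pf (0, A; -Aᵀ, 0)` of `A` of order `n`
(`h = n (n - 1) / 2` is written as `2 h + n = n²`). -/
noncomputable def det (n : M.Num) (A : Mat M) : IntCode M :=
  if ∃ h, (h + h) + n = n * n ∧ ∃ y, h = y + y then pf n (matDouble n A)
  else zNeg (pf n (matDouble n A))

open scoped Classical in
/-- The increasing enumeration of the numbers different from `i`. -/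
noncomputable def skip (i a : M.Num) : M.Num := if a < i then a else a + 1

open scoped Classical in
/-- `A⟨i, j⟩`: the matrix `A` without rows `i, j` and columns `i, j` (for `i ≠ j`). -/
noncomputable def matDel (i j : M.Num) (A : Mat M) : Mat M := fun a b =>
  if i < j then A (skip j (skip i a)) (skip j (skip i b))
  else A (skip i (skip j a)) (skip i (skip j b))

open scoped Classical in
/-- Pfaffian cofactor expansion in `M`: for all skew symmetric `A` of order `2 n`, where `n = m + 1`,
and each row `i`, `pf A = ∑_{j ≠ i} (-1) ^ (i + j + Θ(j - i)) a_ij pf A⟨i, j⟩`. -/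
def PCE (M : TwoSorted.{u}) : Prop :=
  ∀ (m : M.Num) (A : M.Str), Skew ((m + 1) + (m + 1)) (mat A) →
    ∀ i, i < (m + 1) + (m + 1) →
      (pf (m + 1) (mat A)).Same
        (zSum ((m + 1) + (m + 1)) fun j =>
          if j = i then zZero
          else signed (i + j + if i < j then 1 else 0)
            (zMul (mat A i j) (pf m (matDel i j (mat A)))))

/-- Cayley's theorem in `M`: `det A = pf(A)²` for all skew symmetric `A` of order `2 n`. -/
def Cayley (M : TwoSorted.{u}) : Prop :=
  ∀ (n : M.Num) (A : M.Str), Skew (n + n) (mat A) →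
    (det (n + n) (mat A)).Same (zMul (pf n (mat A)) (pf n (mat A)))

end VSharpL

set_option linter.unusedSectionVars false
set_option linter.unusedVariables false

namespace VSharpL
universe u

/-- The models of `V#L`, as a class. -/
class Model (M : TwoSorted.{u}) : Prop where
  isModel : IsModel M
  nonempty_str : Nonempty M.Str

variable {M : TwoSorted.{u}} [hM : Model M]

namespace Num

theorem basic : TwoBasic M := hM.isModel.basic

theorem le_refl' (x : M.Num) : x ≤ x := by
  have := basic.b8 x 0
  rwa [basic.b3] at this

omit hM in
theorem lt_def (x y : M.Num) : x < y ↔ x ≤ y ∧ x ≠ y := Iff.rfl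

theorem induction_of_coded {P : M.Num → Prop}
    (hP : ∀ a, ∃ Y : M.Str, M.len Y ≤ a ∧ ∀ z, z < a → (M.mem z Y ↔ P z))
    (h0 : P 0) (hs : ∀ x, P x → P (x + 1)) (n : M.Num) : P n := by
  have B : TwoBasic M := basic
  obtain ⟨Y, hY, h⟩ := hP (n + 1)
  by_contra hn
  have hlt : ∀ x : M.Num, x < x + 1 := fun x => (B.b11 x x).1 (le_refl' x)
  by_cases hl : M.len Y = 0
  · have h0n : (0 : M.Num) < n + 1 := (B.b11 _ _).1 (B.b9 n)
    have := B.l1 Y 0 ((h 0 h0n).2 h0)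
    rw [hl] at this
    exact this.2 rfl
  · obtain ⟨y, -, hy⟩ := B.b12 _ hl
    have hyY : M.mem y Y := B.l2 Y y hy
    by_cases hyn : y + 1 = n + 1
    · have : y = n := B.b2 _ _ hyn
      subst this
      exact hn ((h y (hlt y)).1 hyY)
    · have h1 : y + 1 < n + 1 := ⟨hy ▸ hY, hyn⟩
      have h2 : y + 1 ≤ n := (B.b11 _ _).2 h1
      have h3 : y ≤ n := by
        rcases B.b10 y n with h | h
        · exact h
        · have h4 := (B.b11 _ _).1 h
          exact absurd (B.b7 _ _ h4.1 h2) h4.2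
      have h5 := (h y ((B.b11 _ _).1 h3)).1 hyY
      have h6 := B.l1 Y (y + 1) ((h _ h1).2 (hs _ h5))
      rw [hy] at h6
      exact h6.2 rfl

theorem induction_sigma (φ : Sigma0B) (ν : ℕ → M.Num) (σ : ℕ → M.Str)
    (h0 : φ.Holds (Function.update ν 0 0) σ)
    (hs : ∀ x, φ.Holds (Function.update ν 0 x) σ → φ.Holds (Function.update ν 0 (x + 1)) σ)
    (n : M.Num) : φ.Holds (Function.update ν 0 n) σ :=
  induction_of_coded (P := fun n => φ.Holds (Function.update ν 0 n) σ)
    (fun a => hM.isModel.comp φ ν σ a) h0 hs n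

/-- The assignment of `a`, `b`, `c` to the number variables `0`, `1`, `2`. -/
def assign (a b c : M.Num) : ℕ → M.Num := fun n => if n = 0 then a else if n = 1 then b else c

omit hM in
theorem update_assign (a b c x : M.Num) : Function.update (assign a b c) 0 x = assign x b c := by
  funext n
  by_cases h : n = 0 <;> simp [assign, h]

/-- Induction for an equation between number terms with two parameters. -/
theorem induction_eq (s t : NumTerm) (b c : M.Num)
    (h0 : ∀ σ, s.eval (assign 0 b c) σ = t.eval (assign 0 b c) σ)
    (hs : ∀ x σ, s.eval (assign x b c) σ = t.eval (assign x b c) σ →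
      s.eval (assign (x + 1) b c) σ = t.eval (assign (x + 1) b c) σ)
    (n : M.Num) : ∀ σ, s.eval (assign n b c) σ = t.eval (assign n b c) σ := by
  intro σ
  have := induction_sigma (.eqNum s t) (assign 0 b c) σ
  simp only [update_assign, Sigma0B.Holds] at this
  exact this (h0 σ) (fun x => hs x σ) n

theorem add_assoc' (a b c : M.Num) : a + b + c = a + (b + c) := by
  have B : TwoBasic M := basic
  obtain ⟨X⟩ := hM.nonempty_str
  refine induction_eq (.add (.add (.var 1) (.var 2)) (.var 0)) (.add (.var 1) (.add (.var 2) (.var 0)))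
    a b ?_ ?_ c (fun _ => X)
  · intro σ; simp [NumTerm.eval, assign, B.b3]
  · intro x σ h
    simp only [NumTerm.eval, assign] at h ⊢
    simp at h ⊢
    rw [B.b4, B.b4, B.b4, h]

theorem zero_add' (a : M.Num) : 0 + a = a := by
  have B : TwoBasic M := basic
  obtain ⟨X⟩ := hM.nonempty_str
  refine induction_eq (.add .zero (.var 0)) (.var 0) 0 0 ?_ ?_ a (fun _ => X)
  · intro σ; simp [NumTerm.eval, assign, B.b3]
  · intro x σ h
    simp [NumTerm.eval, assign] at h ⊢
    rw [B.b4, h]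

theorem succ_add' (a b : M.Num) : a + 1 + b = a + b + 1 := by
  have B : TwoBasic M := basic
  obtain ⟨X⟩ := hM.nonempty_str
  refine induction_eq (.add (.add (.var 1) .one) (.var 0)) (.add (.add (.var 1) (.var 0)) .one)
    a 0 ?_ ?_ b (fun _ => X)
  · intro σ; simp [NumTerm.eval, assign, B.b3]
  · intro x σ h
    simp [NumTerm.eval, assign] at h ⊢
    rw [B.b4, B.b4, h]

theorem add_comm' (a b : M.Num) : a + b = b + a := by
  have B : TwoBasic M := basic
  obtain ⟨X⟩ := hM.nonempty_str
  refine induction_eq (.add (.var 1) (.var 0)) (.add (.var 0) (.var 1)) a 0 ?_ ?_ b (fun _ => X)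
  · intro σ; simp [NumTerm.eval, assign, B.b3, zero_add']
  · intro x σ h
    simp [NumTerm.eval, assign] at h ⊢
    rw [B.b4, succ_add', h]

theorem zero_mul' (a : M.Num) : 0 * a = 0 := by
  have B : TwoBasic M := basic
  obtain ⟨X⟩ := hM.nonempty_str
  refine induction_eq (.mul .zero (.var 0)) .zero 0 0 ?_ ?_ a (fun _ => X)
  · intro σ; simp [NumTerm.eval, assign, B.b5]
  · intro x σ h
    simp [NumTerm.eval, assign] at h ⊢
    rw [B.b6, h, B.b3]

instance : AddCommMonoid M.Num where
  add := (· + ·)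
  zero := 0
  add_assoc := add_assoc'
  zero_add := zero_add'
  add_zero := basic.b3
  add_comm := add_comm'
  nsmul := nsmulRec

theorem succ_mul' (a b : M.Num) : (a + 1) * b = a * b + b := by
  have B : TwoBasic M := basic
  obtain ⟨X⟩ := hM.nonempty_str
  refine induction_eq (.mul (.add (.var 1) .one) (.var 0)) (.add (.mul (.var 1) (.var 0)) (.var 0))
    a 0 ?_ ?_ b (fun _ => X)
  · intro σ; simp [NumTerm.eval, assign, B.b3, B.b5]
  · intro x σ h
    simp [NumTerm.eval, assign] at h ⊢
    rw [B.b6, B.b6, h]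
    ac_rfl

theorem mul_comm' (a b : M.Num) : a * b = b * a := by
  have B : TwoBasic M := basic
  obtain ⟨X⟩ := hM.nonempty_str
  refine induction_eq (.mul (.var 1) (.var 0)) (.mul (.var 0) (.var 1)) a 0 ?_ ?_ b (fun _ => X)
  · intro σ; simp [NumTerm.eval, assign, B.b5, zero_mul']
  · intro x σ h
    simp [NumTerm.eval, assign] at h ⊢
    rw [B.b6, succ_mul', h]

theorem mul_add' (a b c : M.Num) : a * (b + c) = a * b + a * c := by
  have B : TwoBasic M := basic
  obtain ⟨X⟩ := hM.nonempty_str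
  refine induction_eq (.mul (.var 1) (.add (.var 2) (.var 0)))
    (.add (.mul (.var 1) (.var 2)) (.mul (.var 1) (.var 0))) a b ?_ ?_ c (fun _ => X)
  · intro σ; simp [NumTerm.eval, assign, B.b5, B.b3]
  · intro x σ h
    simp [NumTerm.eval, assign] at h ⊢
    rw [B.b4, B.b6, B.b6, h, add_assoc']

theorem mul_assoc' (a b c : M.Num) : a * b * c = a * (b * c) := by
  have B : TwoBasic M := basic
  obtain ⟨X⟩ := hM.nonempty_str
  refine induction_eq (.mul (.mul (.var 1) (.var 2)) (.var 0))
    (.mul (.var 1) (.mul (.var 2) (.var 0))) a b ?_ ?_ c (fun _ => X)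
  · intro σ; simp [NumTerm.eval, assign, B.b5]
  · intro x σ h
    simp [NumTerm.eval, assign] at h ⊢
    rw [B.b6, B.b6, h, mul_add']

theorem one_mul' (a : M.Num) : 1 * a = a := by
  have B : TwoBasic M := basic
  have := succ_mul' 0 a
  rwa [zero_add', zero_mul', zero_add'] at this

instance : CommSemiring M.Num where
  mul := (· * ·)
  one := 1
  mul_assoc := mul_assoc'
  one_mul := one_mul'
  mul_one a := by rw [mul_comm', one_mul']
  left_distrib := mul_add'
  right_distrib a b c := by rw [mul_comm', mul_add', mul_comm' c a, mul_comm' c b]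
  zero_mul := zero_mul'
  mul_zero := basic.b5
  mul_comm := mul_comm'

theorem add_right_cancel' {a b : M.Num} (c : M.Num) : a + c = b + c → a = b := by
  have B : TwoBasic M := basic
  obtain ⟨X⟩ := hM.nonempty_str
  have := induction_sigma (.or (.not (.eqNum (.add (.var 1) (.var 0)) (.add (.var 2) (.var 0))))
    (.eqNum (.var 1) (.var 2))) (assign 0 a b) (fun _ => X) ?_ ?_ c
  · simpa [update_assign, Sigma0B.Holds, NumTerm.eval, assign, or_iff_not_imp_left] using this
  · simp [Sigma0B.Holds, NumTerm.eval, assign, or_iff_not_imp_left]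
  · intro x
    simp only [update_assign, Sigma0B.Holds, NumTerm.eval, assign, or_iff_not_imp_left]
    simp only [not_not, one_ne_zero, if_true, if_false, OfNat.ofNat_ne_zero, OfNat.ofNat_ne_one]
    intro h h'
    rw [← add_assoc, ← add_assoc] at h'
    exact h (B.b2 _ _ h')

theorem exists_add_or (a b : M.Num) : (∃ c, a + c = b) ∨ ∃ c, b + c = a := by
  have B : TwoBasic M := basic
  obtain ⟨X⟩ := hM.nonempty_str
  have := induction_sigma (.or (.ex 2 (.var 0) (.eqNum (.add (.var 1) (.var 2)) (.var 0)))
      (.ex 2 (.var 1) (.eqNum (.add (.var 0) (.var 2)) (.var 1)))) (assign 0 a a) (fun _ => X) ?_ ?_ b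
  · simp [update_assign, Sigma0B.Holds, NumTerm.eval, assign] at this
    grind
  · simp [update_assign, Sigma0B.Holds, NumTerm.eval, assign]
    right
    exact le_refl' _
  · intro x
    simp [update_assign, Sigma0B.Holds, NumTerm.eval, assign]
    rintro (⟨c, hc, h⟩ | ⟨c, hc, h⟩)
    · left
      refine ⟨c + 1, ?_, ?_⟩
      · rw [← h, add_comm a c, add_assoc, add_comm a 1, ← add_assoc]
        exact B.b8 _ _
      · rw [← h, add_assoc]
    · by_cases h0 : c = 0
      · left
        refine ⟨1, ?_, ?_⟩
        · rw [add_comm]; exact B.b8 _ _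
        · rw [← h, h0, add_zero]
      · right
        obtain ⟨d, hd, rfl⟩ := B.b12 c h0
        refine ⟨d, ?_, ?_⟩
        · rw [← h, ← add_assoc, add_assoc, add_comm, add_assoc]; exact B.b8 _ _
        · rw [← h]; ring

theorem le_iff_exists (a b : M.Num) : a ≤ b ↔ ∃ c, b = a + c := by
  have B : TwoBasic M := basic
  constructor
  · intro h
    rcases exists_add_or a b with ⟨c, hc⟩ | ⟨c, hc⟩
    · exact ⟨c, hc.symm⟩
    · have h1 := B.b8 b c
      rw [hc] at h1
      exact ⟨0, by rw [add_zero]; exact B.b7 _ _ h1 h⟩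
  · rintro ⟨c, rfl⟩
    exact B.b8 _ _

noncomputable instance : LinearOrder M.Num where
  le_refl := le_refl'
  le_trans a b c h1 h2 := by
    obtain ⟨x, rfl⟩ := (le_iff_exists _ _).1 h1
    obtain ⟨y, rfl⟩ := (le_iff_exists _ _).1 h2
    rw [add_assoc]
    exact basic.b8 _ _
  le_antisymm := basic.b7
  le_total := basic.b10
  lt_iff_le_not_ge a b := by
    rw [lt_def]
    refine and_congr_right fun h => ?_
    constructor
    · intro h1 h2; exact h1 (basic.b7 _ _ h h2)
    · rintro h1 rfl; exact h1 h
  toDecidableLE := Classical.decRel _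

theorem add_one_ne_zero (a : M.Num) : a + 1 ≠ 0 := basic.b1 a

instance : IsOrderedCancelAddMonoid M.Num where
  add_le_add_left a b h c := by
    obtain ⟨x, rfl⟩ := (le_iff_exists _ _).1 h
    rw [le_iff_exists]
    exact ⟨x, by ring⟩
  le_of_add_le_add_left a b c h := by
    obtain ⟨x, hx⟩ := (le_iff_exists _ _).1 h
    rw [le_iff_exists]
    exact ⟨x, add_right_cancel' a (by rw [add_comm c, hx]; ring)⟩

instance : CanonicallyOrderedAdd M.Num where
  exists_add_of_le h := (le_iff_exists _ _).1 h
  le_add_self a b := by rw [add_comm]; exact basic.b8 _ _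
  le_self_add := basic.b8

theorem lt_add_one_iff {a b : M.Num} : a < b + 1 ↔ a ≤ b := (basic.b11 a b).symm

theorem add_one_le_iff {a b : M.Num} : a + 1 ≤ b ↔ a < b := by
  rw [← lt_add_one_iff]
  exact add_lt_add_iff_right 1

instance : NoMaxOrder M.Num := ⟨fun a => ⟨a + 1, lt_add_one_iff.2 le_rfl⟩⟩

theorem eq_zero_or_succ (a : M.Num) : a = 0 ∨ ∃ b, a = b + 1 := by
  by_cases h : a = 0
  · exact .inl h
  · obtain ⟨y, -, hy⟩ := basic.b12 a h
    exact .inr ⟨y, hy.symm⟩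

instance : Nontrivial M.Num := ⟨1, 0, by simp⟩

instance : IsOrderedRing M.Num where
  zero_le_one := basic.b9 1
  mul_le_mul_of_nonneg_left a ha b c h := by
    obtain ⟨x, rfl⟩ := (le_iff_exists _ _).1 h
    rw [le_iff_exists]
    exact ⟨a * x, by ring⟩
  mul_le_mul_of_nonneg_right a ha b c h := by
    obtain ⟨x, rfl⟩ := (le_iff_exists _ _).1 h
    rw [le_iff_exists]
    exact ⟨x * a, by ring⟩

instance : IsStrictOrderedRing M.Num where
  mul_lt_mul_of_pos_left a ha b c h := by
    obtain ⟨x, rfl⟩ := (le_iff_exists _ _).1 (add_one_le_iff.2 h)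
    rw [← add_one_le_iff, le_iff_exists]
    obtain ⟨y, rfl⟩ := (le_iff_exists _ _).1 (add_one_le_iff.2 ha)
    exact ⟨y + (0 + 1 + y) * x, by ring⟩
  mul_lt_mul_of_pos_right a ha b c h := by
    obtain ⟨x, rfl⟩ := (le_iff_exists _ _).1 (add_one_le_iff.2 h)
    rw [← add_one_le_iff, le_iff_exists]
    obtain ⟨y, rfl⟩ := (le_iff_exists _ _).1 (add_one_le_iff.2 ha)
    exact ⟨y + (0 + 1 + y) * x, by ring⟩

open Classical in
noncomputable instance : Sub M.Num := ⟨fun a b => if h : ∃ c, a = b + c then h.choose else 0⟩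

open Classical in
theorem sub_of_le {a b : M.Num} (h : b ≤ a) : a = b + (a - b) := by
  have h' := (le_iff_exists _ _).1 h
  show a = b + (if h : ∃ c, a = b + c then h.choose else 0)
  rw [dif_pos h']
  exact h'.choose_spec

open Classical in
theorem sub_of_lt {a b : M.Num} (h : a < b) : a - b = 0 := by
  show (if h : ∃ c, a = b + c then h.choose else 0) = 0
  rw [dif_neg]
  rintro ⟨c, rfl⟩
  exact absurd h (by simp)

instance : OrderedSub M.Num where
  tsub_le_iff_right a b c := by
    rcases le_or_gt b a with h | h
    · conv_rhs => rw [sub_of_le h, add_comm b]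
      simp
    · rw [sub_of_lt h]
      simp only [zero_le, true_iff]
      exact h.le.trans le_add_self

theorem eq_add_one_of_lt {a b : M.Num} (h : a < b) : ∃ c, b = c + 1 ∧ a ≤ c := by
  obtain ⟨x, rfl⟩ := (le_iff_exists _ _).1 (add_one_le_iff.2 h)
  exact ⟨a + x, by ring, by simp⟩

/-! ### The pairing function -/

theorem le_pair_left (x y : M.Num) : x ≤ pair x y := by
  rw [le_iff_exists]
  exact ⟨x * x + x * y + x * y + y * y + y + y + y, by unfold pair; ring⟩

theorem le_pair_right (x y : M.Num) : y ≤ pair x y := by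
  rw [le_iff_exists]
  exact ⟨(x + y) * (x + y + 1) + y, by unfold pair; ring⟩

theorem pair_le_pair {x y x' y' : M.Num} (hx : x ≤ x') (hy : y ≤ y') : pair x y ≤ pair x' y' := by
  unfold pair
  gcongr

theorem pair_lt_pair_right {x y y' : M.Num} (hy : y < y') : pair x y < pair x y' := by
  unfold pair
  gcongr

theorem pair_lt_of_add_lt {x y x' y' : M.Num} (h : x + y < x' + y') : pair x y < pair x' y' := by
  obtain ⟨c, hc⟩ := (le_iff_exists _ _).1 (add_one_le_iff.2 h)
  rw [← add_one_le_iff, le_iff_exists]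
  unfold pair
  rw [hc]
  exact ⟨x + x + 1 + (x + y + 1 + c) * c + c * (x + y + 1 + 1) + y' + y', by ring⟩

theorem pair_inj {x y x' y' : M.Num} : pair x y = pair x' y' ↔ x = x' ∧ y = y' := by
  refine ⟨fun h => ?_, by rintro ⟨rfl, rfl⟩; rfl⟩
  have hs : x + y = x' + y' := by
    rcases lt_trichotomy (x + y) (x' + y') with h1 | h1 | h1
    · exact absurd h (pair_lt_of_add_lt h1).ne
    · exact h1
    · exact absurd h (pair_lt_of_add_lt h1).ne'
  have hy : y = y' := by
    unfold pair at h
    rw [hs] at h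
    have h2 := add_left_cancel h
    rcases lt_trichotomy y y' with h1 | h1 | h1
    · exact absurd h2 (add_lt_add h1 h1).ne
    · exact h1
    · exact absurd h2 (add_lt_add h1 h1).ne'
  subst hy
  exact ⟨add_right_cancel hs, rfl⟩

end Num
end VSharpL

namespace VSharpL
universe u v w
variable {M : TwoSorted.{u}} [hM : Model M]

/-! ### Coded families -/

/-- `P` is coded by strings on every initial segment. -/
def AdmProp (P : M.Num → Prop) : Prop := ∀ a, ∃ Y : M.Str, ∀ z, M.mem z Y ↔ z < a ∧ P z

/-- `R` is coded by strings on every initial segment. -/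
def AdmRel (R : M.Num → M.Num → Prop) : Prop :=
  ∀ a b, ∃ W : M.Str, ∀ x y, M.mem (pair x y) W ↔ x < a ∧ y < b ∧ R x y

def AdmNum (h : M.Num → M.Num) : Prop :=
  (∀ a, ∃ b, ∀ z, z < a → h z < b) ∧ AdmRel fun z y => h z = y

def AdmStr (X : M.Num → M.Str) : Prop :=
  ∀ a, ∃ W : M.Str, ∀ z, z < a → ∀ i, M.mem (pair z i) W ↔ M.mem i (X z)

theorem lt_len_of_mem {X : M.Str} {i : M.Num} (h : M.mem i X) : i < M.len X := Num.basic.l1 X i h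

theorem exists_str_of_formula (φ : Sigma0B) (ν : ℕ → M.Num) (σ : ℕ → M.Str) (a : M.Num) :
    ∃ Y : M.Str, ∀ z, M.mem z Y ↔ z < a ∧ φ.Holds (Function.update ν 0 z) σ := by
  obtain ⟨Y, hY, h⟩ := hM.isModel.comp φ ν σ a
  refine ⟨Y, fun z => ⟨fun hz => ?_, fun hz => (h z hz.1).2 hz.2⟩⟩
  have hza := (lt_len_of_mem hz).trans_le hY
  exact ⟨hza, (h z hza).1 hz⟩

/-- The term `⟨s, t⟩`. -/
def NumTerm.pair (s t : NumTerm) : NumTerm :=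
  .add (.mul (.add s t) (.add (.add s t) .one)) (.add t t)

omit hM in
@[simp] theorem NumTerm.eval_pair (ν : ℕ → M.Num) (σ : ℕ → M.Str) (s t : NumTerm) :
    (NumTerm.pair s t).eval ν σ = VSharpL.pair (s.eval ν σ) (t.eval ν σ) := rfl

/-- The assignment for formulas that define binary relations: the variables `1` and `2` are the
arguments, the variables `3`, `4`, `5` are parameters. -/
def assign2 (a b c x y : M.Num) : ℕ → M.Num := fun n =>
  if n = 0 then pair x y else if n = 1 then x else if n = 2 then y else
  if n = 3 then a else if n = 4 then b else c

/-- The assignment for formulas that define sets: variable `0` is the argument. -/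
def assign1 (b z : M.Num) : ℕ → M.Num := fun n => if n = 0 then z else b

/-- Two strings as an assignment. -/
def strs (X Y : M.Str) : ℕ → M.Str := fun n => if n = 0 then X else Y

theorem AdmRel.of_formula {R : M.Num → M.Num → Prop}
    (h : ∀ a b, ∃ (φ : Sigma0B) (σ : ℕ → M.Str) (c : M.Num), ∀ x y, x < a → y < b →
      (φ.Holds (assign2 a b c x y) σ ↔ R x y)) : AdmRel R := by
  intro a b
  obtain ⟨φ, σ, c, hφ⟩ := h a b
  obtain ⟨W, hW⟩ := exists_str_of_formula
    (.ex 1 (.var 0) (.ex 2 (.var 0) (.and (.eqNum (.var 0) (.pair (.var 1) (.var 2)))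
      (.and (.and (.le (.var 1) (.var 3)) (.not (.eqNum (.var 1) (.var 3))))
        (.and (.and (.le (.var 2) (.var 4)) (.not (.eqNum (.var 2) (.var 4)))) φ)))))
    (assign2 a b c 0 0) σ (pair a b + 1)
  refine ⟨W, fun x y => (hW _).trans ?_⟩
  have key : ∀ x y : M.Num, Function.update (Function.update (Function.update
      (assign2 a b c 0 0) 0 (pair x y)) 1 x) 2 y = assign2 a b c x y := by
    intro x y; funext n
    simp only [Function.update_apply, assign2]
    split_ifs <;> simp_all
  simp only [Sigma0B.Holds]
  constructor
  · rintro ⟨-, x', -, y', -, h1, h2, h3, h4⟩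
    have h5 : pair x y = pair x' y' := by simpa [NumTerm.eval] using h1
    obtain ⟨rfl, rfl⟩ := Num.pair_inj.1 h5
    rw [key] at h2 h3 h4
    have h6 : x < a := h2
    have h7 : y < b := h3
    exact ⟨h6, h7, (hφ x y h6 h7).1 h4⟩
  · rintro ⟨h1, h2, h3⟩
    refine ⟨?_, x, Num.le_pair_left x y, y, ?_, ?_, ?_⟩
    · exact Num.lt_add_one_iff.2 (Num.pair_le_pair h1.le h2.le)
    · simpa [NumTerm.eval] using Num.le_pair_right x y
    · simp [NumTerm.eval]
    · rw [key]
      exact ⟨h1, h2, (hφ x y h1 h2).2 h3⟩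

theorem AdmProp.of_formula {P : M.Num → Prop}
    (h : ∀ a, ∃ (φ : Sigma0B) (σ : ℕ → M.Str) (b : M.Num), ∀ z, z < a →
      (φ.Holds (assign1 b z) σ ↔ P z)) : AdmProp P := by
  intro a
  obtain ⟨φ, σ, b, hφ⟩ := h a
  obtain ⟨Y, hY⟩ := exists_str_of_formula φ (assign1 b 0) σ a
  have key : ∀ z, Function.update (assign1 b 0) 0 z = assign1 b z := by
    intro z; funext n
    simp only [Function.update_apply, assign1]
    split_ifs <;> rfl
  refine ⟨Y, fun z => (hY z).trans (and_congr_right fun hz => ?_)⟩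
  rw [key]
  exact hφ z hz

theorem AdmProp.and {P Q : M.Num → Prop} (hP : AdmProp P) (hQ : AdmProp Q) :
    AdmProp fun z => P z ∧ Q z := by
  refine .of_formula fun a => ?_
  obtain ⟨X, hX⟩ := hP a
  obtain ⟨Y, hY⟩ := hQ a
  refine ⟨.and (.mem (.var 0) 0) (.mem (.var 0) 1), strs X Y, 0, fun z hz => ?_⟩
  simp [Sigma0B.Holds, NumTerm.eval, assign1, strs, hX, hY, hz]

theorem AdmProp.not {P : M.Num → Prop} (hP : AdmProp P) : AdmProp fun z => ¬ P z := by
  refine .of_formula fun a => ?_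
  obtain ⟨X, hX⟩ := hP a
  refine ⟨.not (.mem (.var 0) 0), strs X X, 0, fun z hz => ?_⟩
  simp [Sigma0B.Holds, NumTerm.eval, assign1, strs, hX, hz]

theorem AdmProp.ex {R : M.Num → M.Num → Prop} {t : M.Num → M.Num} (hR : AdmRel R)
    (ht : AdmNum t) : AdmProp fun z => ∃ y, y < t z ∧ R z y := by
  refine .of_formula fun a => ?_
  obtain ⟨b, hb⟩ := ht.1 a
  obtain ⟨X, hX⟩ := ht.2 a b
  obtain ⟨Y, hY⟩ := hR a b
  refine ⟨.ex 1 (.var 1) (.and (.mem (.pair (.var 0) (.var 1)) 0)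
    (.ex 2 (.var 1) (.and (.not (.eqNum (.var 2) (.var 1))) (.mem (.pair (.var 0) (.var 2)) 1)))),
    strs X Y, b, fun z hz => ?_⟩
  simp only [Sigma0B.Holds, NumTerm.eval, NumTerm.eval_pair, Function.update_apply, assign1, strs]
  simp only [hX, hY, hz, one_ne_zero, zero_ne_one, if_true, if_false, OfNat.ofNat_ne_zero,
    OfNat.ofNat_ne_one, OfNat.zero_ne_ofNat, OfNat.one_ne_ofNat, true_and]
  constructor
  · rintro ⟨y', h1, ⟨h2, rfl⟩, y, h3, h4, h5, h6⟩
    exact ⟨y, lt_of_le_of_ne h3 h4, h6⟩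
  · rintro ⟨y, h1, h2⟩
    exact ⟨t z, (hb z hz).le, ⟨hb z hz, rfl⟩, y, h1.le, h1.ne, h1.trans (hb z hz), h2⟩

theorem AdmProp.precomp {P : M.Num → Prop} {h : M.Num → M.Num} (hP : AdmProp P)
    (hh : AdmNum h) : AdmProp fun z => P (h z) := by
  refine .of_formula fun a => ?_
  obtain ⟨b, hb⟩ := hh.1 a
  obtain ⟨X, hX⟩ := hh.2 a b
  obtain ⟨Y, hY⟩ := hP b
  refine ⟨.ex 1 (.var 1) (.and (.mem (.pair (.var 0) (.var 1)) 0) (.mem (.var 1) 1)),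
    strs X Y, b, fun z hz => ?_⟩
  simp only [Sigma0B.Holds, NumTerm.eval, NumTerm.eval_pair, Function.update_apply, assign1, strs]
  simp only [hX, hY, hz, one_ne_zero, zero_ne_one, if_true, if_false, true_and]
  constructor
  · rintro ⟨y, h1, ⟨h2, rfl⟩, h3⟩
    exact h3.2
  · intro h1
    exact ⟨h z, (hb z hz).le, ⟨hb z hz, rfl⟩, hb z hz, h1⟩

theorem AdmProp.mem {X : M.Num → M.Str} {h : M.Num → M.Num} (hX : AdmStr X)
    (hh : AdmNum h) : AdmProp fun z => M.mem (h z) (X z) := by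
  refine .of_formula fun a => ?_
  obtain ⟨b, hb⟩ := hh.1 a
  obtain ⟨H, hH⟩ := hh.2 a b
  obtain ⟨W, hW⟩ := hX a
  refine ⟨.ex 1 (.var 1) (.and (.mem (.pair (.var 0) (.var 1)) 0) (.mem (.pair (.var 0) (.var 1)) 1)),
    strs H W, b, fun z hz => ?_⟩
  simp only [Sigma0B.Holds, NumTerm.eval, NumTerm.eval_pair, Function.update_apply, assign1, strs]
  simp only [hH, hW z hz, hz, one_ne_zero, zero_ne_one, if_true, if_false, true_and]
  constructor
  · rintro ⟨y, h1, ⟨h2, rfl⟩, h3⟩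
    exact h3
  · intro h1
    exact ⟨h z, (hb z hz).le, ⟨hb z hz, rfl⟩, h1⟩

theorem AdmNum.exists_bound₂ {h k : M.Num → M.Num} (hh : AdmNum h) (hk : AdmNum k) (a : M.Num) :
    ∃ b, ∀ z, z < a → h z < b ∧ k z < b := by
  obtain ⟨b, hb⟩ := hh.1 a
  obtain ⟨c, hc⟩ := hk.1 a
  exact ⟨b + c, fun z hz => ⟨(hb z hz).trans_le le_self_add, (hc z hz).trans_le le_add_self⟩⟩

theorem AdmProp.eq {h k : M.Num → M.Num} (hh : AdmNum h) (hk : AdmNum k) :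
    AdmProp fun z => h z = k z := by
  refine .of_formula fun a => ?_
  obtain ⟨b, hb⟩ := hh.exists_bound₂ hk a
  obtain ⟨X, hX⟩ := hh.2 a b
  obtain ⟨Y, hY⟩ := hk.2 a b
  refine ⟨.ex 1 (.var 1) (.and (.mem (.pair (.var 0) (.var 1)) 0) (.mem (.pair (.var 0) (.var 1)) 1)),
    strs X Y, b, fun z hz => ?_⟩
  simp only [Sigma0B.Holds, NumTerm.eval, NumTerm.eval_pair, Function.update_apply, assign1, strs]
  simp only [hX, hY, hz, one_ne_zero, zero_ne_one, if_true, if_false, true_and]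
  constructor
  · rintro ⟨y, h1, ⟨h2, rfl⟩, h3⟩
    exact h3.2.symm
  · intro h1
    exact ⟨h z, (hb z hz).1.le, ⟨(hb z hz).1, rfl⟩, (hb z hz).1, h1.symm⟩

theorem AdmProp.le {h k : M.Num → M.Num} (hh : AdmNum h) (hk : AdmNum k) :
    AdmProp fun z => h z ≤ k z := by
  refine .of_formula fun a => ?_
  obtain ⟨b, hb⟩ := hh.exists_bound₂ hk a
  obtain ⟨X, hX⟩ := hh.2 a b
  obtain ⟨Y, hY⟩ := hk.2 a b
  refine ⟨.ex 1 (.var 1) (.and (.mem (.pair (.var 0) (.var 1)) 0) (.ex 2 (.var 2)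
    (.and (.mem (.pair (.var 0) (.var 2)) 1) (.le (.var 1) (.var 2))))), strs X Y, b, fun z hz => ?_⟩
  simp only [Sigma0B.Holds, NumTerm.eval, NumTerm.eval_pair, Function.update_apply, assign1, strs]
  simp only [hX, hY, hz, one_ne_zero, zero_ne_one, if_true, if_false, true_and, OfNat.ofNat_ne_zero,
    OfNat.ofNat_ne_one, OfNat.zero_ne_ofNat, OfNat.one_ne_ofNat]
  constructor
  · rintro ⟨y, h1, ⟨h2, rfl⟩, x, h3, ⟨h4, rfl⟩, h5⟩
    exact h5
  · intro h1
    exact ⟨h z, (hb z hz).1.le, ⟨(hb z hz).1, rfl⟩, k z, (hb z hz).2.le, ⟨(hb z hz).2, rfl⟩, h1⟩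

theorem AdmNum.const (c : M.Num) : AdmNum fun _ => c := by
  refine ⟨fun a => ⟨c + 1, fun _ _ => Num.lt_add_one_iff.2 le_rfl⟩, .of_formula fun a b => ?_⟩
  obtain ⟨X⟩ := hM.nonempty_str
  refine ⟨.eqNum (.var 5) (.var 2), fun _ => X, c, fun x y _ _ => ?_⟩
  simp [Sigma0B.Holds, NumTerm.eval, assign2]

theorem AdmNum.id : AdmNum fun z : M.Num => z := by
  refine ⟨fun a => ⟨a, fun _ h => h⟩, .of_formula fun a b => ?_⟩
  obtain ⟨X⟩ := hM.nonempty_str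
  refine ⟨.eqNum (.var 1) (.var 2), fun _ => X, 0, fun x y _ _ => ?_⟩
  simp [Sigma0B.Holds, NumTerm.eval, assign2]

theorem AdmNum.map₂ {h k : M.Num → M.Num} (hh : AdmNum h) (hk : AdmNum k)
    (f : M.Num → M.Num → M.Num) (t : NumTerm)
    (ht : ∀ ν : ℕ → M.Num, ∀ σ, t.eval ν σ = f (ν 6) (ν 7))
    (hf : ∀ x x' y y' : M.Num, x ≤ x' → y ≤ y' → f x y ≤ f x' y') :
    AdmNum fun z => f (h z) (k z) := by
  refine ⟨fun a => ?_, .of_formula fun a b => ?_⟩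
  · obtain ⟨b, hb⟩ := hh.exists_bound₂ hk a
    exact ⟨f b b + 1, fun z hz => Num.lt_add_one_iff.2 (hf _ _ _ _ (hb z hz).1.le (hb z hz).2.le)⟩
  obtain ⟨c, hc⟩ := hh.exists_bound₂ hk a
  obtain ⟨X, hX⟩ := hh.2 a c
  obtain ⟨Y, hY⟩ := hk.2 a c
  refine ⟨.ex 6 (.var 5) (.ex 7 (.var 5) (.and (.mem (.pair (.var 1) (.var 6)) 0)
    (.and (.mem (.pair (.var 1) (.var 7)) 1) (.eqNum t (.var 2))))), strs X Y, c,
    fun x y hx hy => ?_⟩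
  simp only [Sigma0B.Holds, NumTerm.eval, NumTerm.eval_pair, Function.update_apply, assign2, strs, ht]
  norm_num [hX, hY, hx]
  constructor
  · rintro ⟨_, h1, _, h2, ⟨h3, rfl⟩, ⟨h4, rfl⟩, h5⟩
    exact h5
  · intro h1
    exact ⟨h x, (hc x hx).1.le, k x, (hc x hx).2.le, ⟨(hc x hx).1, rfl⟩, ⟨(hc x hx).2, rfl⟩, h1⟩

theorem AdmNum.add {h k : M.Num → M.Num} (hh : AdmNum h) (hk : AdmNum k) :
    AdmNum fun z => h z + k z :=
  hh.map₂ hk (· + ·) (.add (.var 6) (.var 7)) (fun _ _ => rfl) fun _ _ _ _ => add_le_add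

theorem AdmNum.mul {h k : M.Num → M.Num} (hh : AdmNum h) (hk : AdmNum k) :
    AdmNum fun z => h z * k z :=
  hh.map₂ hk (· * ·) (.mul (.var 6) (.var 7)) (fun _ _ => rfl) fun _ _ _ _ => mul_le_mul'

theorem AdmNum.precomp {h k : M.Num → M.Num} (hh : AdmNum h) (hk : AdmNum k) :
    AdmNum fun z => h (k z) := by
  refine ⟨fun a => ?_, .of_formula fun a b => ?_⟩
  · obtain ⟨b, hb⟩ := hk.1 a
    obtain ⟨c, hc⟩ := hh.1 b
    exact ⟨c, fun z hz => hc _ (hb z hz)⟩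
  obtain ⟨c, hc⟩ := hk.1 a
  obtain ⟨X, hX⟩ := hk.2 a c
  obtain ⟨Y, hY⟩ := hh.2 c b
  refine ⟨.ex 6 (.var 5) (.and (.mem (.pair (.var 1) (.var 6)) 0)
    (.mem (.pair (.var 6) (.var 2)) 1)), strs X Y, c, fun x y hx hy => ?_⟩
  simp only [Sigma0B.Holds, NumTerm.eval, NumTerm.eval_pair, Function.update_apply, assign2, strs]
  norm_num [hX, hY, hx, hy]
  constructor
  · rintro ⟨_, h1, ⟨h3, rfl⟩, h4⟩
    exact h4.2
  · intro h1
    exact ⟨k x, (hc x hx).le, ⟨hc x hx, rfl⟩, hc x hx, h1⟩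

open Classical in
/-- The first component of a pair. -/
noncomputable def fstNum (z : M.Num) : M.Num := if h : ∃ x y, z = pair x y then h.choose else 0

open Classical in
/-- The second component of a pair. -/
noncomputable def sndNum (z : M.Num) : M.Num :=
  if h : ∃ x y, z = pair x y then h.choose_spec.choose else 0

open Classical in
@[simp] theorem fstNum_pair (x y : M.Num) : fstNum (pair x y) = x := by
  have h : ∃ x' y', pair x y = pair x' y' := ⟨x, y, rfl⟩
  rw [fstNum, dif_pos h]
  exact (Num.pair_inj.1 h.choose_spec.choose_spec).1.symm

open Classical in
@[simp] theorem sndNum_pair (x y : M.Num) : sndNum (pair x y) = y := by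
  have h : ∃ x' y', pair x y = pair x' y' := ⟨x, y, rfl⟩
  rw [sndNum, dif_pos h]
  exact (Num.pair_inj.1 h.choose_spec.choose_spec).2.symm

open Classical in
theorem fstNum_of_not {z : M.Num} (h : ¬ ∃ x y, z = pair x y) : fstNum z = 0 := dif_neg h

open Classical in
theorem sndNum_of_not {z : M.Num} (h : ¬ ∃ x y, z = pair x y) : sndNum z = 0 := dif_neg h

theorem AdmNum.fstNum : AdmNum (fstNum : M.Num → M.Num) := by
  refine ⟨fun a => ⟨a + 1, fun z hz => ?_⟩, .of_formula fun a b => ?_⟩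
  · by_cases h : ∃ x y, z = pair x y
    · obtain ⟨x, y, rfl⟩ := h
      rw [fstNum_pair]
      exact Num.lt_add_one_iff.2 ((Num.le_pair_left x y).trans hz.le)
    · rw [fstNum_of_not h]
      exact Num.lt_add_one_iff.2 (zero_le)
  obtain ⟨X⟩ := hM.nonempty_str
  refine ⟨.or (.ex 6 (.var 1) (.eqNum (.var 1) (.pair (.var 2) (.var 6))))
    (.and (.not (.ex 6 (.var 1) (.ex 7 (.var 1) (.eqNum (.var 1) (.pair (.var 6) (.var 7))))))
      (.eqNum (.var 2) .zero)), fun _ => X, 0, fun x y hx hy => ?_⟩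
  simp only [Sigma0B.Holds, NumTerm.eval, NumTerm.eval_pair, Function.update_apply, assign2]
  norm_num
  by_cases h : ∃ u v, x = pair u v
  · obtain ⟨u, v, rfl⟩ := h
    simp only [Num.pair_inj, fstNum_pair]
    constructor
    · rintro (⟨_, -, h, -⟩ | ⟨h, -⟩)
      · exact h
      · exact (h u (Num.le_pair_left u v) v (Num.le_pair_right u v) ⟨rfl, rfl⟩).elim
    · intro h
      exact .inl ⟨v, Num.le_pair_right u v, h, rfl⟩
  · rw [fstNum_of_not h]
    constructor
    · rintro (⟨v, -, h1⟩ | ⟨-, h1⟩)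
      · exact absurd ⟨y, v, h1⟩ h
      · exact h1.symm
    · intro h1
      exact .inr ⟨fun u _ v _ h2 => h ⟨u, v, h2⟩, h1.symm⟩

theorem AdmNum.sndNum : AdmNum (sndNum : M.Num → M.Num) := by
  refine ⟨fun a => ⟨a + 1, fun z hz => ?_⟩, .of_formula fun a b => ?_⟩
  · by_cases h : ∃ x y, z = pair x y
    · obtain ⟨x, y, rfl⟩ := h
      rw [sndNum_pair]
      exact Num.lt_add_one_iff.2 ((Num.le_pair_right x y).trans hz.le)
    · rw [sndNum_of_not h]
      exact Num.lt_add_one_iff.2 (zero_le)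
  obtain ⟨X⟩ := hM.nonempty_str
  refine ⟨.or (.ex 6 (.var 1) (.eqNum (.var 1) (.pair (.var 6) (.var 2))))
    (.and (.not (.ex 6 (.var 1) (.ex 7 (.var 1) (.eqNum (.var 1) (.pair (.var 6) (.var 7))))))
      (.eqNum (.var 2) .zero)), fun _ => X, 0, fun x y hx hy => ?_⟩
  simp only [Sigma0B.Holds, NumTerm.eval, NumTerm.eval_pair, Function.update_apply, assign2]
  norm_num
  by_cases h : ∃ u v, x = pair u v
  · obtain ⟨u, v, rfl⟩ := h
    simp only [Num.pair_inj, sndNum_pair]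
    constructor
    · rintro (⟨_, -, -, h⟩ | ⟨h, -⟩)
      · exact h
      · exact (h u (Num.le_pair_left u v) v (Num.le_pair_right u v) ⟨rfl, rfl⟩).elim
    · intro h
      exact .inl ⟨u, Num.le_pair_left u v, rfl, h⟩
  · rw [sndNum_of_not h]
    constructor
    · rintro (⟨v, -, h1⟩ | ⟨-, h1⟩)
      · exact absurd ⟨v, y, h1⟩ h
      · exact h1.symm
    · intro h1
      exact .inr ⟨fun u _ v _ h2 => h ⟨u, v, h2⟩, h1.symm⟩

theorem AdmStr.of_rel {X : M.Num → M.Str} {R : M.Num → M.Num → Prop} (hR : AdmRel R)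
    (hb : ∀ a, ∃ b, ∀ z, z < a → ∀ i, M.mem i (X z) ↔ i < b ∧ R z i) : AdmStr X := by
  intro a
  obtain ⟨b, hb⟩ := hb a
  obtain ⟨W, hW⟩ := hR a b
  refine ⟨W, fun z hz i => ?_⟩
  rw [hW, hb z hz]
  simp [hz]

theorem AdmStr.const (X : M.Str) : AdmStr fun _ : M.Num => X := by
  refine AdmStr.of_rel (R := fun _ i => M.mem i X) (.of_formula fun a b => ?_) fun a => ?_
  · refine ⟨.mem (.var 2) 0, fun _ => X, 0, fun x y _ _ => ?_⟩
    simp [Sigma0B.Holds, NumTerm.eval, assign2]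
  · exact ⟨M.len X, fun z _ i => ⟨fun h => ⟨lt_len_of_mem h, h⟩, And.right⟩⟩

theorem AdmStr.precomp {X : M.Num → M.Str} {k : M.Num → M.Num} (hX : AdmStr X) (hk : AdmNum k) :
    AdmStr fun z => X (k z) := by
  intro a
  obtain ⟨c, hc⟩ := hk.1 a
  obtain ⟨K, hK⟩ := hk.2 a c
  obtain ⟨W, hW⟩ := hX c
  have hR : AdmRel fun z i => M.mem (pair (k z) i) W := by
    refine .of_formula fun a b => ?_
    obtain ⟨c, hc⟩ := hk.1 a
    obtain ⟨K, hK⟩ := hk.2 a c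
    refine ⟨.ex 6 (.var 5) (.and (.mem (.pair (.var 1) (.var 6)) 0)
      (.mem (.pair (.var 6) (.var 2)) 1)), strs K W, c, fun x y hx hy => ?_⟩
    simp only [Sigma0B.Holds, NumTerm.eval, NumTerm.eval_pair, Function.update_apply, assign2, strs]
    norm_num [hK, hx, hy]
    constructor
    · rintro ⟨_, h1, ⟨h3, rfl⟩, h4⟩
      exact h4
    · intro h1
      exact ⟨k x, (hc x hx).le, ⟨hc x hx, rfl⟩, h1⟩
  obtain ⟨V, hV⟩ := hR a (M.len W)
  refine ⟨V, fun z hz i => ?_⟩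
  rw [hV]
  beta_reduce
  rw [hW _ (hc z hz)]
  refine ⟨fun h => h.2.2, fun h => ⟨hz, ?_, h⟩⟩
  exact (Num.le_pair_right (k z) i).trans_lt (lt_len_of_mem ((hW _ (hc z hz) i).2 h))

theorem AdmRel.of_adm {R : M.Num → M.Num → Prop}
    (h : AdmProp fun w => R (VSharpL.fstNum w) (VSharpL.sndNum w)) : AdmRel R := by
  refine .of_formula fun a b => ?_
  obtain ⟨Y, hY⟩ := h (pair a b + 1)
  refine ⟨.mem (.pair (.var 1) (.var 2)) 0, fun _ => Y, 0, fun x y hx hy => ?_⟩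
  simp [Sigma0B.Holds, NumTerm.eval, assign2, hY, Num.lt_add_one_iff, Num.pair_le_pair hx.le hy.le]

theorem AdmProp.of_local {P : M.Num → Prop}
    (h : ∀ a, ∃ Q : M.Num → Prop, AdmProp Q ∧ ∀ z, z < a → (P z ↔ Q z)) : AdmProp P := by
  intro a
  obtain ⟨Q, hQ, h⟩ := h a
  obtain ⟨Y, hY⟩ := hQ a
  exact ⟨Y, fun z => (hY z).trans (and_congr_right fun hz => (h z hz).symm)⟩

theorem AdmStr.of_local {X : M.Num → M.Str}
    (h : ∀ a, ∃ Y : M.Num → M.Str, AdmStr Y ∧ ∀ z, z < a → X z = Y z) : AdmStr X := by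
  intro a
  obtain ⟨Y, hY, h⟩ := h a
  obtain ⟨W, hW⟩ := hY a
  exact ⟨W, fun z hz i => by rw [hW z hz, h z hz]⟩

theorem induction_adm {P : M.Num → Prop} (hP : AdmProp P) (h0 : P 0)
    (hs : ∀ x, P x → P (x + 1)) (n : M.Num) : P n := by
  by_contra hn
  obtain ⟨Y, hY⟩ := hP (n + 1)
  have h := Num.induction_sigma (.or (.mem (.var 0) 0) (.not (.le (.var 0) (.var 1))))
    (fun _ => n) (fun _ => Y)
  simp [Sigma0B.Holds, NumTerm.eval, hY, Num.lt_add_one_iff] at h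
  refine hn ?_
  have := h h0 (fun x hx => ?_) n
  · simpa using this
  · by_cases hxn : x < n
    · left
      refine ⟨hxn, hs x ?_⟩
      rcases hx with hx | hx
      · exact hx.2
      · exact absurd hxn hx.not_gt
    · right
      exact not_lt.1 hxn

end VSharpL

namespace VSharpL
universe u v w
variable {M : TwoSorted.{u}} [hM : Model M]

/-! ### Spaces with coded families -/

/-- A type with a notion of coded families indexed by the numbers of `M`. -/
class Space (M : TwoSorted.{u}) (α : Type v) where
  adm : (M.Num → α) → Prop
  adm_const : ∀ x, adm fun _ => x
  adm_comp : ∀ {p : M.Num → α} {h : M.Num → M.Num}, adm p → AdmNum h → adm fun z => p (h z)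
  adm_local : ∀ {p : M.Num → α}, (∀ a, ∃ q, adm q ∧ ∀ z, z < a → p z = q z) → adm p

open Space

instance : Space M Prop where
  adm := AdmProp
  adm_const P := by
    obtain ⟨X⟩ := hM.nonempty_str
    by_cases h : P
    · exact .of_formula fun a => ⟨.eqNum .zero .zero, fun _ => X, 0, by simp [Sigma0B.Holds, h]⟩
    · exact .of_formula fun a => ⟨.not (.eqNum .zero .zero), fun _ => X, 0, by simp [Sigma0B.Holds, h]⟩
  adm_comp := AdmProp.precomp
  adm_local h := .of_local fun a => by
    obtain ⟨q, hq, h⟩ := h a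
    exact ⟨q, hq, fun z hz => iff_of_eq (h z hz)⟩

instance : Space M M.Num where
  adm := AdmNum
  adm_const := AdmNum.const
  adm_comp := AdmNum.precomp
  adm_local h := by
    constructor
    · intro a
      obtain ⟨q, hq, h⟩ := h a
      obtain ⟨b, hb⟩ := hq.1 a
      exact ⟨b, fun z hz => h z hz ▸ hb z hz⟩
    · intro a b
      obtain ⟨q, hq, h⟩ := h a
      obtain ⟨W, hW⟩ := hq.2 a b
      exact ⟨W, fun x y => (hW x y).trans (and_congr_right fun hx => by beta_reduce; rw [h x hx])⟩

instance : Space M M.Str where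
  adm := AdmStr
  adm_const := AdmStr.const
  adm_comp := AdmStr.precomp
  adm_local := AdmStr.of_local

instance {α : Type v} {β : Type w} [Space M α] [Space M β] : Space M (α × β) where
  adm p := adm (M := M) (fun z => (p z).1) ∧ adm (M := M) (fun z => (p z).2)
  adm_const x := ⟨adm_const x.1, adm_const x.2⟩
  adm_comp hp hh := ⟨adm_comp hp.1 hh, adm_comp hp.2 hh⟩
  adm_local h := by
    constructor <;> refine adm_local fun a => ?_ <;> obtain ⟨q, hq, h⟩ := h a
    · exact ⟨_, hq.1, fun z hz => by rw [h z hz]⟩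
    · exact ⟨_, hq.2, fun z hz => by rw [h z hz]⟩

variable {α : Type v} {β : Type w} {γ : Type*} [Space M α] [Space M β] [Space M γ]

/-- Maps that preserve coded families. -/
@[fun_prop]
def Mor (M : TwoSorted.{u}) [Model M] {α : Type v} {β : Type w} [Space M α] [Space M β]
    (f : α → β) : Prop :=
  ∀ p : M.Num → α, adm p → adm (M := M) fun z => f (p z)

namespace Mor

@[fun_prop]
theorem id : Mor M fun x : α => x := fun _ h => h

@[fun_prop]
theorem const (y : β) : Mor M fun _ : α => y := fun _ _ => adm_const y

@[fun_prop]
theorem comp {f : β → γ} {g : α → β} (hf : Mor M f) (hg : Mor M g) : Mor M fun x => f (g x) :=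
  fun _ hp => hf _ (hg _ hp)

@[fun_prop]
theorem prodMk {f : α → β} {g : α → γ} (hf : Mor M f) (hg : Mor M g) :
    Mor M fun x => (f x, g x) :=
  fun _ hp => ⟨hf _ hp, hg _ hp⟩

@[fun_prop]
theorem fst {f : α → β × γ} (hf : Mor M f) : Mor M fun x => (f x).1 := fun _ hp => (hf _ hp).1

@[fun_prop]
theorem snd {f : α → β × γ} (hf : Mor M f) : Mor M fun x => (f x).2 := fun _ hp => (hf _ hp).2

theorem adm {f : M.Num → β} (hf : Mor M f) : Space.adm (M := M) f := hf _ AdmNum.id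

theorem of_adm {f : M.Num → β} (hf : Space.adm (M := M) f) : Mor M f := fun _ hp => adm_comp hf hp

@[fun_prop]
theorem fstNum : Mor M (VSharpL.fstNum : M.Num → M.Num) := .of_adm AdmNum.fstNum

@[fun_prop]
theorem sndNum : Mor M (VSharpL.sndNum : M.Num → M.Num) := .of_adm AdmNum.sndNum

@[fun_prop]
theorem add_num {f g : α → M.Num} (hf : Mor M f) (hg : Mor M g) : Mor M fun x => f x + g x :=
  fun _ hp => AdmNum.add (hf _ hp) (hg _ hp)

@[fun_prop]
theorem mul_num {f g : α → M.Num} (hf : Mor M f) (hg : Mor M g) : Mor M fun x => f x * g x :=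
  fun _ hp => AdmNum.mul (hf _ hp) (hg _ hp)

@[fun_prop]
theorem pair {f g : α → M.Num} (hf : Mor M f) (hg : Mor M g) :
    Mor M fun x => VSharpL.pair (f x) (g x) := by
  unfold VSharpL.pair
  fun_prop

@[fun_prop]
theorem and {P Q : α → Prop} (hP : Mor M P) (hQ : Mor M Q) : Mor M fun x => P x ∧ Q x :=
  fun _ hp => AdmProp.and (hP _ hp) (hQ _ hp)

@[fun_prop]
theorem not {P : α → Prop} (hP : Mor M P) : Mor M fun x => ¬ P x :=
  fun _ hp => AdmProp.not (hP _ hp)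

theorem congr {f g : α → β} (hf : Mor M f) (h : ∀ x, f x = g x) : Mor M g := by
  rwa [← funext h]

@[fun_prop]
theorem or {P Q : α → Prop} (hP : Mor M P) (hQ : Mor M Q) : Mor M fun x => P x ∨ Q x :=
  (hP.not.and hQ.not).not.congr fun x => propext (by tauto)

theorem imp {P Q : α → Prop} (hP : Mor M P) (hQ : Mor M Q) : Mor M fun x => P x → Q x :=
  (hP.not.or hQ).congr fun x => propext (by tauto)

@[fun_prop]
theorem iff {P Q : α → Prop} (hP : Mor M P) (hQ : Mor M Q) : Mor M fun x => P x ↔ Q x :=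
  ((hP.imp hQ).and (hQ.imp hP)).congr fun x => propext (by tauto)

@[fun_prop]
theorem xor {P Q : α → Prop} (hP : Mor M P) (hQ : Mor M Q) : Mor M fun x => Xor (P x) (Q x) :=
  (hP.iff hQ).not.congr fun x => propext (by unfold Xor; tauto)

@[fun_prop]
theorem eq_num {f g : α → M.Num} (hf : Mor M f) (hg : Mor M g) : Mor M fun x => f x = g x :=
  fun _ hp => AdmProp.eq (hf _ hp) (hg _ hp)

@[fun_prop]
theorem le_num {f g : α → M.Num} (hf : Mor M f) (hg : Mor M g) : Mor M fun x => f x ≤ g x :=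
  fun _ hp => AdmProp.le (hf _ hp) (hg _ hp)

@[fun_prop]
theorem lt_num {f g : α → M.Num} (hf : Mor M f) (hg : Mor M g) : Mor M fun x => f x < g x :=
  ((hf.le_num hg).and (hf.eq_num hg).not).congr fun x => propext (by
    rw [lt_iff_le_and_ne])

@[fun_prop]
theorem mem {f : α → M.Num} {X : α → M.Str} (hf : Mor M f) (hX : Mor M X) :
    Mor M fun x => M.mem (f x) (X x) :=
  fun _ hp => AdmProp.mem (hX _ hp) (hf _ hp)

theorem rel {R : α → M.Num → Prop} (hR : Mor M fun x : α × M.Num => R x.1 x.2) {p : M.Num → α}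
    (hp : Space.adm p) : AdmRel fun z y => R (p z) y := by
  refine AdmRel.of_adm ?_
  exact hR (fun w => (p (VSharpL.fstNum w), VSharpL.sndNum w))
    ⟨adm_comp hp AdmNum.fstNum, AdmNum.sndNum⟩

theorem exists_lt {R : α → M.Num → Prop} {t : α → M.Num}
    (hR : Mor M fun x : α × M.Num => R x.1 x.2) (ht : Mor M t) :
    Mor M fun x => ∃ y, y < t x ∧ R x y :=
  fun _ hp => AdmProp.ex (hR.rel hp) (ht _ hp)

theorem forall_lt {R : α → M.Num → Prop} {t : α → M.Num}
    (hR : Mor M fun x : α × M.Num => R x.1 x.2) (ht : Mor M t) :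
    Mor M fun x => ∀ y, y < t x → R x y :=
  (exists_lt (R := fun x y => ¬ R x y) hR.not ht).not.congr fun x => propext (by push Not; rfl)

theorem of_local {f : α → β} (h : ∀ p : M.Num → α, Mor M p → ∀ a, ∃ g : M.Num → β, Mor M g ∧
    ∀ z, z < a → f (p z) = g z) : Mor M f := by
  intro p hp
  refine adm_local fun a => ?_
  obtain ⟨g, hg, h⟩ := h p (.of_adm hp) a
  exact ⟨g, hg.adm, h⟩

@[fun_prop]
theorem ite_prop {P f g : α → Prop} [∀ x, Decidable (P x)] (hP : Mor M P) (hf : Mor M f) (hg : Mor M g) :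
    Mor M fun x => if P x then f x else g x :=
  ((hP.and hf).or (hP.not.and hg)).congr fun x => propext (by split_ifs <;> tauto)

/-- A bounded function with coded graph is a morphism. -/
theorem num_of_graph {f b : α → M.Num} (hb : Mor M b) (hfb : ∀ x, f x ≤ b x)
    (hf : Mor M fun x : α × M.Num => f x.1 = x.2) : Mor M f := by
  intro p hp
  refine ⟨fun a => ?_, rel (R := fun x y => f x = y) hf hp⟩
  obtain ⟨c, hc⟩ := (hb p hp).1 a
  exact ⟨c, fun z hz => (hfb _).trans_lt (hc z hz)⟩

@[fun_prop]
theorem ite_num {P : α → Prop} [∀ x, Decidable (P x)] {f g : α → M.Num} (hP : Mor M P) (hf : Mor M f) (hg : Mor M g) :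
    Mor M fun x => if P x then f x else g x := by
  refine num_of_graph (b := fun x => f x + g x) (by fun_prop) (fun x => ?_) ?_
  · split_ifs
    · exact le_self_add
    · exact le_add_self
  · refine Mor.congr (f := fun x : α × M.Num => if P x.1 then f x.1 = x.2 else g x.1 = x.2)
      (by fun_prop) fun x => ?_
    split_ifs <;> rfl

@[fun_prop]
theorem sub_num {f g : α → M.Num} (hf : Mor M f) (hg : Mor M g) : Mor M fun x => f x - g x := by
  refine num_of_graph (b := f) (by fun_prop) (fun x => tsub_le_self) ?_
  refine Mor.congr (f := fun x : α × M.Num =>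
    (f x.1 = g x.1 + x.2) ∨ (f x.1 < g x.1 ∧ x.2 = 0)) (by fun_prop) fun x => propext ?_
  rcases lt_or_ge (f x.1) (g x.1) with h | h
  · rw [tsub_eq_zero_of_le h.le]
    constructor
    · rintro (h1 | h1)
      · exact absurd (h1 ▸ h) (by simp)
      · exact h1.2.symm
    · intro h1; exact .inr ⟨h, h1.symm⟩
  · rw [tsub_eq_iff_eq_add_of_le h, add_comm]
    simp [h.not_gt]

end Mor

theorem induction_mor {P : M.Num → Prop} (hP : Mor M P) (h0 : P 0)
    (hs : ∀ x, P x → P (x + 1)) (n : M.Num) : P n := induction_adm hP.adm h0 hs n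

end VSharpL

namespace VSharpL
universe u v w
variable {M : TwoSorted.{u}} [hM : Model M]

variable {α : Type v} [Space M α]

namespace Mor

theorem curry {β : Type*} {γ : Type*} [Space M β] [Space M γ] {f : α → β → γ}
    (hf : Mor M fun x : α × β => f x.1 x.2) (x : α) : Mor M (f x) := by
  have : Mor M fun y => (fun x : α × β => f x.1 x.2) (x, y) := by fun_prop
  exact this

end Mor

theorem str_ext {X Y : M.Str} (h : ∀ i, M.mem i X ↔ M.mem i Y) : X = Y := by
  have key : ∀ {X Y : M.Str}, (∀ i, M.mem i X ↔ M.mem i Y) → M.len X ≤ M.len Y := by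
    intro X Y h
    rcases Num.eq_zero_or_succ (M.len X) with h0 | ⟨y, hy⟩
    · rw [h0]; exact zero_le
    · rw [hy, Num.add_one_le_iff]
      exact lt_len_of_mem ((h y).1 (Num.basic.l2 X y hy.symm))
  exact Num.basic.se X Y (le_antisymm (key h) (key fun i => (h i).symm)) fun i _ => h i

theorem len_le_iff {X : M.Str} {b : M.Num} : M.len X ≤ b ↔ ∀ i, M.mem i X → i < b := by
  refine ⟨fun h i hi => (lt_len_of_mem hi).trans_le h, fun h => ?_⟩
  rcases Num.eq_zero_or_succ (M.len X) with h0 | ⟨y, hy⟩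
  · rw [h0]; exact zero_le
  · rw [hy, Num.add_one_le_iff]
    exact h y (Num.basic.l2 X y hy.symm)

theorem AdmStr.exists_bound {X : M.Num → M.Str} (hX : AdmStr X) (a : M.Num) :
    ∃ b, ∀ z, z < a → M.len (X z) ≤ b := by
  obtain ⟨W, hW⟩ := hX a
  refine ⟨M.len W, fun z hz => len_le_iff.2 fun i hi => ?_⟩
  exact (Num.le_pair_right z i).trans_lt (lt_len_of_mem ((hW z hz i).2 hi))

@[fun_prop]
theorem Mor.eq_str {X Y : α → M.Str} (hX : Mor M X) (hY : Mor M Y) :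
    Mor M fun x => X x = Y x := by
  intro p hp
  refine AdmProp.of_local fun a => ?_
  obtain ⟨b, hb⟩ := (hX p hp).exists_bound a
  obtain ⟨c, hc⟩ := (hY p hp).exists_bound a
  refine ⟨fun z => ∀ i, i < b + c → (M.mem i (X (p z)) ↔ M.mem i (Y (p z))), ?_, fun z hz => ?_⟩
  · refine Mor.forall_lt (R := fun x i => (M.mem i (X x) ↔ M.mem i (Y x))) (t := fun _ => b + c)
      ?_ ?_ p hp <;> fun_prop
  · refine ⟨fun h i _ => by rw [h], fun h => str_ext fun i => ⟨fun hi => ?_, fun hi => ?_⟩⟩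
    · exact (h i ((lt_len_of_mem hi).trans_le ((hb z hz).trans le_self_add))).1 hi
    · exact (h i ((lt_len_of_mem hi).trans_le ((hc z hz).trans le_add_self))).2 hi

theorem len_eq_iff {X : M.Str} {y : M.Num} :
    M.len X = y ↔ (∀ i, M.mem i X → i < y) ∧ (y = 0 ∨ ∃ k, k < y ∧ y = k + 1 ∧ M.mem k X) := by
  constructor
  · rintro rfl
    refine ⟨fun i => lt_len_of_mem, ?_⟩
    rcases Num.eq_zero_or_succ (M.len X) with h0 | ⟨y, hy⟩
    · exact .inl h0
    · exact .inr ⟨y, by rw [hy, Num.lt_add_one_iff], hy, Num.basic.l2 X y hy.symm⟩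
  · rintro ⟨h1, h2⟩
    refine le_antisymm (len_le_iff.2 h1) ?_
    rcases h2 with rfl | ⟨k, -, rfl, hk⟩
    · exact zero_le
    · exact Num.add_one_le_iff.2 (lt_len_of_mem hk)

@[fun_prop]
theorem Mor.len {X : α → M.Str} (hX : Mor M X) : Mor M fun x => M.len (X x) := by
  intro p hp
  refine ⟨fun a => ?_, ?_⟩
  · obtain ⟨b, hb⟩ := (hX p hp).exists_bound a
    exact ⟨b + 1, fun z hz => Num.lt_add_one_iff.2 (hb z hz)⟩
  intro a b
  obtain ⟨c, hc⟩ := (hX p hp).exists_bound a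
  have h1 : Mor M fun x : α × M.Num => (∀ i, i < c → (¬ M.mem i (X x.1) ∨ i < x.2)) ∧
      (x.2 = 0 ∨ ∃ k, k < x.2 ∧ (x.2 = k + 1 ∧ M.mem k (X x.1))) := by
    refine .and (.forall_lt ?_ ?_) (.or ?_ (.exists_lt ?_ ?_)) <;> fun_prop
  obtain ⟨W, hW⟩ := Mor.rel (R := fun x y => (∀ i, i < c → (¬ M.mem i (X x) ∨ i < y)) ∧
      (y = 0 ∨ ∃ k, k < y ∧ (y = k + 1 ∧ M.mem k (X x)))) h1 hp a b
  refine ⟨W, fun x y => (hW x y).trans (and_congr_right fun hx => and_congr_right fun _ => ?_)⟩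
  beta_reduce
  rw [len_eq_iff]
  refine and_congr_left fun _ => forall_congr' fun i => ?_
  refine ⟨fun h hi => ?_, fun h _ => by tauto⟩
  have := h ((lt_len_of_mem hi).trans_le (hc x hx))
  tauto

open Classical in
/-- The string with elements `{i < b | P i}`. -/
noncomputable def mkStr (b : M.Num) (P : M.Num → Prop) : M.Str :=
  if h : ∃ Y : M.Str, ∀ z, M.mem z Y ↔ z < b ∧ P z then h.choose else hM.nonempty_str.some

theorem mem_mkStr {b : M.Num} {P : M.Num → Prop} (hP : Mor M P) (i : M.Num) :
    M.mem i (mkStr b P) ↔ i < b ∧ P i := by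
  classical
  have h : ∃ Y : M.Str, ∀ z, M.mem z Y ↔ z < b ∧ P z := hP.adm b
  unfold mkStr
  rw [dif_pos h]
  exact h.choose_spec i

@[fun_prop]
theorem Mor.mkStr {b : α → M.Num} {P : α → M.Num → Prop} (hb : Mor M b)
    (hP : Mor M fun x : α × M.Num => P x.1 x.2) : Mor M fun x => mkStr (b x) (P x) := by
  intro p hp
  refine AdmStr.of_rel (hP.and (Mor.lt_num (f := fun x : α × M.Num => x.2)
    (g := fun x => b x.1) (by fun_prop) (by fun_prop)) |>.rel
    (R := fun x i => P x i ∧ i < b x) hp) fun a => ?_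
  obtain ⟨c, hc⟩ := (hb p hp).1 a
  refine ⟨c, fun z hz i => ?_⟩
  rw [mem_mkStr (hP.curry _)]
  exact ⟨fun h => ⟨h.1.trans (hc z hz), h.2, h.1⟩, fun h => ⟨h.2.2, h.2.1⟩⟩

/-! ### Addition of strings -/

theorem not_carry_zero (p q : Bits M) : ¬ carry p q 0 := by
  rintro ⟨k, hk, -⟩
  exact absurd hk not_lt_zero

theorem carry_succ (p q : Bits M) (i : M.Num) :
    carry p q (i + 1) ↔ (p i ∧ q i) ∨ (carry p q i ∧ (p i ∨ q i)) := by
  constructor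
  · rintro ⟨k, hk, hp, hq, h⟩
    rcases (Num.lt_add_one_iff.1 hk).eq_or_lt with rfl | hki
    · exact .inl ⟨hp, hq⟩
    · exact .inr ⟨⟨k, hki, hp, hq, fun j h1 h2 => h j h1 (h2.trans (lt_add_one i))⟩,
        h i hki (lt_add_one i)⟩
  · rintro (⟨hp, hq⟩ | ⟨⟨k, hk, hp, hq, h⟩, h'⟩)
    · exact ⟨i, lt_add_one i, hp, hq, fun j h1 h2 => absurd h1 (Num.lt_add_one_iff.1 h2).not_gt⟩
    · refine ⟨k, hk.trans (lt_add_one i), hp, hq, fun j h1 h2 => ?_⟩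
      rcases (Num.lt_add_one_iff.1 h2).eq_or_lt with rfl | hji
      · exact h'
      · exact h j h1 hji

@[fun_prop]
theorem Mor.carry {p q : α → M.Num → Prop} {i : α → M.Num}
    (hp : Mor M fun x : α × M.Num => p x.1 x.2) (hq : Mor M fun x : α × M.Num => q x.1 x.2)
    (hi : Mor M i) : Mor M fun x => carry (p x) (q x) (i x) := by
  refine (exists_lt (R := fun x k => p x k ∧ q x k ∧
    ∀ j, j < i x → (j ≤ k ∨ (p x j ∨ q x j))) (t := i) ?_ hi).congr fun x => propext ?_
  · refine .and (by fun_prop) (.and (by fun_prop) (.forall_lt ?_ ?_)) <;> fun_prop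
  · unfold VSharpL.carry
    refine exists_congr fun k => ?_
    refine and_congr_right fun _ => and_congr_right fun _ => and_congr_right fun _ =>
      forall_congr' fun j => ?_
    rw [← not_lt]
    tauto

@[fun_prop]
theorem Mor.bAdd {p q : α → M.Num → Prop} {i : α → M.Num}
    (hp : Mor M fun x : α × M.Num => p x.1 x.2) (hq : Mor M fun x : α × M.Num => q x.1 x.2)
    (hi : Mor M i) : Mor M fun x => bAdd (p x) (q x) (i x) := by
  unfold VSharpL.bAdd
  fun_prop

@[fun_prop]
theorem Mor.bits {X : α → M.Str} {i : α → M.Num} (hX : Mor M X) (hi : Mor M i) :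
    Mor M fun x => bits (X x) (i x) := hi.mem hX

theorem bits_injective {X Y : M.Str} (h : bits X = bits Y) : X = Y :=
  str_ext fun i => iff_of_eq (congrFun h i)

noncomputable instance : Zero M.Str := ⟨mkStr 0 fun _ => False⟩
noncomputable instance : One M.Str := ⟨mkStr 1 fun i => i = 0⟩
noncomputable instance : Add M.Str :=
  ⟨fun X Y => mkStr (M.len X + M.len Y + 1) (bAdd (bits X) (bits Y))⟩

@[simp] theorem not_mem_zero (i : M.Num) : ¬ M.mem i (0 : M.Str) := fun h =>
  not_lt_zero ((mem_mkStr (Mor.const False) i).1 h).1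

@[simp] theorem mem_one (i : M.Num) : M.mem i (1 : M.Str) ↔ i = 0 := by
  refine (mem_mkStr (by fun_prop) i).trans ⟨And.right, ?_⟩
  rintro rfl
  exact ⟨zero_lt_one, rfl⟩

theorem bits_zero : bits (0 : M.Str) = fun _ => False := by
  funext i; simp [bits]

theorem mem_add (X Y : M.Str) (i : M.Num) : M.mem i (X + Y) ↔ bAdd (bits X) (bits Y) i := by
  have hm : Mor M fun i => bAdd (bits X) (bits Y) i := by fun_prop
  refine (mem_mkStr hm i).trans ⟨And.right, fun h => ⟨?_, h⟩⟩
  by_contra hi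
  rw [not_lt] at hi
  obtain ⟨k, rfl, hk⟩ := Num.eq_add_one_of_lt (Num.add_one_le_iff.1 hi)
  have hX : ∀ j, M.len X + M.len Y ≤ j → ¬ bits X j := fun j hj h =>
    (lt_len_of_mem h).not_ge (le_self_add.trans hj)
  have hY : ∀ j, M.len X + M.len Y ≤ j → ¬ bits Y j := fun j hj h =>
    (lt_len_of_mem h).not_ge (le_add_self.trans hj)
  have h1 : M.len X + M.len Y ≤ k + 1 := hk.trans (lt_add_one k).le
  simp only [bAdd, carry_succ, hX _ hk, hY _ hk, hX _ h1, hY _ h1, Xor] at h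
  tauto

theorem bits_add (X Y : M.Str) : bits (X + Y) = bAdd (bits X) (bits Y) := by
  funext i; exact propext (mem_add X Y i)

@[fun_prop]
theorem Mor.add_str {X Y : α → M.Str} (hX : Mor M X) (hY : Mor M Y) :
    Mor M fun x => X x + Y x := by
  show Mor M fun x => VSharpL.mkStr _ _
  fun_prop

theorem carry_comm (p q : Bits M) (i : M.Num) : carry p q i ↔ carry q p i := by
  unfold carry
  refine exists_congr fun k => ?_
  refine and_congr_right fun _ => ?_
  constructor <;> rintro ⟨h1, h2, h3⟩ <;> exact ⟨h2, h1, fun j a b => (h3 j a b).symm⟩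

theorem not_carry_of_disjoint {p q : Bits M} (h : ∀ i, ¬ (p i ∧ q i)) (i : M.Num) :
    ¬ carry p q i := fun ⟨k, _, hp, hq, _⟩ => h k ⟨hp, hq⟩

theorem mem_add_of_disjoint {X Y : M.Str} (h : ∀ i, ¬ (M.mem i X ∧ M.mem i Y)) (i : M.Num) :
    M.mem i (X + Y) ↔ M.mem i X ∨ M.mem i Y := by
  rw [mem_add, bAdd]
  have h1 := not_carry_of_disjoint (p := bits X) (q := bits Y) h i
  have h2 := h i
  simp only [h1, Xor, bits] at h2 ⊢
  tauto

theorem full_adder_bool : ∀ x y z c₁ c₂ d₁ d₂ : Bool, ((c₁ && c₂) = (d₁ && d₂)) →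
    ((c₁ ^^ c₂) = (d₁ ^^ d₂)) →
    (((x && y || c₁ && (x || y)) && ((x ^^ y ^^ c₁) && z || c₂ && ((x ^^ y ^^ c₁) || z))) =
      ((y && z || d₁ && (y || z)) && (x && (y ^^ z ^^ d₁) || d₂ && (x || (y ^^ z ^^ d₁))))) ∧
    (((x && y || c₁ && (x || y)) ^^ ((x ^^ y ^^ c₁) && z || c₂ && ((x ^^ y ^^ c₁) || z))) =
      ((y && z || d₁ && (y || z)) ^^ (x && (y ^^ z ^^ d₁) || d₂ && (x || (y ^^ z ^^ d₁))))) := by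
  decide

theorem exists_bool (p : Prop) : ∃ b : Bool, p = (b = true) := by
  by_cases h : p
  · exact ⟨true, by simp [h]⟩
  · exact ⟨false, by simp [h]⟩

theorem xor_bool (a b : Bool) : Xor (a = true) (b = true) = ((a ^^ b) = true) := by
  cases a <;> cases b <;> simp [Xor]

theorem str_add_assoc (X Y Z : M.Str) : X + Y + Z = X + (Y + Z) := by
  have hXY : ∀ i, bits (X + Y) i = Xor (Xor (bits X i) (bits Y i)) (carry (bits X) (bits Y) i) :=
    fun i => propext (mem_add X Y i)
  have hYZ : ∀ i, bits (Y + Z) i = Xor (Xor (bits Y i) (bits Z i)) (carry (bits Y) (bits Z) i) :=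
    fun i => propext (mem_add Y Z i)
  have key : ∀ i, ((carry (bits X) (bits Y) i ∧ carry (bits (X + Y)) (bits Z) i) ↔
      (carry (bits Y) (bits Z) i ∧ carry (bits X) (bits (Y + Z)) i)) ∧
      (Xor (carry (bits X) (bits Y) i) (carry (bits (X + Y)) (bits Z) i) ↔
      Xor (carry (bits Y) (bits Z) i) (carry (bits X) (bits (Y + Z)) i)) := by
    refine induction_mor (by fun_prop) (by simp [not_carry_zero]) fun i => ?_
    simp only [carry_succ]
    rw [hXY, hYZ]
    obtain ⟨c₁, h⟩ := exists_bool (carry (bits X) (bits Y) i); rw [h]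
    obtain ⟨c₂, h⟩ := exists_bool (carry (bits (X + Y)) (bits Z) i); rw [h]
    obtain ⟨d₁, h⟩ := exists_bool (carry (bits Y) (bits Z) i); rw [h]
    obtain ⟨d₂, h⟩ := exists_bool (carry (bits X) (bits (Y + Z)) i); rw [h]
    obtain ⟨x, h⟩ := exists_bool (bits X i); rw [h]
    obtain ⟨y, h⟩ := exists_bool (bits Y i); rw [h]
    obtain ⟨z, h⟩ := exists_bool (bits Z i); rw [h]
    simp only [xor_bool, ← Bool.and_eq_true, ← Bool.or_eq_true, ← Bool.eq_iff_iff]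
    exact fun h => full_adder_bool x y z c₁ c₂ d₁ d₂ h.1 h.2
  refine str_ext fun i => ?_
  rw [mem_add, mem_add]
  unfold bAdd
  rw [hXY, hYZ]
  have := (key i).2
  obtain ⟨c₁, h⟩ := exists_bool (carry (bits X) (bits Y) i); rw [h] at this ⊢
  obtain ⟨c₂, h⟩ := exists_bool (carry (bits (X + Y)) (bits Z) i); rw [h] at this ⊢
  obtain ⟨d₁, h⟩ := exists_bool (carry (bits Y) (bits Z) i); rw [h] at this ⊢
  obtain ⟨d₂, h⟩ := exists_bool (carry (bits X) (bits (Y + Z)) i); rw [h] at this ⊢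
  obtain ⟨x, h⟩ := exists_bool (bits X i); rw [h]
  obtain ⟨y, h⟩ := exists_bool (bits Y i); rw [h]
  obtain ⟨z, h⟩ := exists_bool (bits Z i); rw [h]
  simp only [xor_bool, ← Bool.eq_iff_iff] at this ⊢
  have sum : ∀ x y z c₁ c₂ d₁ d₂ : Bool, (c₁ ^^ c₂) = (d₁ ^^ d₂) →
    (x ^^ y ^^ c₁ ^^ z ^^ c₂) = (x ^^ (y ^^ z ^^ d₁) ^^ d₂) := by decide
  exact sum x y z c₁ c₂ d₁ d₂ this

theorem str_add_comm (X Y : M.Str) : X + Y = Y + X := by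
  refine str_ext fun i => ?_
  rw [mem_add, mem_add]
  unfold bAdd
  rw [carry_comm]
  simp only [Xor]
  tauto

noncomputable instance : AddCommMonoid M.Str where
  add_assoc := str_add_assoc
  add_comm := str_add_comm
  zero_add X := str_ext fun i => by rw [mem_add_of_disjoint] <;> simp
  add_zero X := str_ext fun i => by rw [mem_add_of_disjoint] <;> simp
  nsmul := nsmulRec

theorem str_add_left_cancel {X Y Z : M.Str} (h : X + Y = X + Z) : Y = Z := by
  have hb : ∀ i, bAdd (bits X) (bits Y) i ↔ bAdd (bits X) (bits Z) i := fun i => by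
    rw [← mem_add, ← mem_add, h]
  have key : ∀ i, carry (bits X) (bits Y) i ↔ carry (bits X) (bits Z) i := by
    refine induction_mor (by fun_prop) (by simp [not_carry_zero]) fun i ih => ?_
    have := hb i
    simp only [bAdd, carry_succ, Xor] at this ⊢
    tauto
  refine str_ext fun i => ?_
  have h1 := hb i
  have h2 := key i
  simp only [bAdd, Xor, bits] at h1 h2 ⊢
  tauto

instance : IsLeftCancelAdd M.Str := ⟨fun _ _ _ => str_add_left_cancel⟩

/-- Some bit of `X + Y` is at least as high as each bit of `X`. -/
theorem exists_mem_add_of_mem {X : M.Str} (Y : M.Str) {k : M.Num} (hk : M.mem k X) :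
    ∃ l, k ≤ l ∧ M.mem l (X + Y) := by
  have key : ∀ (X Y : M.Str) (k : M.Num), M.mem k X → (∀ i, M.mem i X → i ≤ k) →
      (∀ i, M.mem i Y → i ≤ k) → ∃ l, k ≤ l ∧ M.mem l (X + Y) := by
    intro X Y k hk hX hY
    by_contra h
    push Not at h
    have h1 := h k le_rfl
    have h2 := h (k + 1) (lt_add_one k).le
    have h3 : ¬ bits X (k + 1) := fun h => (hX _ h).not_gt (lt_add_one k)
    have h4 : ¬ bits Y (k + 1) := fun h => (hY _ h).not_gt (lt_add_one k)
    rw [mem_add] at h1 h2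
    replace hk : bits X k := hk
    simp only [bAdd, carry_succ, Xor] at h1 h2
    tauto
  have top : ∀ (X : M.Str) (k : M.Num), M.mem k X →
      ∃ t, k ≤ t ∧ M.mem t X ∧ M.len X = t + 1 ∧ ∀ i, M.mem i X → i ≤ t := by
    intro X k hk
    obtain ⟨t, ht, hkt⟩ := Num.eq_add_one_of_lt (lt_len_of_mem hk)
    exact ⟨t, hkt, Num.basic.l2 X t ht.symm, ht, fun i hi =>
      Num.lt_add_one_iff.1 (ht ▸ lt_len_of_mem hi)⟩
  obtain ⟨t, hkt, ht, hlen, htop⟩ := top X k hk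
  by_cases h : ∀ i, M.mem i Y → i ≤ t
  · obtain ⟨l, hl, hm⟩ := key X Y t ht htop h
    exact ⟨l, hkt.trans hl, hm⟩
  · push Not at h
    obtain ⟨j, hj, htj⟩ := h
    obtain ⟨s, hjs, hs, -, hs_top⟩ := top Y j hj
    obtain ⟨l, hl, hm⟩ := key Y X s hs hs_top fun i hi =>
      (htop i hi).trans (htj.le.trans hjs)
    exact ⟨l, hkt.trans (htj.le.trans (hjs.trans hl)), by rwa [add_comm]⟩

/-- Subtraction: of two natural numbers one is the sum of the other and a third. -/
theorem str_exists_add_or (X Y : M.Str) : (∃ Z, X + Z = Y) ∨ ∃ Z, Y + Z = X := by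
  have key : ∀ X Y : M.Str, ∀ L, M.len X ≤ L → M.len Y ≤ L →
      ¬ carry (bits X) (fun i => ¬ bits Y i) L → ∃ Z, X + Z = Y := by
    intro X Y L hXL hYL hc
    let Z := mkStr L fun i => Xor (Xor (bits X i) (bits Y i)) (carry (bits X) (fun i => ¬ bits Y i) i)
    have hm : Mor M fun i =>
        Xor (Xor (bits X i) (bits Y i)) (carry (bits X) (fun i => ¬ bits Y i) i) :=
      .xor (.xor (.bits (.const X) .id) (.bits (.const Y) .id)) (.carry (p := fun _ => bits X) (q := fun _ i => ¬ bits Y i)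
        (by fun_prop) (by fun_prop) (by fun_prop))
    have hZ : ∀ i, M.mem i Z ↔ i < L ∧
        Xor (Xor (bits X i) (bits Y i)) (carry (bits X) (fun i => ¬ bits Y i) i) := fun i =>
      mem_mkStr hm i
    have hX : ∀ i, L ≤ i → ¬ bits X i := fun i hi h =>
      (lt_len_of_mem h).not_ge (hXL.trans hi)
    have hY : ∀ i, L ≤ i → ¬ bits Y i := fun i hi h =>
      (lt_len_of_mem h).not_ge (hYL.trans hi)
    have hbig : ∀ k, ¬ carry (bits X) (fun i => ¬ bits Y i) (L + k) := by
      refine induction_mor (by fun_prop) (by simpa using hc) fun k ih => ?_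
      rw [← add_assoc, carry_succ]
      have := hX (L + k) le_self_add
      tauto
    have hZ' : ∀ i, bits Z i ↔
        Xor (Xor (bits X i) (bits Y i)) (carry (bits X) (fun i => ¬ bits Y i) i) := by
      intro i
      refine (hZ i).trans ⟨And.right, fun h => ⟨?_, h⟩⟩
      by_contra hi
      rw [not_lt] at hi
      obtain ⟨k, rfl⟩ := (Num.le_iff_exists _ _).1 hi
      have h1 := hbig k
      have h2 := hX _ hi
      have h3 := hY _ hi
      simp only [Xor] at h
      tauto
    have hcar : ∀ i, carry (bits X) (bits Z) i ↔ carry (bits X) (fun i => ¬ bits Y i) i := by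
      refine induction_mor (by fun_prop) (by simp [not_carry_zero]) fun i ih => ?_
      have := hZ' i
      simp only [carry_succ, Xor] at this ⊢
      tauto
    refine ⟨Z, str_ext fun i => ?_⟩
    rw [mem_add]
    have h1 := hcar i
    have h2 := hZ' i
    simp only [bAdd, Xor, bits] at h1 h2 ⊢
    tauto
  have hnot : ∀ i, ¬ (carry (bits X) (fun i => ¬ bits Y i) i ∧
      carry (bits Y) (fun i => ¬ bits X i) i) := by
    refine induction_mor (by fun_prop) (by simp [not_carry_zero]) fun i ih => ?_
    simp only [carry_succ]
    tauto
  by_cases h : carry (bits X) (fun i => ¬ bits Y i) (M.len X + M.len Y)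
  · exact .inr (key Y X _ le_add_self le_self_add fun h' => hnot _ ⟨h, h'⟩)
  · exact .inl (key X Y _ le_self_add le_add_self h)

end VSharpL

namespace VSharpL
universe u v w
variable {M : TwoSorted.{u}} [hM : Model M]

variable {α : Type v} [Space M α]

theorem Mor.ite_str {P : α → Prop} [∀ x, Decidable (P x)] {X Y : α → M.Str} (hP : Mor M P)
    (hX : Mor M X) (hY : Mor M Y) : Mor M fun x => if P x then X x else Y x := by
  refine Mor.congr (f := fun x => VSharpL.mkStr (M.len (X x) + M.len (Y x)) fun i =>
    (P x ∧ M.mem i (X x)) ∨ (¬ P x ∧ M.mem i (Y x))) (by fun_prop) fun x => str_ext fun i => ?_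
  rw [mem_mkStr (by fun_prop)]
  split_ifs with h
  · simp only [h, true_and, not_true, false_and, or_false, and_iff_right_iff_imp]
    exact fun h => (lt_len_of_mem h).trans_le le_self_add
  · simp only [h, true_and, not_false_iff, false_and, false_or, and_iff_right_iff_imp]
    exact fun h => (lt_len_of_mem h).trans_le le_add_self

attribute [fun_prop] Mor.ite_str

/-- Row `i` of an array of strings. -/
noncomputable def rowStr (W : M.Str) (i : M.Num) : M.Str := mkStr (M.len W) (row W i)

@[fun_prop]
theorem Mor.row {W : α → M.Str} {i j : α → M.Num} (hW : Mor M W) (hi : Mor M i) (hj : Mor M j) :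
    Mor M fun x => row (W x) (i x) (j x) := by
  unfold VSharpL.row
  fun_prop

@[fun_prop]
theorem Mor.rowStr {W : α → M.Str} {i : α → M.Num} (hW : Mor M W) (hi : Mor M i) :
    Mor M fun x => rowStr (W x) (i x) := by
  unfold VSharpL.rowStr
  refine .mkStr (by fun_prop) (.row ?_ ?_ ?_) <;> fun_prop

theorem bits_rowStr (W : M.Str) (i : M.Num) : bits (rowStr W i) = row W i := by
  funext j
  refine propext ((mem_mkStr (.row (.const W) (.const i) .id) j).trans ⟨And.right, fun h => ⟨?_, h⟩⟩)
  exact (Num.le_pair_right i j).trans_lt (lt_len_of_mem h)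

theorem exists_array {F : M.Num → M.Str} (hF : Mor M F) (a : M.Num) :
    ∃ W : M.Str, ∀ z, z < a → row W z = bits (F z) := by
  obtain ⟨W, hW⟩ := hF.adm a
  exact ⟨W, fun z hz => funext fun i => propext (hW z hz i)⟩

/-! ### Shifts -/

/-- The product of `X` by `2 ^ k`. -/
noncomputable def shift (k : M.Num) (X : M.Str) : M.Str :=
  mkStr (k + M.len X) fun j => k ≤ j ∧ M.mem (j - k) X

@[fun_prop]
theorem Mor.shift {k : α → M.Num} {X : α → M.Str} (hk : Mor M k) (hX : Mor M X) :
    Mor M fun x => shift (k x) (X x) := by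
  unfold VSharpL.shift
  fun_prop

@[simp] theorem mem_shift (k i : M.Num) (X : M.Str) : M.mem (k + i) (shift k X) ↔ M.mem i X := by
  unfold shift
  rw [mem_mkStr (by fun_prop)]
  simp only [add_tsub_cancel_left, le_add_iff_nonneg_right, zero_le, true_and,
    add_lt_add_iff_left, and_iff_right_iff_imp]
  exact lt_len_of_mem

theorem le_of_mem_shift {k i : M.Num} {X : M.Str} (h : M.mem i (shift k X)) : k ≤ i := by
  unfold shift at h
  rw [mem_mkStr (by fun_prop)] at h
  exact h.2.1

theorem mem_shift_iff {k j : M.Num} {X : M.Str} :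
    M.mem j (shift k X) ↔ ∃ i, j = k + i ∧ M.mem i X := by
  constructor
  · intro h
    obtain ⟨i, rfl⟩ := (Num.le_iff_exists _ _).1 (le_of_mem_shift h)
    exact ⟨i, rfl, (mem_shift k i X).1 h⟩
  · rintro ⟨i, rfl, h⟩
    exact (mem_shift k i X).2 h

@[simp] theorem shift_zero_right (k : M.Num) : shift k (0 : M.Str) = 0 :=
  str_ext fun i => by simp [mem_shift_iff]

@[simp] theorem shift_zero_left (X : M.Str) : shift 0 X = X :=
  str_ext fun i => by simp [mem_shift_iff]

theorem shift_shift (k l : M.Num) (X : M.Str) : shift k (shift l X) = shift (k + l) X :=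
  str_ext fun i => by simp [mem_shift_iff, add_assoc]

theorem shift_add (k : M.Num) (X Y : M.Str) : shift k (X + Y) = shift k X + shift k Y := by
  have low : ∀ i, i ≤ k → ¬ carry (bits (shift k X)) (bits (shift k Y)) i := by
    rintro i hi ⟨j, hj, h, -⟩
    exact (le_of_mem_shift h).not_gt (hj.trans_le hi)
  have hb : ∀ (X : M.Str) i, bits (shift k X) (k + i) ↔ bits X i := fun X i => mem_shift k i X
  have key : ∀ i, carry (bits (shift k X)) (bits (shift k Y)) (k + i) ↔
      carry (bits X) (bits Y) i := by
    refine induction_mor (by fun_prop) (by simp [not_carry_zero, low]) fun i ih => ?_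
    rw [← add_assoc, carry_succ, carry_succ, ih, hb, hb]
  refine str_ext fun j => ?_
  rcases lt_or_ge j k with hj | hj
  · have h0 : ∀ X : M.Str, ¬ M.mem j (shift k X) := fun X h => (le_of_mem_shift h).not_gt hj
    have h1 := low j hj.le
    have h2 : ¬ bits (shift k X) j := h0 X
    have h3 : ¬ bits (shift k Y) j := h0 Y
    simp [h0, mem_add, bAdd, h1, h2, h3, Xor]
  · obtain ⟨i, rfl⟩ := (Num.le_iff_exists _ _).1 hj
    rw [mem_shift, mem_add, mem_add]
    unfold bAdd
    rw [hb, hb, key]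

/-! ### Multiplication of strings -/

open Classical in
theorem exists_mulSeq (X Y : M.Str) : ∃ V : M.Num → M.Str, Mor M V ∧ V 0 = 0 ∧
    ∀ i, V (i + 1) = V i + if M.mem i X then shift i Y else 0 := by
  obtain ⟨Z, b, W, ⟨hb, h0, hs⟩, -⟩ := hM.isModel.string_mul X Y
  refine ⟨fun i => if i < b then rowStr W i else rowStr W b, by fun_prop, ?_, fun i => ?_⟩
  · have h0' : rowStr W 0 = 0 := by
      apply bits_injective
      rw [bits_rowStr, bits_zero]
      funext j
      simpa using h0 j
    dsimp only
    split_ifs with h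
    · exact h0'
    · have : b = 0 := le_antisymm (not_lt.1 h) zero_le
      rw [this, h0']
  · have hrow : ∀ i, i < b →
        rowStr W (i + 1) = rowStr W i + if M.mem i X then shift i Y else 0 := by
      intro i hi
      apply bits_injective
      rw [bits_rowStr, bits_add, hs i hi, bits_rowStr]
      congr 1
      funext j
      by_cases h : M.mem i X
      · simp [h, bits, mem_shift_iff]
      · simp [h, bits]
    dsimp only
    by_cases h1 : i + 1 < b
    · rw [if_pos h1, if_pos ((lt_add_one i).trans h1), hrow i ((lt_add_one i).trans h1)]
    · rw [if_neg h1]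
      by_cases h2 : i < b
      · have : b = i + 1 := le_antisymm (not_lt.1 h1) (Num.add_one_le_iff.2 h2)
        rw [if_pos h2, ← hrow i h2, this]
      · rw [if_neg h2, if_neg (show ¬ M.mem i X from fun h => h2 (hb i h)), add_zero]

/-- `mulSeq X Y i` is the product of `X mod 2 ^ i` by `Y`. -/
noncomputable def mulSeq (X Y : M.Str) : M.Num → M.Str := (exists_mulSeq X Y).choose

theorem Mor.mulSeq (X Y : M.Str) : Mor M (mulSeq X Y) := (exists_mulSeq X Y).choose_spec.1

theorem mulSeq_zero (X Y : M.Str) : mulSeq X Y 0 = 0 := (exists_mulSeq X Y).choose_spec.2.1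

open Classical in
theorem mulSeq_succ (X Y : M.Str) (i : M.Num) :
    mulSeq X Y (i + 1) = mulSeq X Y i + if M.mem i X then shift i Y else 0 :=
  (exists_mulSeq X Y).choose_spec.2.2 i

open Classical in
theorem eq_mulSeq {X Y : M.Str} {V : M.Num → M.Str} {b : M.Num} (hV : Mor M V) (h0 : V 0 = 0)
    (hs : ∀ i, i < b → V (i + 1) = V i + if M.mem i X then shift i Y else 0) :
    ∀ i, i ≤ b → V i = mulSeq X Y i := by
  have := Mor.mulSeq X Y
  refine induction_mor (.imp (by fun_prop) (by fun_prop)) ?_ fun i ih hi => ?_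
  · intro _; rw [h0, mulSeq_zero]
  · rw [hs i (Num.add_one_le_iff.1 hi), mulSeq_succ, ih ((lt_add_one i).le.trans hi)]

noncomputable instance : Mul M.Str := ⟨fun X Y => mulSeq X Y (M.len X)⟩

theorem mulSeq_of_len_le {X Y : M.Str} {i : M.Num} (hi : M.len X ≤ i) : mulSeq X Y i = X * Y := by
  obtain ⟨k, rfl⟩ := (Num.le_iff_exists _ _).1 hi
  have := Mor.mulSeq X Y
  revert k
  suffices ∀ k, mulSeq X Y (M.len X + k) = X * Y from fun k _ => this k
  refine induction_mor (by fun_prop) (by rw [add_zero]; rfl) fun k ih => ?_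
  rw [← add_assoc, mulSeq_succ, ih, if_neg, add_zero]
  exact fun h => (lt_len_of_mem h).not_ge le_self_add

theorem mulTrace_iff {X Y : M.Str} {b : M.Num} {W : M.Str} :
    MulTrace (bits X) (bits Y) b W ↔ M.len X ≤ b ∧ ∀ i, i ≤ b → rowStr W i = mulSeq X Y i := by
  classical
  have conv : ∀ i, (fun j => bits X i ∧ ∃ k, j = i + k ∧ bits Y k) =
      bits (if M.mem i X then shift i Y else 0) := by
    intro i
    funext j
    by_cases h : M.mem i X
    · simp [h, bits, mem_shift_iff]
    · simp [h, bits]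
  constructor
  · rintro ⟨hb, h0, hs⟩
    refine ⟨len_le_iff.2 hb, eq_mulSeq (by fun_prop) ?_ fun i hi => ?_⟩
    · apply bits_injective
      rw [bits_rowStr, bits_zero]
      funext j
      simpa using h0 j
    · apply bits_injective
      rw [bits_rowStr, bits_add, hs i hi, bits_rowStr, conv]
  · rintro ⟨hb, h⟩
    refine ⟨len_le_iff.1 hb, fun j => ?_, fun i hi => ?_⟩
    · rw [← bits_rowStr, h 0 zero_le, mulSeq_zero, bits_zero]
      exact not_false
    · rw [← bits_rowStr, h _ (Num.add_one_le_iff.2 hi), mulSeq_succ, bits_add, ← h i hi.le,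
        bits_rowStr, conv]

theorem isProd_iff {X Y : M.Str} {r : Bits M} : IsProd (bits X) (bits Y) r ↔ r = bits (X * Y) := by
  constructor
  · rintro ⟨b, W, h, rfl⟩
    obtain ⟨hb, h⟩ := mulTrace_iff.1 h
    rw [← bits_rowStr, h b le_rfl, mulSeq_of_len_le hb]
  · rintro rfl
    obtain ⟨W, hW⟩ := exists_array (Mor.mulSeq X Y) (M.len X + 1)
    have hW' : ∀ i, i ≤ M.len X → rowStr W i = mulSeq X Y i := fun i hi => by
      apply bits_injective
      rw [bits_rowStr, hW i (Num.lt_add_one_iff.2 hi)]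
    refine ⟨M.len X, W, mulTrace_iff.2 ⟨le_rfl, hW'⟩, ?_⟩
    rw [← bits_rowStr, hW' _ le_rfl]
    rfl

theorem bMul_bits (X Y : M.Str) : bMul (bits X) (bits Y) = bits (X * Y) := by
  funext j
  unfold bMul
  simp only [isProd_iff, eq_iff_iff]
  constructor
  · rintro ⟨r, hr, h⟩
    rwa [← hr]
  · exact fun h => ⟨_, rfl, h⟩

theorem str_zero_mul (Y : M.Str) : 0 * Y = 0 := by
  have hM := Mor.mulSeq 0 Y
  have : ∀ i, mulSeq 0 Y i = 0 := by
    refine induction_mor (by fun_prop) (mulSeq_zero _ _) fun i ih => ?_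
    rw [mulSeq_succ, ih, if_neg (by simp), add_zero]
  exact this _

theorem str_mul_zero (X : M.Str) : X * 0 = 0 := by
  have hM := Mor.mulSeq X 0
  have : ∀ i, mulSeq X 0 i = 0 := by
    refine induction_mor (by fun_prop) (mulSeq_zero _ _) fun i ih => ?_
    rw [mulSeq_succ, ih]
    split_ifs <;> simp
  exact this _

theorem len_one : M.len (1 : M.Str) = 1 := by
  rw [len_eq_iff]
  refine ⟨by simp, .inr ⟨0, by simp⟩⟩

theorem str_one_mul (Y : M.Str) : 1 * Y = Y := by
  show mulSeq 1 Y (M.len 1) = Y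
  have := mulSeq_succ 1 Y 0
  rw [len_one, ← zero_add (1 : M.Num), this, mulSeq_zero]
  simp

/-! ### Sums with at most two summands -/

theorem bSum_eq {d : M.Num} {f : M.Num → Bits M} {F S : M.Num → M.Str} (hS : Mor M S)
    (hf : ∀ i, i < d → f i = bits (F i)) (h0 : S 0 = 0)
    (hs : ∀ i, i < d → S (i + 1) = S i + F i) : bSum d f = bits (S d) := by
  funext j
  unfold bSum
  refine propext ⟨?_, fun h => ?_⟩
  · rintro ⟨W, ⟨hW0, hWs⟩, hj⟩
    have key : ∀ i, i ≤ d → rowStr W i = S i := by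
      refine induction_mor (.imp (by fun_prop) (by fun_prop)) ?_ fun i ih hi => ?_
      · intro _
        rw [h0]
        apply bits_injective
        rw [bits_rowStr, bits_zero]
        funext j
        simpa using hW0 j
      · have hi' := Num.add_one_le_iff.1 hi
        apply bits_injective
        rw [bits_rowStr, hWs i hi', hs i hi', bits_add, ← ih hi'.le, bits_rowStr, hf i hi']
    rwa [← key d le_rfl, bits_rowStr]
  · obtain ⟨W, hW⟩ := exists_array hS (d + 1)
    refine ⟨W, ⟨fun j => ?_, fun i hi => ?_⟩, ?_⟩
    · rw [hW 0 (Num.lt_add_one_iff.2 zero_le), h0, bits_zero]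
      exact not_false
    · rw [hW _ (add_lt_add_of_lt_of_le hi le_rfl), hW _ (hi.trans (lt_add_one d)), hs i hi,
        hf i hi, bits_add]
    · rwa [hW d (lt_add_one d)]

open Classical in
theorem bSum_two {d u₁ u₂ : M.Num} {f : M.Num → Bits M} {F : M.Num → M.Str} (h12 : u₁ < u₂)
    (h2 : u₂ < d) (hf : ∀ i, i < d → f i = bits (F i)) (h0 : ∀ i, i ≠ u₁ → i ≠ u₂ → F i = 0) :
    bSum d f = bits (F u₁ + F u₂) := by
  have := bSum_eq (d := d) (f := f) (F := F)
    (S := fun i => (if u₁ < i then F u₁ else 0) + if u₂ < i then F u₂ else 0) (by fun_prop) hf ?_ ?_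
  · rw [this]
    simp only [h12.trans h2, h2, if_true]
  · simp
  · intro i hi
    simp only [Num.lt_add_one_iff]
    rcases eq_or_ne i u₁ with rfl | h1
    · simp [h12.not_gt, h12.not_ge, add_comm]
    rcases eq_or_ne i u₂ with rfl | h2
    · simp [h12, h12.le]
    · rw [h0 i h1 h2, add_zero]
      simp only [lt_iff_le_and_ne, h1.symm, h2.symm, ne_eq, not_false_eq_true, and_true]

end VSharpL

namespace VSharpL
universe u v w
variable {M : TwoSorted.{u}} [hM : Model M]

variable {α : Type v} [Space M α]

/-! ### Integer codes whose components are strings -/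

/-- A pair of strings, coding the integer `pos - neg`. -/
@[ext]
structure Code (M : TwoSorted.{u}) where
  pos : M.Str
  neg : M.Str

/-- The integer code given by a pair of strings. -/
def Code.toInt (a : Code M) : IntCode M := ⟨bits a.pos, bits a.neg⟩

theorem Code.toInt_injective {a b : Code M} (h : a.toInt = b.toInt) : a = b := by
  rw [Code.toInt, Code.toInt, IntCode.mk.injEq] at h
  exact Code.ext (bits_injective h.1) (bits_injective h.2)

noncomputable instance : Zero (Code M) := ⟨⟨0, 0⟩⟩
noncomputable instance : One (Code M) := ⟨⟨1, 0⟩⟩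
noncomputable instance : Add (Code M) := ⟨fun a b => ⟨a.pos + b.pos, a.neg + b.neg⟩⟩
noncomputable instance : Mul (Code M) :=
  ⟨fun a b => ⟨a.pos * b.pos + a.neg * b.neg, a.pos * b.neg + a.neg * b.pos⟩⟩

@[simp] theorem Code.zero_pos : (0 : Code M).pos = 0 := rfl
@[simp] theorem Code.zero_neg : (0 : Code M).neg = 0 := rfl
@[simp] theorem Code.one_pos : (1 : Code M).pos = 1 := rfl
@[simp] theorem Code.one_neg : (1 : Code M).neg = 0 := rfl
@[simp] theorem Code.add_pos (a b : Code M) : (a + b).pos = a.pos + b.pos := rfl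
@[simp] theorem Code.add_neg (a b : Code M) : (a + b).neg = a.neg + b.neg := rfl
@[simp] theorem Code.mul_pos (a b : Code M) : (a * b).pos = a.pos * b.pos + a.neg * b.neg := rfl
@[simp] theorem Code.mul_neg (a b : Code M) : (a * b).neg = a.pos * b.neg + a.neg * b.pos := rfl

theorem zMul_toInt (a b : Code M) : zMul a.toInt b.toInt = (a * b).toInt := by
  simp only [zMul, Code.toInt, bMul_bits, Code.mul_pos, Code.mul_neg, bits_add]

theorem zZero_eq : (zZero : IntCode M) = (0 : Code M).toInt := by
  simp only [zZero, Code.toInt, Code.zero_pos, Code.zero_neg, bits_zero]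

theorem bits_one : bits (1 : M.Str) = fun i => i = 0 := by
  funext i
  simp [bits]

theorem zOne_eq : (zOne : IntCode M) = (1 : Code M).toInt := by
  simp only [zOne, Code.toInt, Code.one_pos, Code.one_neg, bits_zero, bits_one]

open Classical in
theorem matOne_eq (a b : M.Num) : matOne a b = (if a = b then 1 else 0 : Code M).toInt := by
  split_ifs with h
  · subst h
    simp [matOne, Code.toInt, bits_one, bits_zero]
  · simp [matOne, Code.toInt, bits_zero, h]

instance : Space M (Code M) where
  adm f := AdmStr (fun z => (f z).pos) ∧ AdmStr (fun z => (f z).neg)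
  adm_const _ := ⟨.const _, .const _⟩
  adm_comp h hk := ⟨h.1.precomp hk, h.2.precomp hk⟩
  adm_local h := by
    constructor <;> refine AdmStr.of_local fun a => ?_ <;> obtain ⟨q, hq, h⟩ := h a
    · exact ⟨_, hq.1, fun z hz => by rw [h z hz]⟩
    · exact ⟨_, hq.2, fun z hz => by rw [h z hz]⟩

namespace Mor

@[fun_prop]
theorem pos {f : α → Code M} (hf : Mor M f) : Mor M fun x => (f x).pos := fun _ hp => (hf _ hp).1

@[fun_prop]
theorem neg {f : α → Code M} (hf : Mor M f) : Mor M fun x => (f x).neg := fun _ hp => (hf _ hp).2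

@[fun_prop]
theorem codeMk {f g : α → M.Str} (hf : Mor M f) (hg : Mor M g) :
    Mor M fun x => Code.mk (f x) (g x) := fun _ hp => ⟨hf _ hp, hg _ hp⟩

@[fun_prop]
theorem ite_code {P : α → Prop} [∀ x, Decidable (P x)] {X Y : α → Code M} (hP : Mor M P)
    (hX : Mor M X) (hY : Mor M Y) : Mor M fun x => if P x then X x else Y x := by
  refine Mor.congr (f := fun x => Code.mk (if P x then (X x).pos else (Y x).pos)
    (if P x then (X x).neg else (Y x).neg)) (by fun_prop) fun x => ?_
  split_ifs <;> rfl

@[fun_prop]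
theorem add_code {f g : α → Code M} (hf : Mor M f) (hg : Mor M g) : Mor M fun x => f x + g x := by
  show Mor M fun x => Code.mk ((f x).pos + (g x).pos) ((f x).neg + (g x).neg)
  fun_prop

@[fun_prop]
theorem eq_code {f g : α → Code M} (hf : Mor M f) (hg : Mor M g) : Mor M fun x => f x = g x :=
  ((hf.pos.eq_str hg.pos).and (hf.neg.eq_str hg.neg)).congr fun _ => propext Code.ext_iff.symm

end Mor

/-- Item `i` of an array of integer codes. -/
noncomputable def cellCode (W : M.Str) (i : M.Num) : Code M :=
  ⟨rowStr W (pair i 0), rowStr W (pair i 1)⟩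

@[fun_prop]
theorem Mor.cellCode {W : α → M.Str} {i : α → M.Num} (hW : Mor M W) (hi : Mor M i) :
    Mor M fun x => cellCode (W x) (i x) := by
  unfold VSharpL.cellCode
  fun_prop

theorem cell_eq (W : M.Str) (i : M.Num) : cell W i = (cellCode W i).toInt := by
  simp only [cell, cellCode, Code.toInt, bits_rowStr]

open Classical in
theorem exists_cell {F : M.Num → Code M} (hF : Mor M F) (a : M.Num) :
    ∃ W : M.Str, ∀ z, z < a → cellCode W z = F z := by
  obtain ⟨W, hW⟩ := exists_array (F := fun z : M.Num =>
    if sndNum z = 0 then (F (fstNum z)).pos else (F (fstNum z)).neg) (by fun_prop) (pair a 1 + 1)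
  refine ⟨W, fun z hz => Code.toInt_injective ?_⟩
  rw [← cell_eq, cell, Code.toInt, hW, hW]
  · simp
  · exact Num.lt_add_one_iff.2 (Num.pair_le_pair hz.le le_rfl)
  · exact Num.lt_add_one_iff.2 (Num.pair_le_pair hz.le zero_le)

/-- The matrix of integer codes given by a string. -/
noncomputable def matCode (X : M.Str) (a b : M.Num) : Code M := cellCode X (pair a b)

@[fun_prop]
theorem Mor.matCode {W : α → M.Str} {i j : α → M.Num} (hW : Mor M W) (hi : Mor M i)
    (hj : Mor M j) : Mor M fun x => matCode (W x) (i x) (j x) := by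
  unfold VSharpL.matCode
  fun_prop

theorem mat_eq (X : M.Str) (a b : M.Num) : mat X a b = (matCode X a b).toInt := cell_eq _ _

theorem exists_mat {F : M.Num → M.Num → Code M} (hF : Mor M fun x : M.Num × M.Num => F x.1 x.2)
    (a : M.Num) : ∃ W : M.Str, ∀ x y, x < a → y < a → matCode W x y = F x y := by
  obtain ⟨W, hW⟩ := exists_cell (F := fun z : M.Num => F (fstNum z) (sndNum z))
    (by fun_prop) (pair a a)
  refine ⟨W, fun x y hx hy => ?_⟩
  rw [matCode, hW]
  · simp
  · exact (pair_lt_aux hx hy)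
where
  pair_lt_aux {a x y : M.Num} (hx : x < a) (hy : y < a) : pair x y < pair a a :=
    (Num.pair_le_pair hx.le le_rfl).trans_lt (Num.pair_lt_pair_right hy)

theorem zSum_two {d u₁ u₂ : M.Num} {f : M.Num → IntCode M} {F : M.Num → Code M} (h12 : u₁ < u₂)
    (h2 : u₂ < d) (hf : ∀ i, i < d → f i = (F i).toInt) (h0 : ∀ i, i ≠ u₁ → i ≠ u₂ → F i = 0) :
    zSum d f = (F u₁ + F u₂).toInt := by
  unfold zSum
  rw [bSum_two (F := fun i => (F i).pos) h12 h2 (fun i hi => by rw [hf i hi]; rfl)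
      (fun i h h' => by rw [h0 i h h']; rfl),
    bSum_two (F := fun i => (F i).neg) h12 h2 (fun i hi => by rw [hf i hi]; rfl)
      (fun i h h' => by rw [h0 i h h']; rfl)]
  rfl

theorem code_mul_zero (a : Code M) : a * 0 = 0 := by
  ext1 <;> simp [str_mul_zero]

/-- Families of solutions of affine recursions, from powers of sparse matrices. -/
theorem exists_affine_rec {f g : M.Num → M.Num → M.Str}
    (hf : Mor M fun x : M.Num × M.Num => f x.1 x.2)
    (hg : Mor M fun x : M.Num × M.Num => g x.1 x.2) (a n : M.Num) :
    ∃ v : M.Num → M.Num → M.Str, (Mor M fun x : M.Num × M.Num => v x.1 x.2) ∧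
      ∀ c, c < a → v c 0 = 0 ∧ ∀ s, s < n → v c (s + 1) = v c s * g c s + f c s := by
  classical
  let E : M.Num → M.Num → Code M := fun u w =>
    if w = pair (pair (fstNum (fstNum u)) (sndNum (fstNum u) + 1)) 0 then
      if u = pair (pair (fstNum (fstNum u)) (sndNum (fstNum u))) 0 then ⟨1, 0⟩ else ⟨0, 0⟩
    else if w = pair (pair (fstNum (fstNum u)) (sndNum (fstNum u) + 1)) 1 then
      if u = pair (pair (fstNum (fstNum u)) (sndNum (fstNum u))) 0 then
        ⟨f (fstNum (fstNum u)) (sndNum (fstNum u)), 0⟩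
      else if u = pair (pair (fstNum (fstNum u)) (sndNum (fstNum u))) 1 then
        ⟨g (fstNum (fstNum u)) (sndNum (fstNum u)), 0⟩
      else ⟨0, 0⟩
    else ⟨0, 0⟩
  have hE : Mor M fun x : M.Num × M.Num => E x.1 x.2 := by
    dsimp only [E]
    fun_prop
  let D := pair (pair a (n + 1)) 1 + 1
  have hD : ∀ c s b, c < a → s ≤ n → b ≤ 1 → pair (pair c s) b < D := fun c s b hc hs hb =>
    Num.lt_add_one_iff.2 (Num.pair_le_pair (Num.pair_le_pair hc.le (hs.trans (lt_add_one n).le)) hb)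
  obtain ⟨X, hX⟩ := exists_mat hE D
  obtain ⟨-, W, ⟨hW0, hWs⟩, -⟩ := hM.isModel.matrix_pow X D n
  let P : M.Num → M.Num → M.Num → Code M := fun i x y => cellCode W (pair (pair i x) y)
  have hP : ∀ i x y, matItem W i x y = (P i x y).toInt := fun i x y => cell_eq _ _
  have hE01 : ∀ c s u, u ≠ pair (pair c s) 0 → u ≠ pair (pair c s) 1 →
      ∀ b, E u (pair (pair c (s + 1)) b) = 0 := by
    intro c s u h0 h1 b
    dsimp only [E]
    simp only [Num.pair_inj]
    split_ifs with h2 h3 h4 h5 h6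
    · obtain ⟨⟨h7, h8⟩, -⟩ := h2
      rw [← h7, ← add_right_cancel h8] at h3
      exact absurd h3 h0
    · rfl
    · obtain ⟨⟨h7, h8⟩, -⟩ := h4
      rw [← h7, ← add_right_cancel h8] at h5
      exact absurd h5 h0
    · obtain ⟨⟨h7, h8⟩, -⟩ := h4
      rw [← h7, ← add_right_cancel h8] at h6
      exact absurd h6 h1
    · rfl
    · rfl
  have hstep : ∀ c s b, c < a → s < n → b ≤ 1 →
      P (s + 1) (pair (pair c 0) 0) (pair (pair c (s + 1)) b) =
        P s (pair (pair c 0) 0) (pair (pair c s) 0) *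
          E (pair (pair c s) 0) (pair (pair c (s + 1)) b) +
        P s (pair (pair c 0) 0) (pair (pair c s) 1) *
          E (pair (pair c s) 1) (pair (pair c (s + 1)) b) := by
    intro c s b hc hs hb
    apply Code.toInt_injective
    have h1 := hD c 0 0 hc zero_le zero_le
    have h2 := hD c (s + 1) b hc (Num.add_one_le_iff.2 hs) hb
    have h3 := hD c s 0 hc hs.le zero_le
    have h4 := hD c s 1 hc hs.le le_rfl
    rw [← hP, hWs s hs _ _ h1 h2, matMul]
    refine zSum_two (F := fun l => P s (pair (pair c 0) 0) l * E l (pair (pair c (s + 1)) b))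
      (Num.pair_lt_pair_right zero_lt_one) h4 ?_ ?_
    · intro i hi
      rw [hP, mat_eq, hX i _ hi h2, zMul_toInt]
    · intro i hi0 hi1
      rw [hE01 c s i hi0 hi1, code_mul_zero]
  have hone : ∀ c, c < a → ∀ s, s ≤ n → P s (pair (pair c 0) 0) (pair (pair c s) 0) = 1 := by
    intro c hc
    refine induction_mor (.imp (by fun_prop) (by dsimp only [P]; fun_prop)) ?_ fun s ih hs => ?_
    · intro _
      apply Code.toInt_injective
      rw [← hP, hW0 _ _ (hD c 0 0 hc zero_le zero_le) (hD c 0 0 hc zero_le zero_le), matOne_eq,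
        if_pos rfl]
    · have hs' := Num.add_one_le_iff.1 hs
      rw [hstep c s 0 hc hs' zero_le, ih hs'.le]
      have h1 : E (pair (pair c s) 0) (pair (pair c (s + 1)) 0) = 1 := by
        simp only [E, fstNum_pair, sndNum_pair, if_true]
        rfl
      have h2 : E (pair (pair c s) 1) (pair (pair c (s + 1)) 0) = 0 := by
        simp [E, Num.pair_inj]
        rfl
      rw [h1, h2, code_mul_zero]
      ext1 <;> simp [str_one_mul, str_zero_mul]
  refine ⟨fun c s => (P s (pair (pair c 0) 0) (pair (pair c s) 1)).pos, ?_, fun c hc => ⟨?_, ?_⟩⟩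
  · dsimp only [P]
    fun_prop
  · have : P 0 (pair (pair c 0) 0) (pair (pair c 0) 1) = 0 := by
      apply Code.toInt_injective
      rw [← hP, hW0 _ _ (hD c 0 0 hc zero_le zero_le) (hD c 0 1 hc zero_le le_rfl), matOne_eq,
        if_neg (by simp [Num.pair_inj])]
    dsimp only
    rw [this]
    rfl
  · intro s hs
    dsimp only
    rw [hstep c s 1 hc hs le_rfl, hone c hc s hs.le]
    have h1 : E (pair (pair c s) 0) (pair (pair c (s + 1)) 1) = ⟨f c s, 0⟩ := by
      simp [E, Num.pair_inj]
    have h2 : E (pair (pair c s) 1) (pair (pair c (s + 1)) 1) = ⟨g c s, 0⟩ := by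
      simp [E, Num.pair_inj]
    rw [h1, h2]
    simp [str_one_mul, str_mul_zero, add_comm]

end VSharpL

namespace VSharpL
universe u v w
variable {M : TwoSorted.{u}} [hM : Model M]

variable {α : Type v} [Space M α]

@[fun_prop]
theorem Mor.mul_str {X Y : α → M.Str} (hX : Mor M X) (hY : Mor M Y) :
    Mor M fun x => X x * Y x := by
  classical
  refine .of_local fun p hp a => ?_
  obtain ⟨v, hv, h⟩ := exists_affine_rec (f := fun c s => if s = 0 then X (p c) else 0)
    (g := fun c s => if s = 0 then 0 else Y (p c)) (by fun_prop) (by fun_prop) a (1 + 1)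
  refine ⟨fun z => v z (1 + 1), by fun_prop, fun z hz => ?_⟩
  obtain ⟨h0, hs⟩ := h z hz
  have h1 := hs 0 (by positivity)
  have h2 := hs 1 (lt_add_one 1)
  rw [zero_add, if_pos rfl, if_pos rfl, h0, str_mul_zero, zero_add] at h1
  beta_reduce
  rw [h2, if_neg one_ne_zero, if_neg one_ne_zero, add_zero, h1]

/-- The string of the elements of `X` below `i`. -/
noncomputable def low (i : M.Num) (X : M.Str) : M.Str := mkStr i fun j => M.mem j X

@[fun_prop]
theorem Mor.low {i : α → M.Num} {X : α → M.Str} (hi : Mor M i) (hX : Mor M X) :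
    Mor M fun x => low (i x) (X x) := by
  unfold VSharpL.low
  fun_prop

theorem mem_low (i j : M.Num) (X : M.Str) : M.mem j (low i X) ↔ j < i ∧ M.mem j X :=
  mem_mkStr (by fun_prop) j

theorem low_zero (X : M.Str) : low 0 X = 0 := str_ext fun i => by simp [mem_low]

theorem low_len (X : M.Str) : low (M.len X) X = X :=
  str_ext fun i => by
    rw [mem_low]
    exact ⟨And.right, fun h => ⟨lt_len_of_mem h, h⟩⟩

open Classical in
theorem low_succ (i : M.Num) (X : M.Str) :
    low (i + 1) X = low i X + if M.mem i X then shift i 1 else 0 := by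
  refine str_ext fun j => ?_
  rw [mem_add_of_disjoint]
  · split_ifs with h
    · simp only [mem_low, mem_shift_iff, mem_one, exists_eq_right, add_zero, Num.lt_add_one_iff,
        le_iff_lt_or_eq]
      constructor
      · rintro ⟨h1 | rfl, h2⟩
        · exact .inl ⟨h1, h2⟩
        · exact .inr rfl
      · rintro (⟨h1, h2⟩ | rfl)
        · exact ⟨.inl h1, h2⟩
        · exact ⟨.inr rfl, h⟩
    · simp only [mem_low, not_mem_zero, or_false, Num.lt_add_one_iff, le_iff_lt_or_eq]
      constructor
      · rintro ⟨h1 | rfl, h2⟩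
        · exact ⟨h1, h2⟩
        · exact absurd h2 h
      · rintro ⟨h1, h2⟩
        exact ⟨.inl h1, h2⟩
  · rintro j ⟨h1, h2⟩
    split_ifs at h2
    · exact (le_of_mem_shift h2).not_gt ((mem_low _ _ _).1 h1).1
    · exact not_mem_zero _ h2

theorem str_mul_add (X Y Z : M.Str) : X * (Y + Z) = X * Y + X * Z := by
  have h1 := Mor.mulSeq X (Y + Z)
  have h2 := Mor.mulSeq X Y
  have h3 := Mor.mulSeq X Z
  have : ∀ i, mulSeq X (Y + Z) i = mulSeq X Y i + mulSeq X Z i := by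
    refine induction_mor (by fun_prop) (by simp [mulSeq_zero]) fun i ih => ?_
    rw [mulSeq_succ, mulSeq_succ, mulSeq_succ, ih, shift_add]
    split_ifs
    · exact add_add_add_comm _ _ _ _
    · simp
  exact this _

theorem str_mul_shift (X Y : M.Str) (k : M.Num) : X * shift k Y = shift k (X * Y) := by
  have h1 := Mor.mulSeq X (shift k Y)
  have h2 := Mor.mulSeq X Y
  have : ∀ i, mulSeq X (shift k Y) i = shift k (mulSeq X Y i) := by
    refine induction_mor (by fun_prop) (by simp [mulSeq_zero]) fun i ih => ?_
    rw [mulSeq_succ, mulSeq_succ, ih, shift_add, shift_shift, add_comm i k, ← shift_shift]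
    split_ifs
    · rfl
    · simp
  exact this _

theorem str_mul_one (X : M.Str) : X * 1 = X := by
  have h1 := Mor.mulSeq X 1
  have : ∀ i, mulSeq X 1 i = low i X := by
    refine induction_mor (by fun_prop) (by rw [mulSeq_zero, low_zero]) fun i ih => ?_
    rw [mulSeq_succ, low_succ, ih]
  exact (this _).trans (low_len X)

theorem str_mul_low_succ (X Y : M.Str) (i : M.Num) [Decidable (M.mem i Y)] :
    X * low (i + 1) Y = X * low i Y + if M.mem i Y then shift i X else 0 := by
  rw [low_succ, str_mul_add]
  split_ifs
  · rw [str_mul_shift, str_mul_one]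
  · rw [str_mul_zero]

theorem str_mul_comm (X Y : M.Str) : X * Y = Y * X := by
  classical
  have h1 := Mor.mulSeq Y X
  have : ∀ i, X * low i Y = mulSeq Y X i := by
    refine induction_mor (by fun_prop) ?_ fun i ih => ?_
    · rw [mulSeq_zero, low_zero, str_mul_zero]
    · rw [mulSeq_succ, str_mul_low_succ, ih]
  have := this (M.len Y)
  rwa [low_len] at this

theorem str_mul_assoc (X Y Z : M.Str) : X * Y * Z = X * (Y * Z) := by
  classical
  have : ∀ i, X * Y * low i Z = X * (Y * low i Z) := by
    refine induction_mor (by fun_prop) ?_ fun i ih => ?_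
    · simp only [low_zero, str_mul_zero]
    · rw [str_mul_low_succ, str_mul_low_succ, ih, str_mul_add]
      split_ifs
      · rw [str_mul_shift]
      · rw [str_mul_zero]
  have := this (M.len Z)
  rwa [low_len] at this

noncomputable instance : CommSemiring M.Str where
  mul_assoc := str_mul_assoc
  one_mul := str_one_mul
  mul_one := str_mul_one
  left_distrib := str_mul_add
  right_distrib X Y Z := by
    rw [str_mul_comm, str_mul_add, str_mul_comm Z, str_mul_comm Z]
  zero_mul := str_zero_mul
  mul_zero := str_mul_zero
  mul_comm := str_mul_comm

theorem str_ne_zero_iff {X : M.Str} : X ≠ 0 ↔ ∃ i, M.mem i X := by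
  constructor
  · intro h
    by_contra h'
    push Not at h'
    exact h (str_ext fun i => by simp [h' i])
  · rintro ⟨i, hi⟩ rfl
    exact not_mem_zero i hi

theorem str_eq_zero_of_add {X Y : M.Str} (h : X + Y = 0) : X = 0 := by
  by_contra hX
  obtain ⟨i, hi⟩ := str_ne_zero_iff.1 hX
  obtain ⟨l, -, hl⟩ := exists_mem_add_of_mem Y hi
  rw [h] at hl
  exact not_mem_zero l hl

instance : Nontrivial M.Str := ⟨1, 0, str_ne_zero_iff.2 ⟨0, by simp⟩⟩

theorem str_eq_one_add {X : M.Str} (h : X ≠ 0) : ∃ k Y, X = shift k 1 + Y := by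
  obtain ⟨k, hk⟩ := str_ne_zero_iff.1 h
  refine ⟨k, mkStr (M.len X) fun i => M.mem i X ∧ i ≠ k, str_ext fun i => ?_⟩
  have hm : ∀ j, M.mem j (mkStr (M.len X) fun i => M.mem i X ∧ i ≠ k) ↔ j < M.len X ∧
      (M.mem j X ∧ j ≠ k) := fun j => mem_mkStr (by fun_prop) j
  rw [mem_add_of_disjoint]
  · simp only [hm, mem_shift_iff, mem_one, exists_eq_right, add_zero]
    constructor
    · intro hi
      by_cases h : i = k
      · exact .inl h
      · exact .inr ⟨lt_len_of_mem hi, hi, h⟩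
    · rintro (rfl | h)
      · exact hk
      · exact h.2.1
  · simp only [hm, mem_shift_iff, mem_one, exists_eq_right, add_zero]
    rintro j ⟨h1, h2⟩
    exact h2.2.2 h1

theorem shift_eq_mul (k : M.Num) (X : M.Str) : shift k X = shift k 1 * X := by
  rw [mul_comm, str_mul_shift, mul_one]

theorem shift_ne_zero {k : M.Num} {X : M.Str} (h : X ≠ 0) : shift k X ≠ 0 := by
  obtain ⟨i, hi⟩ := str_ne_zero_iff.1 h
  exact str_ne_zero_iff.2 ⟨k + i, (mem_shift k i X).2 hi⟩

instance : NoZeroDivisors M.Str where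
  eq_zero_or_eq_zero_of_mul_eq_zero {X Y} h := by
    by_contra! hne
    obtain ⟨k, Z, rfl⟩ := str_eq_one_add hne.1
    rw [add_mul, ← shift_eq_mul] at h
    exact shift_ne_zero hne.2 (str_eq_zero_of_add h)

noncomputable instance : CommSemiring (Code M) where
  add_assoc a b c := by ext1 <;> simp [add_assoc]
  zero_add a := by ext1 <;> simp
  add_zero a := by ext1 <;> simp
  add_comm a b := by ext1 <;> simp [add_comm]
  nsmul := nsmulRec
  mul_assoc a b c := by ext1 <;> simp <;> ring
  one_mul a := by ext1 <;> simp
  mul_one a := by ext1 <;> simp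
  left_distrib a b c := by ext1 <;> simp <;> ring
  right_distrib a b c := by ext1 <;> simp <;> ring
  zero_mul a := by ext1 <;> simp
  mul_zero a := by ext1 <;> simp
  mul_comm a b := by ext1 <;> simp <;> ring

end VSharpL

namespace VSharpL
universe u v w
variable {M : TwoSorted.{u}} [hM : Model M]

variable {α : Type v} [Space M α]

/-! ### Sums inside the model -/

/-- A monoid in which coded families can be compared and summed. -/
class SumSpace (M : TwoSorted.{u}) [Model M] (R : Type w) [AddCommMonoid R] [Space M R] :
    Prop where
  mor_add : Mor M fun x : R × R => x.1 + x.2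
  mor_eq : Mor M fun x : R × R => x.1 = x.2
  mor_ite : ∀ {P : M.Num → Prop} [∀ x, Decidable (P x)] {f g : M.Num → R}, Mor M P → Mor M f →
    Mor M g → Mor M fun x => if P x then f x else g x
  exists_sum : ∀ {f : M.Num → M.Num → R}, (Mor M fun x : M.Num × M.Num => f x.1 x.2) → ∀ a n,
    ∃ v : M.Num → M.Num → R, (Mor M fun x : M.Num × M.Num => v x.1 x.2) ∧
      ∀ c, c < a → v c 0 = 0 ∧ ∀ s, s < n → v c (s + 1) = v c s + f c s

/-- A semiring in which coded families can be compared, summed and multiplied. -/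
class RingSpace (M : TwoSorted.{u}) [Model M] (R : Type w) [CommSemiring R] [Space M R] : Prop
    extends SumSpace M R where
  mor_mul : Mor M fun x : R × R => x.1 * x.2

section SumSpace

variable {R : Type w} [AddCommMonoid R] [Space M R] [SumSpace M R]

namespace Mor

@[fun_prop]
theorem add {f g : α → R} (hf : Mor M f) (hg : Mor M g) : Mor M fun x => f x + g x :=
  (SumSpace.mor_add (M := M) (R := R)).comp (hf.prodMk hg)

@[fun_prop]
theorem eq {f g : α → R} (hf : Mor M f) (hg : Mor M g) : Mor M fun x => f x = g x :=
  (SumSpace.mor_eq (M := M) (R := R)).comp (hf.prodMk hg)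

@[fun_prop]
theorem ite {P : α → Prop} [∀ x, Decidable (P x)] {f g : α → R} (hP : Mor M P) (hf : Mor M f)
    (hg : Mor M g) : Mor M fun x => if P x then f x else g x := fun p hp =>
  (SumSpace.mor_ite (hP.comp (.of_adm hp)) (hf.comp (.of_adm hp)) (hg.comp (.of_adm hp))).adm

end Mor

open Classical in
/-- The sum of `f i` over `i < d` (for coded `f`). -/
noncomputable def isum (d : M.Num) (f : M.Num → R) : R :=
  if h : Mor M f then
    (SumSpace.exists_sum (f := fun _ => f) (h.comp (Mor.snd .id)) 1 d).choose 0 d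
  else 0

theorem isum_eq {d : M.Num} {f S : M.Num → R} (hf : Mor M f) (hS : Mor M S) (h0 : S 0 = 0)
    (hs : ∀ i, i < d → S (i + 1) = S i + f i) : isum d f = S d := by
  classical
  unfold isum
  rw [dif_pos hf]
  have H := (SumSpace.exists_sum (f := fun _ => f) (hf.comp (Mor.snd .id)) 1 d).choose_spec
  set v := (SumSpace.exists_sum (f := fun _ => f) (hf.comp (Mor.snd .id)) 1 d).choose
  obtain ⟨hv, h⟩ := H
  obtain ⟨hv0, hvs⟩ := h 0 zero_lt_one
  have key : ∀ i, i ≤ d → v 0 i = S i := by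
    refine induction_mor (.imp (by fun_prop) (by fun_prop)) ?_ fun i ih hi => ?_
    · intro _; rw [hv0, h0]
    · have hi' := Num.add_one_le_iff.1 hi
      rw [hvs i hi', hs i hi', ih hi'.le]
  exact key d le_rfl

@[fun_prop]
theorem Mor.isum {d : α → M.Num} {f : α → M.Num → R} (hd : Mor M d)
    (hf : Mor M fun x : α × M.Num => f x.1 x.2) : Mor M fun x => isum (d x) (f x) := by
  refine .of_local fun p hp a => ?_
  obtain ⟨n, hn⟩ := (hd.comp hp).adm.1 a
  obtain ⟨v, hv, h⟩ := SumSpace.exists_sum (f := fun c s => f (p c) s) (by fun_prop) a n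
  refine ⟨fun z => v z (d (p z)), by fun_prop, fun z hz => ?_⟩
  obtain ⟨h0, hs⟩ := h z hz
  exact isum_eq (by fun_prop) (by fun_prop) h0 fun i hi => hs i (hi.trans (hn z hz))

theorem isum_zero (f : M.Num → R) : isum 0 f = 0 := by
  classical
  by_cases hf : Mor M f
  · obtain ⟨v, hv, h⟩ := SumSpace.exists_sum (f := fun _ s => f s) (hf.comp (Mor.snd .id)) 1 0
    rw [isum_eq hf (S := v 0) (hv.curry 0) (h 0 zero_lt_one).1 fun i hi => absurd hi not_lt_zero]
    exact (h 0 zero_lt_one).1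
  · exact dif_neg hf

theorem isum_succ {f : M.Num → R} (hf : Mor M f) (d : M.Num) :
    isum (d + 1) f = isum d f + f d := by
  obtain ⟨v, hv, h⟩ := SumSpace.exists_sum (f := fun _ s => f s) (hf.comp (Mor.snd .id)) 1 (d + 1)
  obtain ⟨h0, hs⟩ := h 0 zero_lt_one
  rw [isum_eq hf (S := v 0) (hv.curry 0) h0 hs, hs d (lt_add_one d),
    isum_eq hf (S := v 0) (hv.curry 0) h0 fun i hi => hs i (hi.trans (lt_add_one d))]

theorem isum_congr {d : M.Num} {f g : M.Num → R} (hf : Mor M f) (hg : Mor M g)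
    (h : ∀ i, i < d → f i = g i) : isum d f = isum d g := by
  refine isum_eq hf (S := fun d => VSharpL.isum d g) (by fun_prop) (isum_zero g) fun i hi => ?_
  rw [isum_succ hg, h i hi]

theorem isum_eq_zero {d : M.Num} {f : M.Num → R} (hf : Mor M f) (h : ∀ i, i < d → f i = 0) :
    isum d f = 0 :=
  isum_eq hf (S := fun _ => 0) (by fun_prop) rfl fun i hi => by rw [h i hi, add_zero]

theorem isum_add (d : M.Num) {f g : M.Num → R} (hf : Mor M f) (hg : Mor M g) :
    isum d (fun i => f i + g i) = isum d f + isum d g :=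
  isum_eq (S := fun d => VSharpL.isum d f + VSharpL.isum d g) (by fun_prop) (by fun_prop)
    (by simp [isum_zero]) fun i _ => by
      rw [isum_succ hf, isum_succ hg, add_add_add_comm]

theorem isum_hom {R' : Type*} [AddCommMonoid R'] [Space M R'] [SumSpace M R'] {φ : R → R'}
    (hφ : Mor M φ) (h0 : φ 0 = 0) (hadd : ∀ a b, φ (a + b) = φ a + φ b) (d : M.Num)
    {f : M.Num → R} (hf : Mor M f) : φ (isum d f) = isum d fun i => φ (f i) :=
  (isum_eq (S := fun d => φ (VSharpL.isum d f)) (by fun_prop) (by fun_prop)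
    (by rw [isum_zero, h0]) fun i _ => by rw [isum_succ hf, hadd]).symm

theorem isum_comm (d e : M.Num) {f : M.Num → M.Num → R}
    (hf : Mor M fun x : M.Num × M.Num => f x.1 x.2) :
    isum d (fun i => isum e fun j => f i j) = isum e fun j => isum d fun i => f i j := by
  refine isum_eq (S := fun d => VSharpL.isum e fun j => VSharpL.isum d fun i => f i j)
    (by fun_prop) (by fun_prop) ?_ fun i _ => ?_
  · exact isum_eq_zero (by fun_prop) fun j _ => isum_zero _
  · rw [← isum_add e (by fun_prop) (by fun_prop)]
    exact isum_congr (by fun_prop) (by fun_prop) fun j _ => isum_succ (by fun_prop) _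

theorem isum_ite_eq (d k : M.Num) (a : R) :
    isum d (fun i => if i = k then a else 0) = if k < d then a else 0 := by
  refine isum_eq (S := fun d => if k < d then a else 0) (by fun_prop) (by fun_prop)
    (if_neg not_lt_zero) fun i _ => ?_
  rcases lt_trichotomy i k with h | rfl | h
  · rw [if_neg h.ne, if_neg h.not_gt, if_neg, add_zero]
    exact fun h' => (Num.lt_add_one_iff.1 h').not_gt h
  · simp
  · rw [if_neg h.ne', if_pos h, if_pos (h.trans (lt_add_one i)), add_zero]

theorem isum_eq_single {d k : M.Num} {f : M.Num → R} (hf : Mor M f) (hk : k < d)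
    (h : ∀ i, i < d → i ≠ k → f i = 0) : isum d f = f k := by
  have := isum_ite_eq d k (f k)
  rw [if_pos hk] at this
  rw [← this]
  refine isum_congr hf (by fun_prop) fun i hi => ?_
  split_ifs with hik
  · rw [hik]
  · exact h i hi hik

theorem isum_reindex {D d : M.Num} {f : M.Num → R} (hf : Mor M f) {h : M.Num → M.Num}
    (hh : Mor M h) (inj : ∀ i j, i < d → j < d → h i = h j → i = j) (maps : ∀ j, j < d → h j < D)
    (supp : ∀ i, i < D → f i ≠ 0 → ∃ j, j < d ∧ i = h j) :
    isum D f = isum d fun j => f (h j) := by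
  have h1 : isum D f = isum D fun i => isum d fun j => if i = h j then f (h j) else 0 := by
    refine isum_congr hf (by fun_prop) fun i hi => ?_
    by_cases h0 : f i = 0
    · rw [isum_eq_zero (by fun_prop), h0]
      intro j hj
      split_ifs with hij
      · rw [← hij, h0]
      · rfl
    · obtain ⟨j, hj, rfl⟩ := supp i hi h0
      rw [isum_eq_single (k := j) (by fun_prop) hj, if_pos rfl]
      intro k hk hkj
      exact if_neg fun h' => hkj (inj j k hj hk h').symm
  rw [h1, isum_comm _ _ (by fun_prop)]
  refine isum_congr (by fun_prop) (by fun_prop) fun j hj => ?_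
  rw [isum_ite_eq, if_pos (maps j hj)]

theorem isum_of_le {D d : M.Num} {f : M.Num → R} (hf : Mor M f) (hd : d ≤ D)
    (h : ∀ i, d ≤ i → i < D → f i = 0) : isum D f = isum d f :=
  isum_reindex hf Mor.id (fun _ _ _ _ h => h) (fun _ hj => hj.trans_le hd) fun i hi h0 =>
    ⟨i, not_le.1 fun h' => h0 (h i h' hi), rfl⟩

end SumSpace

section RingSpace

variable {R : Type w} [CommSemiring R] [Space M R] [RingSpace M R]

@[fun_prop]
theorem Mor.mul {f g : α → R} (hf : Mor M f) (hg : Mor M g) : Mor M fun x => f x * g x :=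
  (RingSpace.mor_mul (M := M) (R := R)).comp (hf.prodMk hg)

theorem isum_mul_left (d : M.Num) (a : R) {f : M.Num → R} (hf : Mor M f) :
    isum d (fun i => a * f i) = a * isum d f :=
  (isum_hom (φ := fun x => a * x) (by fun_prop) (mul_zero a) (mul_add a) d hf).symm

theorem isum_mul_right (d : M.Num) (a : R) {f : M.Num → R} (hf : Mor M f) :
    isum d (fun i => f i * a) = isum d f * a :=
  (isum_hom (φ := fun x => x * a) (by fun_prop) (zero_mul a) (fun b c => add_mul b c a) d hf).symm

end RingSpace

instance : RingSpace M M.Str where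
  mor_add := .add_str (by fun_prop) (by fun_prop)
  mor_eq := .eq_str (by fun_prop) (by fun_prop)
  mor_ite hP hf hg := .ite_str hP hf hg
  mor_mul := .mul_str (by fun_prop) (by fun_prop)
  exists_sum {f} hf a n := by
    obtain ⟨v, hv, h⟩ := exists_affine_rec hf (g := fun _ _ => 1) (by fun_prop) a n
    exact ⟨v, hv, fun c hc => ⟨(h c hc).1, fun s hs => by rw [(h c hc).2 s hs, mul_one]⟩⟩

instance : RingSpace M (Code M) where
  mor_add := .add_code (by fun_prop) (by fun_prop)
  mor_eq := .eq_code (by fun_prop) (by fun_prop)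
  mor_ite hP hf hg := .ite_code hP hf hg
  mor_mul := by
    show Mor M fun x : Code M × Code M =>
      Code.mk (x.1.pos * x.2.pos + x.1.neg * x.2.neg) (x.1.pos * x.2.neg + x.1.neg * x.2.pos)
    fun_prop
  exists_sum {f} hf a n := by
    obtain ⟨v, hv, h⟩ := SumSpace.exists_sum (f := fun c s => (f c s).pos) (by fun_prop) a n
    obtain ⟨w, hw, h'⟩ := SumSpace.exists_sum (f := fun c s => (f c s).neg) (by fun_prop) a n
    refine ⟨fun c s => ⟨v c s, w c s⟩, by fun_prop, fun c hc => ⟨?_, fun s hs => ?_⟩⟩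
    · dsimp only
      rw [(h c hc).1, (h' c hc).1]
      rfl
    · dsimp only
      rw [(h c hc).2 s hs, (h' c hc).2 s hs]
      rfl

theorem zSum_toInt {d : M.Num} {f : M.Num → IntCode M} {F : M.Num → Code M} (hF : Mor M F)
    (hf : ∀ i, i < d → f i = (F i).toInt) : zSum d f = (isum d F).toInt := by
  unfold zSum Code.toInt
  congr 1
  · exact bSum_eq (S := fun i => (isum i F).pos) (F := fun i => (F i).pos) (by fun_prop)
      (fun i hi => by rw [hf i hi]; rfl) (by rw [isum_zero]; rfl) fun i _ => by rw [isum_succ hF]; rfl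
  · exact bSum_eq (S := fun i => (isum i F).neg) (F := fun i => (F i).neg) (by fun_prop)
      (fun i hi => by rw [hf i hi]; rfl) (by rw [isum_zero]; rfl) fun i _ => by rw [isum_succ hF]; rfl

end VSharpL

namespace VSharpL
universe u v w
variable {M : TwoSorted.{u}} [hM : Model M]

variable {α : Type v} [Space M α]

/-! ### Linear recursion from matrix powers -/

theorem lt_pair_succ {x y a b : M.Num} (hx : x ≤ a) (hy : y ≤ b) : pair x y < pair a b + 1 :=
  Num.lt_add_one_iff.2 (Num.pair_le_pair hx hy)

/-- Families of solutions of linear recursions with coded coefficients. -/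
theorem exists_linear_rec {A : M.Num → M.Num → M.Num → M.Num → Code M}
    (hA : Mor M fun x : M.Num × M.Num × M.Num × M.Num => A x.1 x.2.1 x.2.2.1 x.2.2.2)
    (a n D : M.Num) :
    ∃ v : M.Num → M.Num → M.Num → Code M,
      (Mor M fun x : M.Num × M.Num × M.Num => v x.1 x.2.1 x.2.2) ∧
      ∀ c, c < a → (∀ i, i < D → v c 0 i = if i = 0 then 1 else 0) ∧
        ∀ s, s < n → ∀ i, i < D → v c (s + 1) i = isum D fun j => v c s j * A c s j i := by
  classical
  let E : M.Num → M.Num → Code M := fun u w =>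
    if u = pair (pair (fstNum (fstNum u)) (sndNum (fstNum u))) (sndNum u) ∧ sndNum u < D ∧
        fstNum w = pair (fstNum (fstNum u)) (sndNum (fstNum u) + 1) then
      A (fstNum (fstNum u)) (sndNum (fstNum u)) (sndNum u) (sndNum w)
    else 0
  have hE : Mor M fun x : M.Num × M.Num => E x.1 x.2 := by
    dsimp only [E]
    fun_prop
  let N := pair (pair a (n + 1)) D + 1
  have hN : ∀ c s i, c < a → s ≤ n → i ≤ D → pair (pair c s) i < N := fun c s i hc hs hi =>
    lt_pair_succ (Num.pair_le_pair hc.le (hs.trans (lt_add_one n).le)) hi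
  obtain ⟨X, hX⟩ := exists_mat hE N
  obtain ⟨-, W, ⟨hW0, hWs⟩, -⟩ := hM.isModel.matrix_pow X N n
  let P : M.Num → M.Num → M.Num → Code M := fun i x y => cellCode W (pair (pair i x) y)
  have hP : ∀ i x y, matItem W i x y = (P i x y).toInt := fun i x y => cell_eq _ _
  have hPm : Mor M fun x : M.Num × M.Num × M.Num => P x.1 x.2.1 x.2.2 := by
    dsimp only [P]
    fun_prop
  have hP0 : ∀ x y, x < N → y < N → P 0 x y = if x = y then 1 else 0 := by
    intro x y hx hy
    apply Code.toInt_injective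
    rw [← hP, hW0 x y hx hy, matOne_eq]
  have hPs : ∀ i x y, i < n → x < N → y < N →
      P (i + 1) x y = isum N fun l => P i x l * E l y := by
    intro i x y hi hx hy
    apply Code.toInt_injective
    rw [← hP, hWs i hi x y hx hy, matMul]
    refine zSum_toInt (by fun_prop) fun l hl => ?_
    rw [hP, mat_eq, hX l y hl hy, zMul_toInt]
  refine ⟨fun c s i => P s (pair (pair c 0) 0) (pair (pair c s) i), by fun_prop,
    fun c hc => ⟨fun i hi => ?_, fun s hs i hi => ?_⟩⟩
  · dsimp only
    rw [hP0 _ _ (hN c 0 0 hc zero_le zero_le) (hN c 0 i hc zero_le hi.le)]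
    simp [Num.pair_inj, eq_comm]
  · dsimp only
    rw [hPs s _ _ hs (hN c 0 0 hc zero_le zero_le) (hN c (s + 1) i hc (Num.add_one_le_iff.2 hs) hi.le)]
    rw [isum_reindex (d := D) (h := fun j => pair (pair c s) j) (by fun_prop) (by fun_prop)]
    · refine isum_congr (by fun_prop) (by fun_prop) fun j hj => ?_
      simp [E, hj]
    · intro i j _ _ h
      exact (Num.pair_inj.1 h).2
    · exact fun j hj => hN c s j hc hs.le hj.le
    · intro u hu hne
      have hEu : E u (pair (pair c (s + 1)) i) ≠ 0 := fun h => hne (by rw [h, mul_zero])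
      dsimp only [E] at hEu
      rw [ne_eq, ite_eq_right_iff, Classical.not_imp] at hEu
      obtain ⟨⟨h1, h2, h3⟩, -⟩ := hEu
      rw [fstNum_pair, Num.pair_inj, add_left_inj] at h3
      refine ⟨sndNum u, h2, ?_⟩
      rw [h3.1, h3.2]
      exact h1

/-! ### Matrix powers -/

/-- `T` starts with the powers `X ^ 0, …, X ^ k` of the matrix `X` of order `d`. -/
structure IsPowRec (d : M.Num) (X : M.Num → M.Num → Code M) (k : M.Num)
    (T : M.Num → M.Num → M.Num → Code M) : Prop where
  mor : Mor M fun x : M.Num × M.Num × M.Num => T x.1 x.2.1 x.2.2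
  zero : ∀ a b, a < d → b < d → T 0 a b = (open Classical in if a = b then 1 else 0)
  succ : ∀ i, i < k → ∀ a b, a < d → b < d → T (i + 1) a b = isum d fun l => T i a l * X l b

theorem IsPowRec.unique {d k k' : M.Num} {X : M.Num → M.Num → Code M}
    (hX : Mor M fun x : M.Num × M.Num => X x.1 x.2) {T T' : M.Num → M.Num → M.Num → Code M}
    (h : IsPowRec d X k T) (h' : IsPowRec d X k' T') :
    ∀ i, i ≤ k → i ≤ k' → ∀ a, a < d → ∀ b, b < d → T i a b = T' i a b := by
  have hT := h.mor
  have hT' := h'.mor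
  refine induction_mor (.imp (by fun_prop) (.imp (by fun_prop) (.forall_lt (.forall_lt
    (R := fun (x : M.Num × M.Num) b => T x.1 x.2 b = T' x.1 x.2 b) ?_ ?_) ?_))) ?_ ?_
  · fun_prop
  · fun_prop
  · fun_prop
  · intro _ _ a ha b hb
    rw [h.zero a b ha hb, h'.zero a b ha hb]
  · intro i ih hk hk' a ha b hb
    have h1 := Num.add_one_le_iff.1 hk
    have h2 := Num.add_one_le_iff.1 hk'
    rw [h.succ i h1 a b ha hb, h'.succ i h2 a b ha hb]
    refine isum_congr (by fun_prop) (by fun_prop) fun l hl => ?_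
    rw [ih h1.le h2.le a ha l hl]

open Classical in
/-- The entry `(a, b)` of the matrix power `X ^ k`, for `X` of order `d`. -/
noncomputable def powCode (d : M.Num) (X : M.Num → M.Num → Code M) (k a b : M.Num) : Code M :=
  if h : (∃ T, IsPowRec d X k T) ∧ a < d ∧ b < d then h.1.choose k a b else 0

theorem IsPowRec.powCode_eq {d k : M.Num} {X : M.Num → M.Num → Code M}
    (hX : Mor M fun x : M.Num × M.Num => X x.1 x.2) {T : M.Num → M.Num → M.Num → Code M}
    (h : IsPowRec d X k T) {a b : M.Num} (ha : a < d) (hb : b < d) :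
    powCode d X k a b = T k a b := by
  classical
  have h' : (∃ T, IsPowRec d X k T) ∧ a < d ∧ b < d := ⟨⟨T, h⟩, ha, hb⟩
  rw [powCode, dif_pos h']
  exact IsPowRec.unique hX h'.1.choose_spec h k le_rfl le_rfl a ha b hb

theorem exists_isPowRec_family {d : M.Num → M.Num} {X : M.Num → M.Num → M.Num → Code M}
    (hd : Mor M d) (hX : Mor M fun x : M.Num × M.Num × M.Num => X x.1 x.2.1 x.2.2)
    (a k : M.Num) : ∃ T : M.Num → M.Num → M.Num → M.Num → Code M,
      (Mor M fun x : M.Num × M.Num × M.Num × M.Num => T x.1 x.2.1 x.2.2.1 x.2.2.2) ∧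
      ∀ z, z < a → IsPowRec (d z) (X z) k (T z) := by
  classical
  obtain ⟨D, hD⟩ := hd.adm.1 a
  obtain ⟨v, hv, h⟩ := exists_linear_rec (A := fun c s j i =>
    if s = 0 then if j = 0 ∧ i = sndNum c then 1 else 0
    else if j < d (fstNum c) then X (fstNum c) j i else 0) (by fun_prop) (pair a D + 1) (k + 1 + 1)
    (D + 1)
  refine ⟨fun z i r b => v (pair z r) (i + 1) b, by fun_prop, fun z hz => ⟨by fun_prop, ?_, ?_⟩⟩
  · intro r b hr hb
    have hr' := (hr.trans (hD z hz))
    have hb' := ((hb.trans (hD z hz)).trans (lt_add_one D))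
    obtain ⟨h0, hs⟩ := h (pair z r) (lt_pair_succ hz.le hr'.le)
    beta_reduce
    rw [hs 0 (by positivity) b hb', isum_eq_single (k := 0) (by fun_prop) (by positivity)]
    · rw [h0 0 (by positivity)]
      simp [eq_comm]
    · intro j hj hj0
      rw [h0 j hj, if_neg hj0, zero_mul]
  · intro i hi r b hr hb
    have hr' := (hr.trans (hD z hz))
    have hb' := ((hb.trans (hD z hz)).trans (lt_add_one D))
    obtain ⟨h0, hs⟩ := h (pair z r) (lt_pair_succ hz.le hr'.le)
    beta_reduce
    rw [hs (i + 1) (add_lt_add_of_lt_of_le (hi.trans (lt_add_one k)) le_rfl) b hb',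
      isum_of_le (d := d z) (by fun_prop) ((hD z hz).trans (lt_add_one D)).le]
    · refine isum_congr (by fun_prop) (by fun_prop) fun l hl => ?_
      rw [if_neg (Num.add_one_ne_zero i), fstNum_pair, if_pos hl]
    · intro j hj _
      rw [if_neg (Num.add_one_ne_zero i), fstNum_pair, if_neg hj.not_gt, mul_zero]

theorem IsPowRec.mono {d k k' : M.Num} {X : M.Num → M.Num → Code M} (hk : k' ≤ k)
    {T : M.Num → M.Num → M.Num → Code M} (h : IsPowRec d X k T) : IsPowRec d X k' T :=
  ⟨h.mor, h.zero, fun i hi => h.succ i (hi.trans_le hk)⟩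

theorem exists_isPowRec (d k : M.Num) {X : M.Num → M.Num → Code M}
    (hX : Mor M fun x : M.Num × M.Num => X x.1 x.2) : ∃ T, IsPowRec d X k T := by
  obtain ⟨T, -, h⟩ := exists_isPowRec_family (d := fun _ => d) (X := fun _ => X)
    (by fun_prop) (by fun_prop) 1 k
  exact ⟨_, h 0 zero_lt_one⟩

@[fun_prop]
theorem Mor.powCode {d k r b : α → M.Num} {X : α → M.Num → M.Num → Code M} (hd : Mor M d)
    (hX : Mor M fun x : α × M.Num × M.Num => X x.1 x.2.1 x.2.2) (hk : Mor M k) (hr : Mor M r)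
    (hb : Mor M b) : Mor M fun x => powCode (d x) (X x) (k x) (r x) (b x) := by
  classical
  refine .of_local fun p hp a => ?_
  obtain ⟨K, hK⟩ := (hk.comp hp).adm.1 a
  obtain ⟨T, hT, h⟩ := exists_isPowRec_family (d := fun z => d (p z)) (X := fun z => X (p z))
    (by fun_prop) (by fun_prop) a K
  refine ⟨fun z => if r (p z) < d (p z) ∧ b (p z) < d (p z) then T z (k (p z)) (r (p z)) (b (p z))
    else 0, by fun_prop, fun z hz => ?_⟩
  beta_reduce
  split_ifs with hrb
  · exact ((h z hz).mono (hK z hz).le).powCode_eq (by fun_prop) hrb.1 hrb.2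
  · exact dif_neg fun h' => hrb h'.2

theorem powCode_zero {d a b : M.Num} {X : M.Num → M.Num → Code M} [Decidable (a = b)]
    (hX : Mor M fun x : M.Num × M.Num => X x.1 x.2) (ha : a < d) (hb : b < d) :
    powCode d X 0 a b = if a = b then 1 else 0 := by
  obtain ⟨T, hT⟩ := exists_isPowRec d 0 hX
  rw [hT.powCode_eq hX ha hb, hT.zero a b ha hb]
  congr

theorem powCode_succ {d k a b : M.Num} {X : M.Num → M.Num → Code M}
    (hX : Mor M fun x : M.Num × M.Num => X x.1 x.2) (ha : a < d) (hb : b < d) :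
    powCode d X (k + 1) a b = isum d fun l => powCode d X k a l * X l b := by
  obtain ⟨T, hT⟩ := exists_isPowRec d (k + 1) hX
  have hTm := hT.mor
  rw [hT.powCode_eq hX ha hb, hT.succ k (lt_add_one k) a b ha hb]
  refine isum_congr (by fun_prop) (by fun_prop) fun l hl => ?_
  rw [(hT.mono (lt_add_one k).le).powCode_eq hX ha hl]

theorem powTrace_iff {d k : M.Num} {X : M.Num → M.Num → Code M}
    (hX : Mor M fun x : M.Num × M.Num => X x.1 x.2) {W : M.Str} :
    PowTrace d (fun a b => (X a b).toInt) k W ↔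
      IsPowRec d X k fun i a b => cellCode W (pair (pair i a) b) := by
  have hP : ∀ i x y, matItem W i x y = (cellCode W (pair (pair i x) y)).toInt :=
    fun i x y => cell_eq _ _
  have hmul : ∀ i a b, matMul d (matItem W i) (fun a b => (X a b).toInt) a b =
      (isum d fun l => cellCode W (pair (pair i a) l) * X l b).toInt := by
    intro i a b
    refine zSum_toInt (by fun_prop) fun l _ => ?_
    rw [hP, zMul_toInt]
  constructor
  · rintro ⟨h0, hs⟩
    refine ⟨by fun_prop, fun a b ha hb => ?_, fun i hi a b ha hb => ?_⟩
    · apply Code.toInt_injective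
      rw [← hP, h0 a b ha hb, matOne_eq]
    · apply Code.toInt_injective
      rw [← hP, hs i hi a b ha hb, hmul]
  · intro h
    refine ⟨fun a b ha hb => ?_, fun i hi a b ha hb => ?_⟩
    · rw [hP, h.zero a b ha hb, matOne_eq]
    · rw [hP, hmul, h.succ i hi a b ha hb]

theorem matPow_toInt {d k a b : M.Num} {X : M.Num → M.Num → Code M}
    (hX : Mor M fun x : M.Num × M.Num => X x.1 x.2) (ha : a < d) (hb : b < d) :
    matPow d (fun a b => (X a b).toInt) k a b = (powCode d X k a b).toInt := by
  have hval : ∀ W, PowTrace d (fun a b => (X a b).toInt) k W →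
      matItem W k a b = (powCode d X k a b).toInt := by
    intro W hW
    rw [((powTrace_iff hX).1 hW).powCode_eq hX ha hb]
    exact cell_eq _ _
  obtain ⟨W, hW⟩ : ∃ W, PowTrace d (fun a b => (X a b).toInt) k W := by
    obtain ⟨T, hT⟩ := exists_isPowRec d k hX
    have hTm := hT.mor
    obtain ⟨W, hW⟩ := exists_cell (F := fun z => T (fstNum (fstNum z)) (sndNum (fstNum z)) (sndNum z))
      (by fun_prop) (pair (pair k d) d + 1)
    have hWT : ∀ i a b, i ≤ k → a < d → b < d → cellCode W (pair (pair i a) b) = T i a b := by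
      intro i a b hi ha hb
      rw [hW _ (lt_pair_succ (Num.pair_le_pair hi ha.le) hb.le)]
      simp
    refine ⟨W, (powTrace_iff hX).2 ⟨by fun_prop, fun a b ha hb => ?_, fun i hi a b ha hb => ?_⟩⟩
    · rw [hWT _ _ _ zero_le ha hb, hT.zero a b ha hb]
    · rw [hWT _ _ _ (Num.add_one_le_iff.2 hi) ha hb, hT.succ i hi a b ha hb]
      refine isum_congr (by fun_prop) (by fun_prop) fun l hl => ?_
      rw [hWT _ _ _ hi.le ha hl]
  ext j
  · constructor
    · rintro ⟨W, hW, h⟩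
      rwa [hval W hW] at h
    · intro h
      exact ⟨W, hW, by rwa [hval W hW]⟩
  · constructor
    · rintro ⟨W, hW, h⟩
      rwa [hval W hW] at h
    · intro h
      exact ⟨W, hW, by rwa [hval W hW]⟩

end VSharpL

namespace VSharpL
universe u v w
variable {M : TwoSorted.{u}} [hM : Model M]

variable {α : Type v} [Space M α]

/-! ### The Pfaffian of a matrix of string pairs -/

open Classical in
/-- The entries of `matJ`. -/
noncomputable def codeJ (i j : M.Num) : Code M :=
  ⟨if ∃ h, h < i + 1 ∧ (i = h + h ∧ j = h + h + 1) then 1 else 0,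
   if ∃ h, h < i + 1 ∧ (i = h + h + 1 ∧ j = h + h) then 1 else 0⟩

@[fun_prop]
theorem Mor.codeJ {i j : α → M.Num} (hi : Mor M i) (hj : Mor M j) :
    Mor M fun x => codeJ (i x) (j x) := by
  classical
  unfold VSharpL.codeJ
  refine .codeMk (.ite (.exists_lt ?_ ?_) ?_ ?_) (.ite (.exists_lt ?_ ?_) ?_ ?_) <;> fun_prop

theorem matJ_eq (i j : M.Num) : matJ i j = (codeJ i j).toInt := by
  classical
  have h1 : (∃ h, h < i + 1 ∧ (i = h + h ∧ j = h + h + 1)) ↔ ∃ h, i = h + h ∧ j = h + h + 1 := by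
    refine ⟨fun ⟨h, _, h'⟩ => ⟨h, h'⟩, fun ⟨h, h'⟩ => ⟨h, ?_, h'⟩⟩
    rw [h'.1, Num.lt_add_one_iff]
    exact le_self_add
  have h2 : (∃ h, h < i + 1 ∧ (i = h + h + 1 ∧ j = h + h)) ↔ ∃ h, i = h + h + 1 ∧ j = h + h := by
    refine ⟨fun ⟨h, _, h'⟩ => ⟨h, h'⟩, fun ⟨h, h'⟩ => ⟨h, ?_, h'⟩⟩
    rw [h'.1, Num.lt_add_one_iff, add_assoc]
    exact le_self_add
  unfold matJ codeJ Code.toInt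
  simp only [h1, h2]
  congr 1
  · funext k
    split_ifs with h
    · rw [bits_one]; simp only [h, and_true]
    · rw [bits_zero]; simp only [h, and_false]
  · funext k
    split_ifs with h
    · rw [bits_one]; simp only [h, and_true]
    · rw [bits_zero]; simp only [h, and_false]

/-- The number `R J (M J) ^ k S` for a matrix of order `2 (s + 1)`. -/
noncomputable def pbEntryCode (s : M.Num) (A : M.Num → M.Num → Code M) (k : M.Num) : Code M :=
  isum (s + s) fun a => (isum (s + s) fun l => A 0 (l + (1 + 1)) * codeJ l a) *
    isum (s + s) fun b => powCode (s + s) (fun i j => isum (s + s) fun l =>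
      A (i + (1 + 1)) (l + (1 + 1)) * codeJ l j) k a b * A (b + (1 + 1)) 1

@[fun_prop]
theorem Mor.pbEntryCode {s k : α → M.Num} {A : α → M.Num → M.Num → Code M} (hs : Mor M s)
    (hA : Mor M fun x : α × M.Num × M.Num => A x.1 x.2.1 x.2.2) (hk : Mor M k) :
    Mor M fun x => pbEntryCode (s x) (A x) (k x) := by
  unfold VSharpL.pbEntryCode
  fun_prop

theorem pbEntry_toInt {s k : M.Num} {A : M.Num → M.Num → Code M}
    (hA : Mor M fun x : M.Num × M.Num => A x.1 x.2) :
    pbEntry s (fun a b => (A a b).toInt) k = (pbEntryCode s A k).toInt := by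
  unfold pbEntry pbEntryCode
  refine zSum_toInt (by fun_prop) fun a ha => ?_
  rw [← zMul_toInt]
  congr 1
  · refine zSum_toInt (by fun_prop) fun l hl => ?_
    rw [matJ_eq, zMul_toInt]
  · refine zSum_toInt (by fun_prop) fun b hb => ?_
    rw [← zMul_toInt]
    congr 1
    rw [← matPow_toInt (by fun_prop) ha hb]
    congr 1
    funext i j
    refine zSum_toInt (by fun_prop) fun l hl => ?_
    rw [matJ_eq, ← zMul_toInt]
    rfl

open Classical in
/-- The Toeplitz matrix of the Pfaffian Berkowitz algorithm. -/
noncomputable def pbMatrixCode (s : M.Num) (A : M.Num → M.Num → Code M) (m l : M.Num) : Code M :=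
  if m = l then 1 else if m = l + 1 then A 0 1 else
  if l + (1 + 1) ≤ m then pbEntryCode s A (m - (l + (1 + 1))) else 0

@[fun_prop]
theorem Mor.pbMatrixCode {s m l : α → M.Num} {A : α → M.Num → M.Num → Code M} (hs : Mor M s)
    (hA : Mor M fun x : α × M.Num × M.Num => A x.1 x.2.1 x.2.2) (hm : Mor M m) (hl : Mor M l) :
    Mor M fun x => pbMatrixCode (s x) (A x) (m x) (l x) := by
  unfold VSharpL.pbMatrixCode
  fun_prop

theorem pbMatrix_toInt {s m l : M.Num} {A : M.Num → M.Num → Code M}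
    (hA : Mor M fun x : M.Num × M.Num => A x.1 x.2) :
    pbMatrix s (fun a b => (A a b).toInt) m l = (pbMatrixCode s A m l).toInt := by
  classical
  unfold pbMatrix pbMatrixCode
  simp only [pbEntry_toInt hA]
  have h1 : (1 : M.Num) ≠ 1 + 1 := (lt_add_one 1).ne
  split_ifs with h h' h'' <;> unfold Code.toInt
  · subst h
    have h3 : ∀ k : M.Num, m ≠ m + (1 + 1) + k := fun k hk => by
      rw [add_assoc, left_eq_add] at hk
      simp at hk
    simp [h3, bits_zero, bits_one]
  · subst h'
    have h3 : ∀ k : M.Num, l + 1 ≠ l + (1 + 1) + k := fun k hk => by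
      rw [add_assoc, add_right_inj, add_assoc, left_eq_add] at hk
      simp at hk
    simp [h3]
  · obtain ⟨k, rfl⟩ := (Num.le_iff_exists _ _).1 h''
    simp [h, h']
  · have h3 : ∀ k : M.Num, m ≠ l + (1 + 1) + k := fun k hk => h'' (hk ▸ le_self_add)
    simp [h, h', h3, bits_zero]

/-- `T` records the Pfaffian Berkowitz algorithm on the matrix `A` of order `2 n`. -/
structure IsPfRec (n : M.Num) (A : M.Num → M.Num → Code M) (T : M.Num → M.Num → Code M) :
    Prop where
  mor : Mor M fun x : M.Num × M.Num => T x.1 x.2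
  zero : T 0 0 = 1
  succ : ∀ s o, o + (s + 1) = n → ∀ m, m ≤ s + 1 → T (s + 1) m = isum (s + 1) fun l =>
    pbMatrixCode s (fun i j => A (i + (o + o)) (j + (o + o))) m l * T s l

theorem pfTrace_iff {n : M.Num} {A : M.Num → M.Num → Code M}
    (hA : Mor M fun x : M.Num × M.Num => A x.1 x.2) {W : M.Str} :
    PfTrace n (fun a b => (A a b).toInt) W ↔ IsPfRec n A fun s m => cellCode W (pair s m) := by
  have hz : ∀ s o m, (zSum (s + 1) fun l => zMul
      (pbMatrix s (matTail (o + o) fun a b => (A a b).toInt) m l) (cell W (pair s l))) =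
      (isum (s + 1) fun l => pbMatrixCode s (fun i j => A (i + (o + o)) (j + (o + o))) m l *
        cellCode W (pair s l)).toInt := by
    intro s o m
    refine zSum_toInt (by fun_prop) fun l _ => ?_
    rw [← zMul_toInt, ← pbMatrix_toInt (by fun_prop), cell_eq]
    rfl
  constructor
  · rintro ⟨h0, hs⟩
    refine ⟨by fun_prop, ?_, fun s o hso m hm => ?_⟩
    · apply Code.toInt_injective
      rw [← cell_eq, h0, zOne_eq]
    · apply Code.toInt_injective
      rw [← cell_eq, hs s o hso m hm, hz]
  · intro h
    refine ⟨?_, fun s o hso m hm => ?_⟩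
    · rw [cell_eq, h.zero, zOne_eq]
    · rw [cell_eq, h.succ s o hso m hm, hz]

theorem IsPfRec.unique {n : M.Num} {A : M.Num → M.Num → Code M}
    (hA : Mor M fun x : M.Num × M.Num => A x.1 x.2) {T T' : M.Num → M.Num → Code M}
    (h : IsPfRec n A T) (h' : IsPfRec n A T') :
    ∀ s, s ≤ n → ∀ m, m < s + 1 → T s m = T' s m := by
  have hT := h.mor
  have hT' := h'.mor
  refine induction_mor (.imp (by fun_prop) (.forall_lt (R := fun s m => T s m = T' s m) ?_ ?_)) ?_ ?_
  · fun_prop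
  · fun_prop
  · intro _ m hm
    have : m = 0 := by simpa using Num.lt_add_one_iff.1 hm
    rw [this, h.zero, h'.zero]
  · intro s ih hs m hm
    have hm' := Num.lt_add_one_iff.1 hm
    obtain ⟨o, rfl⟩ := (Num.le_iff_exists _ _).1 hs
    rw [h.succ s o (add_comm _ _) m hm', h'.succ s o (add_comm _ _) m hm']
    refine isum_congr (by fun_prop) (by fun_prop) fun l hl => ?_
    rw [ih ((lt_add_one s).le.trans hs) l hl]

open Classical in
/-- The Pfaffian of a matrix of order `2 n`. -/
noncomputable def pfCode (n : M.Num) (A : M.Num → M.Num → Code M) : Code M :=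
  if h : ∃ T, IsPfRec n A T then h.choose n n else 0

theorem IsPfRec.pfCode_eq {n : M.Num} {A : M.Num → M.Num → Code M}
    (hA : Mor M fun x : M.Num × M.Num => A x.1 x.2) {T : M.Num → M.Num → Code M}
    (h : IsPfRec n A T) : pfCode n A = T n n := by
  classical
  have h' : ∃ T, IsPfRec n A T := ⟨T, h⟩
  rw [pfCode, dif_pos h']
  exact IsPfRec.unique hA h'.choose_spec h n le_rfl n (lt_add_one n)

theorem exists_isPfRec_family {n : M.Num → M.Num} {A : M.Num → M.Num → M.Num → Code M}
    (hn : Mor M n) (hA : Mor M fun x : M.Num × M.Num × M.Num => A x.1 x.2.1 x.2.2) (a : M.Num) :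
    ∃ T : M.Num → M.Num → M.Num → Code M,
      (Mor M fun x : M.Num × M.Num × M.Num => T x.1 x.2.1 x.2.2) ∧
      ∀ z, z < a → IsPfRec (n z) (A z) (T z) := by
  classical
  obtain ⟨N, hN⟩ := hn.adm.1 a
  obtain ⟨v, hv, h⟩ := exists_linear_rec (A := fun c s j i =>
    if j < s + 1 then pbMatrixCode s (fun i j => A c (i + ((n c - (s + 1)) + (n c - (s + 1))))
      (j + ((n c - (s + 1)) + (n c - (s + 1))))) i j else 0) (by fun_prop) a N (N + 1)
  refine ⟨v, hv, fun z hz => ⟨by fun_prop, ?_, fun s o hso m hm => ?_⟩⟩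
  · rw [(h z hz).1 0 (by positivity), if_pos rfl]
  · have hs : s + 1 ≤ n z := by rw [← hso]; exact le_add_self
    have hs' : s < N := (Num.add_one_le_iff.1 hs).trans (hN z hz)
    have ho : n z - (s + 1) = o := by rw [← hso, add_tsub_cancel_right]
    rw [(h z hz).2 s hs' m (Num.lt_add_one_iff.2 (hm.trans (hs.trans (hN z hz).le))),
      isum_of_le (d := s + 1) (by fun_prop)]
    · refine isum_congr (by fun_prop) (by fun_prop) fun l hl => ?_
      rw [if_pos hl, ho, mul_comm]
    · exact (add_lt_add_of_lt_of_le hs' le_rfl).le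
    · intro i hi _
      rw [if_neg hi.not_gt, mul_zero]

theorem exists_isPfRec (n : M.Num) {A : M.Num → M.Num → Code M}
    (hA : Mor M fun x : M.Num × M.Num => A x.1 x.2) : ∃ T, IsPfRec n A T := by
  obtain ⟨T, -, h⟩ := exists_isPfRec_family (n := fun _ => n) (A := fun _ => A)
    (by fun_prop) (by fun_prop) 1
  exact ⟨_, h 0 zero_lt_one⟩

@[fun_prop]
theorem Mor.pfCode {n : α → M.Num} {A : α → M.Num → M.Num → Code M} (hn : Mor M n)
    (hA : Mor M fun x : α × M.Num × M.Num => A x.1 x.2.1 x.2.2) :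
    Mor M fun x => pfCode (n x) (A x) := by
  refine .of_local fun p hp a => ?_
  obtain ⟨T, hT, h⟩ := exists_isPfRec_family (n := fun z => n (p z)) (A := fun z => A (p z))
    (by fun_prop) (by fun_prop) a
  exact ⟨fun z => T z (n (p z)) (n (p z)), by fun_prop, fun z hz =>
    (h z hz).pfCode_eq (by fun_prop)⟩

theorem pf_toInt {n : M.Num} {A : M.Num → M.Num → Code M}
    (hA : Mor M fun x : M.Num × M.Num => A x.1 x.2) :
    pf n (fun a b => (A a b).toInt) = (pfCode n A).toInt := by
  have hval : ∀ W, PfTrace n (fun a b => (A a b).toInt) W →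
      cell W (pair n n) = (pfCode n A).toInt := by
    intro W hW
    rw [((pfTrace_iff hA).1 hW).pfCode_eq hA]
    exact cell_eq _ _
  obtain ⟨W, hW⟩ : ∃ W, PfTrace n (fun a b => (A a b).toInt) W := by
    obtain ⟨T, hT⟩ := exists_isPfRec n hA
    have hTm := hT.mor
    obtain ⟨W, hW⟩ := exists_cell (F := fun z => T (fstNum z) (sndNum z)) (by fun_prop)
      (pair n n + 1)
    have hWT : ∀ i a, i ≤ n → a ≤ n → cellCode W (pair i a) = T i a := by
      intro i a hi ha
      rw [hW _ (lt_pair_succ hi ha)]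
      simp
    refine ⟨W, (pfTrace_iff hA).2 ⟨by fun_prop, ?_, fun s o hso m hm => ?_⟩⟩
    · rw [hWT 0 0 zero_le zero_le, hT.zero]
    · have hs : s + 1 ≤ n := by rw [← hso]; exact le_add_self
      rw [hWT _ _ hs (hm.trans hs), hT.succ s o hso m hm]
      refine isum_congr (by fun_prop) (by fun_prop) fun l hl => ?_
      rw [hWT _ _ ((lt_add_one s).le.trans hs) (hl.le.trans hs)]
  ext j
  · constructor
    · rintro ⟨W, hW, h⟩
      rwa [hval W hW] at h
    · intro h
      exact ⟨W, hW, by rwa [hval W hW]⟩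
  · constructor
    · rintro ⟨W, hW, h⟩
      rwa [hval W hW] at h
    · intro h
      exact ⟨W, hW, by rwa [hval W hW]⟩

end VSharpL

namespace VSharpL
universe u v w
variable {M : TwoSorted.{u}} [hM : Model M]

variable {α : Type v} [Space M α]

/-! ### The ring of integers of the model -/

/-- Coding the same integer is a congruence. -/
def sameCon (M : TwoSorted.{u}) [Model M] : RingCon (Code M) where
  r a b := a.pos + b.neg = b.pos + a.neg
  iseqv := by
    refine ⟨fun a => rfl, fun h => h.symm, fun {a b c} h1 h2 => ?_⟩
    refine add_left_cancel (a := b.pos + b.neg) ?_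
    calc b.pos + b.neg + (a.pos + c.neg) = (a.pos + b.neg) + (b.pos + c.neg) := by ring
      _ = b.pos + b.neg + (c.pos + a.neg) := by rw [h1, h2]; ring
  add' {a b c d} h1 h2 := by
    show a.pos + c.pos + (b.neg + d.neg) = b.pos + d.pos + (a.neg + c.neg)
    calc _ = (a.pos + b.neg) + (c.pos + d.neg) := by ring
      _ = _ := by rw [h1, h2]; ring
  mul' {a b c d} h1 h2 := by
    show a.pos * c.pos + a.neg * c.neg + (b.pos * d.neg + b.neg * d.pos) =
      b.pos * d.pos + b.neg * d.neg + (a.pos * c.neg + a.neg * c.pos)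
    refine add_left_cancel (a := b.pos * c.pos + b.neg * c.neg + b.pos * c.neg + b.neg * c.pos) ?_
    calc _ = (a.pos + b.neg) * c.pos + (b.pos + a.neg) * c.neg + b.pos * (c.pos + d.neg)
          + b.neg * (d.pos + c.neg) := by ring
      _ = (b.pos + a.neg) * c.pos + (a.pos + b.neg) * c.neg + b.pos * (d.pos + c.neg)
          + b.neg * (c.pos + d.neg) := by rw [h1, h2]
      _ = _ := by ring

/-- The integers of the model. -/
def IntM (M : TwoSorted.{u}) [Model M] : Type u := (sameCon M).Quotient

noncomputable instance : CommSemiring (IntM M) :=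
  inferInstanceAs (CommSemiring (sameCon M).Quotient)

/-- The integer coded by a pair of strings. -/
noncomputable def toZ : Code M →+* IntM M := (sameCon M).mk'

theorem toZ_eq_iff {a b : Code M} : toZ a = toZ b ↔ a.pos + b.neg = b.pos + a.neg :=
  (sameCon M).eq

theorem toZ_surjective (x : IntM M) : ∃ a : Code M, toZ a = x := Quotient.exists_rep x

/-- The code of the negative of an integer. -/
def Code.swap (a : Code M) : Code M := ⟨a.neg, a.pos⟩

theorem zNeg_toInt (a : Code M) : zNeg a.toInt = a.swap.toInt := rfl

theorem toZ_add_swap (a : Code M) : toZ a.swap + toZ a = 0 := by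
  rw [← map_add, ← map_zero (toZ (M := M)), toZ_eq_iff]
  simp [Code.swap, add_comm]

noncomputable instance : Neg (IntM M) :=
  ⟨Quotient.lift (fun a : Code M => toZ a.swap) fun a b h => by
    have h' : a.pos + b.neg = b.pos + a.neg := h
    rw [toZ_eq_iff]
    simp only [Code.swap]
    rw [add_comm, ← h', add_comm]⟩

theorem toZ_swap (a : Code M) : toZ a.swap = -toZ a := rfl

noncomputable instance : CommRing (IntM M) where
  zsmul := zsmulRec
  neg_add_cancel x := by
    obtain ⟨a, rfl⟩ := toZ_surjective x
    exact toZ_add_swap a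
  mul_comm := mul_comm

theorem same_iff {a b : Code M} : a.toInt.Same b.toInt ↔ toZ a = toZ b := by
  rw [toZ_eq_iff]
  unfold IntCode.Same Code.toInt
  rw [← bits_add, ← bits_add]
  exact ⟨fun h => bits_injective h, fun h => by rw [h]⟩

/-- The natural number coded by a string, as an integer. -/
noncomputable def ofStr (t : M.Str) : IntM M := toZ ⟨t, 0⟩

theorem ofStr_add (s t : M.Str) : ofStr (s + t) = ofStr s + ofStr t := by
  unfold ofStr
  rw [← map_add, toZ_eq_iff]
  simp

theorem ofStr_mul (s t : M.Str) : ofStr (s * t) = ofStr s * ofStr t := by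
  unfold ofStr
  rw [← map_mul, toZ_eq_iff]
  simp

theorem ofStr_one : ofStr (1 : M.Str) = 1 := map_one toZ

theorem ofStr_zero : ofStr (0 : M.Str) = 0 := map_zero toZ

theorem ofStr_inj {s t : M.Str} : ofStr s = ofStr t ↔ s = t := by
  unfold ofStr
  rw [toZ_eq_iff]
  simp

theorem eq_ofStr_or (x : IntM M) : ∃ t : M.Str, x = ofStr t ∨ x = -ofStr t := by
  obtain ⟨a, rfl⟩ := toZ_surjective x
  rcases str_exists_add_or a.pos a.neg with ⟨t, ht⟩ | ⟨t, ht⟩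
  · refine ⟨t, .inr ?_⟩
    unfold ofStr
    rw [← toZ_swap, toZ_eq_iff]
    simp [Code.swap, ht]
  · refine ⟨t, .inl ?_⟩
    unfold ofStr
    rw [toZ_eq_iff]
    simp [← ht, add_comm]

instance : Nontrivial (IntM M) := ⟨1, 0, by
  rw [← ofStr_one, ← ofStr_zero, Ne, ofStr_inj]
  exact one_ne_zero⟩

instance : NoZeroDivisors (IntM M) where
  eq_zero_or_eq_zero_of_mul_eq_zero {x y} h := by
    obtain ⟨s, hs⟩ := eq_ofStr_or x
    obtain ⟨t, ht⟩ := eq_ofStr_or y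
    have hst : s * t = 0 := by
      rw [← ofStr_inj, ofStr_mul, ofStr_zero]
      rcases hs with rfl | rfl <;> rcases ht with rfl | rfl <;> simpa using h
    rcases mul_eq_zero.1 hst with rfl | rfl
    · left; rcases hs with rfl | rfl <;> simp [ofStr_zero]
    · right; rcases ht with rfl | rfl <;> simp [ofStr_zero]

instance : IsDomain (IntM M) := NoZeroDivisors.to_isDomain _

theorem add_self_ne_one (t : M.Str) : t + t ≠ 1 := by
  intro h
  have h1 : M.mem 0 (t + t) := by rw [h]; simp
  rw [mem_add] at h1
  simp [bAdd, not_carry_zero, Xor] at h1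

theorem odd_ne_zero (z : IntM M) : 1 + (z + z) ≠ 0 := by
  intro h
  obtain ⟨t, rfl | rfl⟩ := eq_ofStr_or z
  · rw [← ofStr_add, ← ofStr_one, ← ofStr_add, ← ofStr_zero, ofStr_inj] at h
    exact one_ne_zero (str_eq_zero_of_add h)
  · have : ofStr (t + t) = ofStr 1 := by
      rw [ofStr_add, ofStr_one]
      linear_combination -h
    exact add_self_ne_one t (ofStr_inj.1 this)

theorem two_ne_zero_intM : (2 : IntM M) ≠ 0 := by
  rw [← one_add_one_eq_two, ← ofStr_one, ← ofStr_add, ← ofStr_zero, Ne, ofStr_inj]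
  exact fun h => one_ne_zero (str_eq_zero_of_add h)

/-- An integer divisible by all odd integers is zero. -/
theorem eq_zero_of_odd_dvd (x : IntM M) (h : ∀ y : IntM M, (1 + (y + y)) ∣ x) : x = 0 := by
  obtain ⟨t, ht⟩ := eq_ofStr_or x
  obtain ⟨z, hz⟩ := h (ofStr (shift (M.len t) 1))
  obtain ⟨w, hw⟩ := eq_ofStr_or z
  by_cases hw0 : w = 0
  · subst hw0
    rw [ofStr_zero, neg_zero, or_self] at hw
    rw [hz, hw, mul_zero]
  obtain ⟨i, hi⟩ := str_ne_zero_iff.1 hw0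
  have hbig : ∀ s : M.Str, ∃ l, M.len t ≤ l ∧ M.mem l
      (shift (M.len t) w + s) := fun s => by
    obtain ⟨l, hl, hm⟩ := exists_mem_add_of_mem s ((mem_shift (M.len t) i w).2 hi)
    exact ⟨l, le_self_add.trans hl, hm⟩
  have hprod : (1 + (ofStr (shift (M.len t) 1) + ofStr (shift (M.len t) 1))) * ofStr w =
      ofStr (shift (M.len t) w + (shift (M.len t) w + w)) := by
    rw [shift_eq_mul _ w]
    simp only [ofStr_add, ofStr_mul]
    ring
  have hfin : shift (M.len t) w + (shift (M.len t) w + w) = t ∨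
      shift (M.len t) w + (shift (M.len t) w + w) + t = 0 := by
    rw [← ofStr_inj, ← ofStr_inj (t := 0), ofStr_add _ t, ofStr_zero, ← hprod]
    rcases ht with rfl | rfl <;> rcases hw with rfl | rfl
    · left; exact hz.symm
    · right; rw [hz]; ring
    · right; linear_combination -hz
    · left; linear_combination hz
  rcases hfin with h | h
  · obtain ⟨l, hl, hm⟩ := hbig (shift (M.len t) w + w)
    rw [h] at hm
    exact absurd (lt_len_of_mem hm) hl.not_gt
  · obtain ⟨l, hl, hm⟩ := hbig (shift (M.len t) w + w + t)
    rw [← add_assoc, h] at hm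
    exact absurd hm (not_mem_zero l)

/-! ### Coded families of integers -/

instance : Space M (IntM M) where
  adm f := ∀ a, ∃ F : M.Num → Code M, Mor M F ∧ ∀ z, z < a → f z = toZ (F z)
  adm_const x a := by
    obtain ⟨c, rfl⟩ := toZ_surjective x
    exact ⟨fun _ => c, by fun_prop, fun _ _ => rfl⟩
  adm_comp hp hh a := by
    obtain ⟨b, hb⟩ := hh.1 a
    obtain ⟨F, hF, h⟩ := hp b
    exact ⟨_, hF.comp (.of_adm hh), fun z hz => h _ (hb z hz)⟩
  adm_local h a := by
    obtain ⟨q, hq, h⟩ := h a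
    obtain ⟨F, hF, h'⟩ := hq a
    exact ⟨F, hF, fun z hz => (h z hz).trans (h' z hz)⟩

theorem Mor.exists_lift {f : M.Num → IntM M} (hf : Mor M f) (a : M.Num) :
    ∃ F : M.Num → Code M, Mor M F ∧ ∀ z, z < a → f z = toZ (F z) := hf.adm a

theorem Mor.exists_lift₂ {f : M.Num → M.Num → IntM M}
    (hf : Mor M fun x : M.Num × M.Num => f x.1 x.2) (a b : M.Num) :
    ∃ F : M.Num → M.Num → Code M, (Mor M fun x : M.Num × M.Num => F x.1 x.2) ∧
      ∀ x y, x < a → y < b → f x y = toZ (F x y) := by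
  obtain ⟨F, hF, h⟩ := Mor.exists_lift (f := fun w => f (VSharpL.fstNum w) (VSharpL.sndNum w))
    (by fun_prop) (VSharpL.pair a b + 1)
  refine ⟨fun x y => F (VSharpL.pair x y), by fun_prop, fun x y hx hy => ?_⟩
  rw [← h _ (lt_pair_succ hx.le hy.le)]
  simp

@[fun_prop]
theorem Mor.toZ {f : α → Code M} (hf : Mor M f) : Mor M fun x => toZ (f x) := fun p hp a =>
  ⟨_, hf.comp (.of_adm hp), fun _ _ => rfl⟩

@[fun_prop]
theorem Mor.swap {f : α → Code M} (hf : Mor M f) : Mor M fun x => (f x).swap := by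
  unfold Code.swap
  fun_prop

@[fun_prop]
theorem Mor.neg_int {f : α → IntM M} (hf : Mor M f) : Mor M fun x => -f x := by
  refine .of_local fun p hp a => ?_
  obtain ⟨F, hF, h⟩ := (hf.comp hp).exists_lift a
  refine ⟨fun z => VSharpL.toZ (F z).swap, by fun_prop, fun z hz => ?_⟩
  beta_reduce
  rw [h z hz, toZ_swap]

theorem Mor.of_lifts {β : Type*} [Space M β] {f g : α → IntM M} (hf : Mor M f) (hg : Mor M g)
    (op : IntM M → IntM M → β) (op' : Code M → Code M → β)
    (hop : ∀ a b, op (VSharpL.toZ a) (VSharpL.toZ b) = op' a b)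
    (hop' : Mor M fun x : Code M × Code M => op' x.1 x.2) : Mor M fun x => op (f x) (g x) := by
  refine .of_local fun p hp a => ?_
  obtain ⟨F, hF, h⟩ := (hf.comp hp).exists_lift a
  obtain ⟨G, hG, h'⟩ := (hg.comp hp).exists_lift a
  refine ⟨fun z => op' (F z) (G z), by fun_prop, fun z hz => ?_⟩
  rw [h z hz, h' z hz, hop]

instance : RingSpace M (IntM M) where
  mor_add := .of_lifts (by fun_prop) (by fun_prop) (fun a b => a + b) (fun a b => toZ (a + b))
    (fun a b => (map_add _ _ _).symm) (by fun_prop)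
  mor_mul := .of_lifts (by fun_prop) (by fun_prop) (fun a b => a * b) (fun a b => toZ (a * b))
    (fun a b => (map_mul _ _ _).symm) (by fun_prop)
  mor_eq := .of_lifts (by fun_prop) (by fun_prop) (fun a b => a = b)
    (fun a b => a.pos + b.neg = b.pos + a.neg) (fun a b => propext toZ_eq_iff) (by fun_prop)
  mor_ite {P _ f g} hP hf hg := by
    refine .of_local fun p hp a => ?_
    obtain ⟨F, hF, h⟩ := (hf.comp hp).exists_lift a
    obtain ⟨G, hG, h'⟩ := (hg.comp hp).exists_lift a
    refine ⟨fun z => toZ (if P (p z) then F z else G z), by fun_prop, fun z hz => ?_⟩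
    rw [h z hz, h' z hz]
    beta_reduce
    split_ifs <;> rfl
  exists_sum {f} hf a n := by
    obtain ⟨F, hF, h⟩ := Mor.exists_lift₂ hf a n
    obtain ⟨v, hv, hrec⟩ := SumSpace.exists_sum hF a n
    refine ⟨fun c s => toZ (v c s), by fun_prop, fun c hc => ⟨?_, fun s hs => ?_⟩⟩
    · beta_reduce
      rw [(hrec c hc).1, map_zero]
    · beta_reduce
      rw [(hrec c hc).2 s hs, h c s hc hs, map_add]

theorem toZ_isum (d : M.Num) {F : M.Num → Code M} (hF : Mor M F) :
    toZ (isum d F) = isum d fun i => toZ (F i) :=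
  isum_hom (φ := toZ) (by fun_prop) (map_zero _) (map_add _) d hF

theorem isum_neg (d : M.Num) {f : M.Num → IntM M} (hf : Mor M f) :
    isum d (fun i => -f i) = -isum d f :=
  (isum_hom (φ := fun x : IntM M => -x) (by fun_prop) neg_zero neg_add d hf).symm

theorem isum_congr_toZ {d : M.Num} {F G : M.Num → Code M} (hF : Mor M F) (hG : Mor M G)
    (h : ∀ i, i < d → toZ (F i) = toZ (G i)) : toZ (isum d F) = toZ (isum d G) := by
  rw [toZ_isum d hF, toZ_isum d hG]
  exact isum_congr (by fun_prop) (by fun_prop) h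

/-! ### The Pfaffian depends only on the integers that are coded -/

theorem powCode_congr {d k : M.Num} {X Y : M.Num → M.Num → Code M}
    (hX : Mor M fun x : M.Num × M.Num => X x.1 x.2) (hY : Mor M fun x : M.Num × M.Num => Y x.1 x.2)
    (h : ∀ i j, i < d → j < d → toZ (X i j) = toZ (Y i j)) :
    ∀ a, a < d → ∀ b, b < d → toZ (powCode d X k a b) = toZ (powCode d Y k a b) := by
  suffices H : ∀ k, ∀ a, a < d → ∀ b, b < d →
    toZ (powCode d X k a b) = toZ (powCode d Y k a b) from H k
  refine induction_mor (P := fun k => ∀ a, a < d → ∀ b, b < d →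
    toZ (powCode d X k a b) = toZ (powCode d Y k a b)) (.forall_lt (.forall_lt
    (R := fun (x : M.Num × M.Num) b => toZ (powCode d X x.1 x.2 b) = toZ (powCode d Y x.1 x.2 b)) ?_ ?_) ?_) ?_ ?_
  · fun_prop
  · fun_prop
  · fun_prop
  · intro a ha b hb
    rw [powCode_zero hX ha hb, powCode_zero hY ha hb]
  · intro k ih a ha b hb
    rw [powCode_succ hX ha hb, powCode_succ hY ha hb]
    refine isum_congr_toZ (by fun_prop) (by fun_prop) fun l hl => ?_
    rw [map_mul, map_mul, ih a ha l hl, h l b hl hb]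

theorem pbEntryCode_congr {s k : M.Num} {A B : M.Num → M.Num → Code M}
    (hA : Mor M fun x : M.Num × M.Num => A x.1 x.2) (hB : Mor M fun x : M.Num × M.Num => B x.1 x.2)
    (h : ∀ i j, i < s + s + (1 + 1) → j < s + s + (1 + 1) → toZ (A i j) = toZ (B i j)) :
    toZ (pbEntryCode s A k) = toZ (pbEntryCode s B k) := by
  have h0 : (0 : M.Num) < s + s + (1 + 1) := by positivity
  have h1 : (1 : M.Num) < s + s + (1 + 1) := lt_of_lt_of_le (lt_add_one 1) le_add_self
  have h2 : ∀ i : M.Num, i < s + s → i + (1 + 1) < s + s + (1 + 1) := fun i hi => by gcongr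
  unfold pbEntryCode
  refine isum_congr_toZ (by fun_prop) (by fun_prop) fun a ha => ?_
  rw [map_mul, map_mul]
  congr 1
  · refine isum_congr_toZ (by fun_prop) (by fun_prop) fun l hl => ?_
    rw [map_mul, map_mul, h _ _ h0 (h2 l hl)]
  · refine isum_congr_toZ (by fun_prop) (by fun_prop) fun b hb => ?_
    rw [map_mul, map_mul, h _ _ (h2 b hb) h1]
    congr 1
    refine powCode_congr (by fun_prop) (by fun_prop) (fun i j hi hj => ?_) a ha b hb
    refine isum_congr_toZ (by fun_prop) (by fun_prop) fun l hl => ?_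
    rw [map_mul, map_mul, h _ _ (h2 i hi) (h2 l hl)]

theorem pbMatrixCode_congr {s m l : M.Num} {A B : M.Num → M.Num → Code M}
    (hA : Mor M fun x : M.Num × M.Num => A x.1 x.2) (hB : Mor M fun x : M.Num × M.Num => B x.1 x.2)
    (h : ∀ i j, i < s + s + (1 + 1) → j < s + s + (1 + 1) → toZ (A i j) = toZ (B i j)) :
    toZ (pbMatrixCode s A m l) = toZ (pbMatrixCode s B m l) := by
  unfold pbMatrixCode
  split_ifs
  · rfl
  · exact h _ _ (by positivity) (lt_of_lt_of_le (lt_add_one 1) le_add_self)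
  · exact pbEntryCode_congr hA hB h
  · rfl

theorem pfCode_congr {n : M.Num} {A B : M.Num → M.Num → Code M}
    (hA : Mor M fun x : M.Num × M.Num => A x.1 x.2) (hB : Mor M fun x : M.Num × M.Num => B x.1 x.2)
    (h : ∀ i j, i < n + n → j < n + n → toZ (A i j) = toZ (B i j)) :
    toZ (pfCode n A) = toZ (pfCode n B) := by
  obtain ⟨T, hT⟩ := exists_isPfRec n hA
  obtain ⟨T', hT'⟩ := exists_isPfRec n hB
  have hTm := hT.mor
  have hTm' := hT'.mor
  rw [hT.pfCode_eq hA, hT'.pfCode_eq hB]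
  suffices ∀ s, s ≤ n → ∀ m, m < s + 1 → toZ (T s m) = toZ (T' s m) from
    this n le_rfl n (lt_add_one n)
  refine induction_mor (.imp (by fun_prop) (.forall_lt
    (R := fun s m => toZ (T s m) = toZ (T' s m)) ?_ ?_)) ?_ ?_
  · fun_prop
  · fun_prop
  · intro _ m hm
    have : m = 0 := by simpa using Num.lt_add_one_iff.1 hm
    rw [this, hT.zero, hT'.zero]
  · intro s ih hs m hm
    have hm' := Num.lt_add_one_iff.1 hm
    obtain ⟨o, ho⟩ := (Num.le_iff_exists _ _).1 hs
    have ho' : o + (s + 1) = n := by rw [ho, add_comm]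
    rw [hT.succ s o ho' m hm', hT'.succ s o ho' m hm']
    refine isum_congr_toZ (by fun_prop) (by fun_prop) fun l hl => ?_
    rw [map_mul, map_mul, ih ((lt_add_one s).le.trans hs) l hl]
    congr 1
    have hn : n + n = s + s + (1 + 1) + (o + o) := by rw [ho]; ring
    refine pbMatrixCode_congr (by fun_prop) (by fun_prop) fun i j hi hj => h _ _ ?_ ?_
    · rw [hn]; gcongr
    · rw [hn]; gcongr

open Classical in
/-- The Pfaffian of an integer matrix of order `2 n`. -/
noncomputable def pfZ (n : M.Num) (A : M.Num → M.Num → IntM M) : IntM M :=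
  if h : ∃ F : M.Num → M.Num → Code M, (Mor M fun x : M.Num × M.Num => F x.1 x.2) ∧
      ∀ i j, i < n + n → j < n + n → A i j = toZ (F i j) then toZ (pfCode n h.choose) else 0

theorem pfZ_eq {n : M.Num} {A : M.Num → M.Num → IntM M} {F : M.Num → M.Num → Code M}
    (hF : Mor M fun x : M.Num × M.Num => F x.1 x.2)
    (h : ∀ i j, i < n + n → j < n + n → A i j = toZ (F i j)) : pfZ n A = toZ (pfCode n F) := by
  classical
  have h' : ∃ F : M.Num → M.Num → Code M, (Mor M fun x : M.Num × M.Num => F x.1 x.2) ∧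
      ∀ i j, i < n + n → j < n + n → A i j = toZ (F i j) := ⟨F, hF, h⟩
  rw [pfZ, dif_pos h']
  refine pfCode_congr h'.choose_spec.1 hF fun i j hi hj => ?_
  rw [← h'.choose_spec.2 i j hi hj, h i j hi hj]

theorem pfZ_congr {n : M.Num} {A B : M.Num → M.Num → IntM M}
    (hA : Mor M fun x : M.Num × M.Num => A x.1 x.2)
    (h : ∀ i j, i < n + n → j < n + n → A i j = B i j) : pfZ n A = pfZ n B := by
  obtain ⟨F, hF, hAF⟩ := hA.exists_lift₂ (n + n) (n + n)
  rw [pfZ_eq hF hAF, pfZ_eq hF fun i j hi hj => (h i j hi hj).symm.trans (hAF i j hi hj)]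

@[fun_prop]
theorem Mor.pfZ {n : α → M.Num} {A : α → M.Num → M.Num → IntM M} (hn : Mor M n)
    (hA : Mor M fun x : α × M.Num × M.Num => A x.1 x.2.1 x.2.2) :
    Mor M fun x => pfZ (n x) (A x) := by
  refine .of_local fun p hp a => ?_
  obtain ⟨N, hN⟩ := (hn.comp hp).adm.1 a
  obtain ⟨F, hF, h⟩ := Mor.exists_lift₂ (f := fun w j => A (p (VSharpL.fstNum w)) (VSharpL.sndNum w) j)
    (by fun_prop) (VSharpL.pair a (N + N) + 1) (N + N)
  refine ⟨fun z => VSharpL.toZ (VSharpL.pfCode (n (p z)) fun i j => F (VSharpL.pair z i) j),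
    by fun_prop, fun z hz => pfZ_eq (by fun_prop) fun i j hi hj => ?_⟩
  have hN' : n (p z) + n (p z) ≤ N + N := add_le_add (hN z hz).le (hN z hz).le
  rw [← h _ _ (lt_pair_succ hz.le (hi.le.trans hN')) (hj.trans_le hN')]
  simp

theorem pfZ_zero {A : M.Num → M.Num → IntM M} : pfZ 0 A = 1 := by
  have hF : Mor M fun x : M.Num × M.Num => (0 : Code M) := by fun_prop
  obtain ⟨T, hT⟩ := exists_isPfRec 0 (A := fun _ _ => (0 : Code M)) hF
  rw [pfZ_eq (F := fun _ _ => 0) hF, hT.pfCode_eq hF, hT.zero, map_one]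
  intro i j hi
  simp at hi

end VSharpL

namespace VSharpL
universe u v w
variable {M : TwoSorted.{u}} [hM : Model M]

variable {α : Type v} [Space M α]

/-! ### Signs -/

theorem num_even_or_odd (x : M.Num) : ∃ y, y < x + 1 ∧ (x = y + y ∨ x = y + y + 1) := by
  revert x
  refine induction_mor (.exists_lt (by fun_prop) (by fun_prop)) ⟨0, by simp⟩ ?_
  rintro x ⟨y, hy, rfl | rfl⟩
  · exact ⟨y, hy.trans (lt_add_one _), .inr rfl⟩
  · exact ⟨y + 1, by gcongr, .inl (by ring)⟩

theorem add_self_ne_add_self_add_one (y z : M.Num) : y + y ≠ z + z + 1 := by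
  intro h
  rcases le_or_gt y z with h' | h'
  · exact (lt_of_le_of_lt (add_le_add h' h') (lt_add_one _)).ne h
  · have h1 := Num.add_one_le_iff.2 h'
    have : z + z + 1 < y + y := calc
      z + z + 1 < z + z + 1 + 1 := lt_add_one _
      _ = (z + 1) + (z + 1) := by ring
      _ ≤ y + y := add_le_add h1 h1
    exact this.ne' h

open Classical in
/-- The sign `(-1) ^ x`. -/
noncomputable def par (x : M.Num) : IntM M := if ∃ y, y < x + 1 ∧ x = y + y then 1 else -1

@[fun_prop]
theorem Mor.par {f : α → M.Num} (hf : Mor M f) : Mor M fun x => par (f x) := by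
  classical
  unfold VSharpL.par
  exact .ite (.exists_lt (by fun_prop) (by fun_prop)) (by fun_prop) (by fun_prop)

theorem par_add_self (x : M.Num) : par (x + x) = 1 := by
  rw [par, if_pos ⟨x, Num.lt_add_one_iff.2 le_self_add, rfl⟩]

theorem par_add_self_add_one (x : M.Num) : par (x + x + 1) = -1 := by
  rw [par, if_neg]
  rintro ⟨y, -, h⟩
  exact add_self_ne_add_self_add_one _ _ h.symm

theorem par_add_one (x : M.Num) : par (x + 1) = -par x := by
  obtain ⟨y, -, rfl | rfl⟩ := num_even_or_odd x
  · rw [par_add_self, par_add_self_add_one]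
  · rw [par_add_self_add_one, show y + y + 1 + 1 = (y + 1) + (y + 1) by ring, par_add_self, neg_neg]

theorem par_zero : par (0 : M.Num) = 1 := by simpa using par_add_self (0 : M.Num)

theorem par_one : par (1 : M.Num) = -1 := by simpa [par_zero] using par_add_one (0 : M.Num)

theorem par_add (x y : M.Num) : par (x + y) = par x * par y := by
  revert y
  refine induction_mor (by fun_prop) ?_ fun y ih => ?_
  · rw [add_zero, par_zero, mul_one]
  · rw [← add_assoc, par_add_one, par_add_one, ih, mul_neg]

theorem par_mul_self (x : M.Num) : par x * par x = 1 := by rw [← par_add, par_add_self]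

open Classical in
theorem par_eq (x : M.Num) : par x = if ∃ y, x = y + y then 1 else -1 := by
  obtain ⟨y, -, rfl | rfl⟩ := num_even_or_odd x
  · rw [par_add_self, if_pos ⟨y, rfl⟩]
  · rw [par_add_self_add_one, if_neg]
    rintro ⟨z, hz⟩
    exact add_self_ne_add_self_add_one _ _ hz.symm

/-- The sign that tells whether `i < j`. -/
noncomputable def ord (i j : M.Num) : IntM M := if i < j then -1 else 1

@[fun_prop]
theorem Mor.ord {f g : α → M.Num} (hf : Mor M f) (hg : Mor M g) :
    Mor M fun x => ord (f x) (g x) := by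
  unfold VSharpL.ord
  fun_prop

theorem ord_of_lt {i j : M.Num} (h : i < j) : ord i j = -1 := if_pos h

theorem ord_of_le {i j : M.Num} (h : j ≤ i) : ord i j = 1 := if_neg h.not_gt

theorem ord_mul_self (i j : M.Num) : ord i j * ord i j = 1 := by
  unfold ord
  split_ifs <;> simp

theorem ord_swap {i j : M.Num} (h : i ≠ j) : ord j i = -ord i j := by
  rcases h.lt_or_gt with h | h
  · rw [ord_of_lt h, ord_of_le h.le, neg_neg]
  · rw [ord_of_lt h, ord_of_le h.le]

theorem one_ne_neg_one : (1 : IntM M) ≠ -1 := fun h =>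
  two_ne_zero_intM (M := M) (by linear_combination h)

theorem par_eq_one_iff (x : M.Num) : par x = 1 ↔ ∃ y, x = y + y := by
  classical
  rw [par_eq]
  split_ifs with h
  · exact iff_of_true rfl h
  · exact iff_of_false one_ne_neg_one.symm h

theorem par_of_ne_one {x : M.Num} (h : par x ≠ 1) : par x = -1 := by
  classical
  rw [Ne, par_eq_one_iff] at h
  rw [par_eq, if_neg h]

open Classical in
/-- The code of `(-1) ^ x · a`. -/
noncomputable def signedCode (x : M.Num) (a : Code M) : Code M := if par x = 1 then a else a.swap

@[fun_prop]
theorem Mor.signedCode {f : α → M.Num} {g : α → Code M} (hf : Mor M f) (hg : Mor M g) :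
    Mor M fun x => signedCode (f x) (g x) := by
  classical
  unfold VSharpL.signedCode
  fun_prop

theorem signed_toInt (x : M.Num) (a : Code M) : signed x a.toInt = (signedCode x a).toInt := by
  classical
  unfold signed signedCode
  rw [← par_eq_one_iff]
  split_ifs
  · rfl
  · rfl

theorem toZ_signedCode (x : M.Num) (a : Code M) : toZ (signedCode x a) = par x * toZ a := by
  classical
  unfold signedCode
  split_ifs with h
  · rw [h, one_mul]
  · rw [par_of_ne_one h, toZ_swap, neg_one_mul]

/-! ### Deleting two rows and columns -/

theorem skip_of_lt {i a : M.Num} (h : a < i) : skip i a = a := by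
  classical
  exact if_pos h

theorem skip_of_le {i a : M.Num} (h : i ≤ a) : skip i a = a + 1 := by
  classical
  exact if_neg h.not_gt

@[fun_prop]
theorem Mor.skip {f g : α → M.Num} (hf : Mor M f) (hg : Mor M g) :
    Mor M fun x => skip (f x) (g x) := by
  classical
  unfold VSharpL.skip
  fun_prop

theorem skip_strictMono (i : M.Num) : StrictMono (skip i) := by
  intro a b h
  rcases lt_or_ge a i with h1 | h1 <;> rcases lt_or_ge b i with h2 | h2
  · rwa [skip_of_lt h1, skip_of_lt h2]
  · rw [skip_of_lt h1, skip_of_le h2]; exact h.trans (lt_add_one b)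
  · exact absurd (h.trans h2) h1.not_gt
  · rw [skip_of_le h1, skip_of_le h2]; gcongr

theorem exists_skip_iff {i x : M.Num} : (∃ a, skip i a = x) ↔ x ≠ i := by
  constructor
  · rintro ⟨a, rfl⟩
    rcases lt_or_ge a i with h | h
    · rw [skip_of_lt h]; exact h.ne
    · rw [skip_of_le h]; exact (Num.lt_add_one_iff.2 h).ne'
  · intro h
    rcases h.lt_or_gt with h | h
    · exact ⟨x, skip_of_lt h⟩
    · obtain ⟨y, rfl, hy⟩ := Num.eq_add_one_of_lt h
      exact ⟨y, skip_of_le hy⟩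

theorem par_skip (i a : M.Num) : par (skip i a) = par a * ord i (skip i a) := by
  rcases lt_or_ge a i with h | h
  · rw [skip_of_lt h, ord_of_le h.le, mul_one]
  · rw [skip_of_le h, par_add_one, ord_of_lt (Num.lt_add_one_iff.2 h), mul_neg_one]

theorem skip_le (i a : M.Num) : skip i a ≤ a + 1 := by
  rcases lt_or_ge a i with h | h
  · rw [skip_of_lt h]; exact (lt_add_one a).le
  · rw [skip_of_le h]

/-- The increasing enumeration of the numbers different from `i` and `j`. -/
noncomputable def skipTwo (i j a : M.Num) : M.Num :=
  if i < j then skip j (skip i a) else skip i (skip j a)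

@[fun_prop]
theorem Mor.skipTwo {f g h : α → M.Num} (hf : Mor M f) (hg : Mor M g) (hh : Mor M h) :
    Mor M fun x => skipTwo (f x) (g x) (h x) := by
  unfold VSharpL.skipTwo
  fun_prop

theorem skipTwo_comm {i j : M.Num} (h : i ≠ j) (a : M.Num) : skipTwo i j a = skipTwo j i a := by
  unfold skipTwo
  rcases h.lt_or_gt with h | h
  · rw [if_pos h, if_neg h.not_gt]
  · rw [if_pos h, if_neg h.not_gt]

theorem skipTwo_strictMono (i j : M.Num) : StrictMono (skipTwo i j) := by
  intro a b h
  unfold skipTwo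
  split_ifs
  · exact skip_strictMono _ (skip_strictMono _ h)
  · exact skip_strictMono _ (skip_strictMono _ h)

theorem skipTwo_of_lt {i j : M.Num} (h : i < j) (a : M.Num) :
    skipTwo i j a = skip j (skip i a) := if_pos h

theorem exists_skipTwo_iff {i j x : M.Num} (h : i ≠ j) :
    (∃ a, skipTwo i j a = x) ↔ x ≠ i ∧ x ≠ j := by
  wlog hij : i < j generalizing i j
  · have := this h.symm ((not_lt.1 hij).lt_of_ne h.symm)
    simp only [skipTwo_comm h]
    rw [this, and_comm]
  simp only [skipTwo_of_lt hij]
  constructor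
  · rintro ⟨a, rfl⟩
    refine ⟨?_, exists_skip_iff.1 ⟨_, rfl⟩⟩
    have h1 : skip i a ≠ i := exists_skip_iff.1 ⟨_, rfl⟩
    rcases lt_or_ge (skip i a) j with h2 | h2
    · rwa [skip_of_lt h2]
    · rw [skip_of_le h2]
      exact (hij.trans (Num.lt_add_one_iff.2 h2)).ne'
  · rintro ⟨h1, h2⟩
    obtain ⟨b, rfl⟩ := exists_skip_iff.2 h2
    have h3 : b ≠ i := by
      rintro rfl
      exact h1 (skip_of_lt hij)
    obtain ⟨a, rfl⟩ := exists_skip_iff.2 h3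
    exact ⟨a, rfl⟩

theorem par_skipTwo {i j : M.Num} (h : i ≠ j) (a : M.Num) :
    par (skipTwo i j a) = par a * ord i (skipTwo i j a) * ord j (skipTwo i j a) := by
  wlog hij : i < j generalizing i j
  · have := this h.symm ((not_lt.1 hij).lt_of_ne h.symm)
    rw [skipTwo_comm h, this]
    ring
  rw [skipTwo_of_lt hij, par_skip j, par_skip i]
  congr 2
  rcases lt_or_ge (skip i a) j with h2 | h2
  · rw [skip_of_lt h2]
  · have h1 : i < skip i a := hij.trans_le h2
    rw [skip_of_le h2, ord_of_lt h1, ord_of_lt (h1.trans (lt_add_one _))]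

theorem skipTwo_le (i j a : M.Num) : skipTwo i j a ≤ a + (1 + 1) := by
  rw [← add_assoc]
  unfold skipTwo
  split_ifs
  · exact (skip_le _ _).trans (add_le_add_left (skip_le _ _) 1)
  · exact (skip_le _ _).trans (add_le_add_left (skip_le _ _) 1)

theorem skipTwo_lt_iff {i j d a : M.Num} (h : i ≠ j) (hi : i < d + (1 + 1)) (hj : j < d + (1 + 1)) :
    skipTwo i j a < d + (1 + 1) ↔ a < d := by
  constructor
  · intro h1
    by_contra! h2
    refine h1.not_ge ?_
    wlog hij : i < j generalizing i j
    · rw [skipTwo_comm h] at h1 ⊢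
      exact this h.symm hj hi h1 ((not_lt.1 hij).lt_of_ne h.symm)
    rw [skipTwo_of_lt hij]
    rw [← add_assoc] at *
    have h3 : i ≤ a := (Num.lt_add_one_iff.1 (hij.trans_le (Num.lt_add_one_iff.1 hj))).trans h2
    rw [skip_of_le h3, skip_of_le ((Num.lt_add_one_iff.1 hj).trans (by gcongr))]
    gcongr
  · intro h1
    exact (skipTwo_le i j a).trans_lt (by gcongr)

/-- The matrix without rows and columns `i` and `j`. -/
noncomputable def del {R : Type*} (i j : M.Num) (A : M.Num → M.Num → R) (a b : M.Num) : R :=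
  A (skipTwo i j a) (skipTwo i j b)

@[fun_prop]
theorem Mor.del {R : Type*} [Space M R] {A : α → M.Num → M.Num → R} {i j a b : α → M.Num}
    (hA : Mor M fun x : α × M.Num × M.Num => A x.1 x.2.1 x.2.2) (hi : Mor M i) (hj : Mor M j)
    (ha : Mor M a) (hb : Mor M b) : Mor M fun x => del (i x) (j x) (A x) (a x) (b x) := by
  unfold VSharpL.del
  fun_prop

theorem matDel_eq (i j : M.Num) (A : Mat M) : matDel i j A = del i j A := by
  classical
  funext a b
  unfold matDel del skipTwo
  split_ifs <;> rfl

/-- Increasing enumerations with the same values agree. -/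
theorem eq_of_strictMono {f g : M.Num → M.Num} (hf : Mor M f) (hg : Mor M g) (hf' : StrictMono f)
    (hg' : StrictMono g) (h : ∀ x, (∃ a, f a = x) ↔ ∃ a, g a = x) : f = g := by
  suffices H : ∀ n, ∀ a, a < n → f a = g a from funext fun a => H _ a (lt_add_one a)
  refine induction_mor (.forall_lt (R := fun _ a => f a = g a) (by fun_prop) (by fun_prop)) ?_ ?_
  · intro a ha
    exact absurd ha not_lt_zero
  · intro n ih a ha
    rcases (Num.lt_add_one_iff.1 ha).lt_or_eq with h1 | rfl
    · exact ih a h1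
    obtain ⟨b, hb⟩ := (h (f a)).1 ⟨a, rfl⟩
    obtain ⟨c, hc⟩ := (h (g a)).2 ⟨a, rfl⟩
    rcases lt_trichotomy (f a) (g a) with h1 | h1 | h1
    · have hba : b < a := hg'.lt_iff_lt.1 (hb ▸ h1)
      rw [← ih b hba] at hb
      exact absurd (hf'.injective hb) hba.ne
    · exact h1
    · have hca : c < a := hf'.lt_iff_lt.1 (hc ▸ h1)
      rw [ih c hca] at hc
      exact absurd (hg'.injective hc) hca.ne

theorem del_del_comm {R : Type*} {i j l r t r' t' : M.Num} {k : M.Num} (hil : i ≠ l) (hik : i ≠ k)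
    (hr : skipTwo i l r = j) (ht : skipTwo i l t = k) (hr' : skipTwo i k r' = j)
    (ht' : skipTwo i k t' = l) (hjk : j ≠ k) (hjl : j ≠ l) (A : M.Num → M.Num → R) :
    del r t (del i l A) = del r' t' (del i k A) := by
  have hrt : r ≠ t := by rintro rfl; exact hjk (hr.symm.trans ht)
  have hrt' : r' ≠ t' := by rintro rfl; exact hjl (hr'.symm.trans ht')
  have key : ∀ {i l r t j k x : M.Num}, i ≠ l → r ≠ t → skipTwo i l r = j → skipTwo i l t = k →
      ((∃ a, skipTwo i l (skipTwo r t a) = x) ↔ x ≠ i ∧ x ≠ l ∧ x ≠ j ∧ x ≠ k) := by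
    rintro i l r t _ _ x hil hrt rfl rfl
    constructor
    · rintro ⟨a, rfl⟩
      obtain ⟨h1, h2⟩ := (exists_skipTwo_iff hil).1 ⟨_, rfl⟩
      obtain ⟨h3, h4⟩ := (exists_skipTwo_iff hrt (x := skipTwo r t a)).1 ⟨_, rfl⟩
      exact ⟨h1, h2, (skipTwo_strictMono i l).injective.ne h3,
        (skipTwo_strictMono i l).injective.ne h4⟩
    · rintro ⟨h1, h2, h3, h4⟩
      obtain ⟨b, rfl⟩ := (exists_skipTwo_iff hil).2 ⟨h1, h2⟩
      obtain ⟨a, rfl⟩ := (exists_skipTwo_iff hrt).2 ⟨ne_of_apply_ne _ h3, ne_of_apply_ne _ h4⟩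
      exact ⟨a, rfl⟩
  have : (fun a => skipTwo i l (skipTwo r t a)) = fun a => skipTwo i k (skipTwo r' t' a) := by
    refine eq_of_strictMono (by fun_prop) (by fun_prop)
      ((skipTwo_strictMono _ _).comp (skipTwo_strictMono _ _))
      ((skipTwo_strictMono _ _).comp (skipTwo_strictMono _ _)) fun x => ?_
    rw [key hil hrt hr ht, key hik hrt' hr' ht']
    tauto
  funext a b
  exact congrArg₂ A (congrFun this a) (congrFun this b)

end VSharpL

namespace VSharpL
universe u v w
variable {M : TwoSorted.{u}} [hM : Model M]

variable {α : Type v} [Space M α]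

/-! ### Cofactor expansion and Cayley's theorem for integers of the model -/

/-- The matrix `A` of order `d` is skew symmetric. -/
def SkewZ (d : M.Num) (A : M.Num → M.Num → IntM M) : Prop :=
  ∀ i j, i < d → j < d → A i j = -A j i

theorem eq_zero_of_eq_neg {x : IntM M} (h : x = -x) : x = 0 :=
  (mul_eq_zero.1 (show (2 : IntM M) * x = 0 by linear_combination h)).resolve_left two_ne_zero_intM

theorem SkewZ.diag {d : M.Num} {A : M.Num → M.Num → IntM M} (h : SkewZ d A) {i : M.Num}
    (hi : i < d) : A i i = 0 := eq_zero_of_eq_neg (h i i hi hi)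

theorem SkewZ.mono {d e : M.Num} {A : M.Num → M.Num → IntM M} (h : SkewZ d A) (he : e ≤ d) :
    SkewZ e A := fun i j hi hj => h i j (hi.trans_le he) (hj.trans_le he)

theorem skew_mat_iff {d : M.Num} {W : M.Str} :
    Skew d (mat W) ↔ SkewZ d fun i j => toZ (matCode W i j) := by
  unfold Skew SkewZ
  simp only [mat_eq, zNeg_toInt, same_iff, toZ_swap]

theorem toZ_matCode_expand (hPCE : PCE M) {m : M.Num} {W : M.Str}
    (hs : Skew ((m + 1) + (m + 1)) (mat W)) {i : M.Num} (hi : i < (m + 1) + (m + 1)) :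
    toZ (pfCode (m + 1) (matCode W)) = isum ((m + 1) + (m + 1)) fun j => if j = i then 0 else
      par i * par j * ord i j * (toZ (matCode W i j) * toZ (pfCode m (del i j (matCode W)))) := by
  classical
  have hW : mat W = fun a b => (matCode W a b).toInt := by
    funext a b
    exact mat_eq W a b
  have H := hPCE m W hs i hi
  rw [zSum_toInt (F := fun j => if j = i then 0 else signedCode (i + j + if i < j then 1 else 0)
    (matCode W i j * pfCode m (del i j (matCode W)))) (by fun_prop) ?_, hW, pf_toInt (by fun_prop),
    same_iff, toZ_isum _ (by fun_prop)] at H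
  · rw [H]
    refine isum_congr (by fun_prop) (by fun_prop) fun j hj => ?_
    split_ifs
    · exact map_zero _
    · rw [toZ_signedCode, par_add, par_add, ord, map_mul]
      simp [par_one, *]
    · rw [toZ_signedCode, par_add, par_add, ord, map_mul]
      simp [par_zero, *]
  · intro j hj
    by_cases h : j = i
    · rw [if_pos h, if_pos h, zZero_eq]
    · rw [if_neg h, if_neg h, matDel_eq, hW]
      have : del i j (fun a b => (matCode W a b).toInt) =
        fun a b => (del i j (matCode W) a b).toInt := rfl
      rw [this, pf_toInt (by fun_prop), zMul_toInt, signed_toInt]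
      congr!

theorem pfZ_expand (hPCE : PCE M) {m : M.Num} {A : M.Num → M.Num → IntM M}
    (hA : Mor M fun x : M.Num × M.Num => A x.1 x.2) (hs : SkewZ ((m + 1) + (m + 1)) A)
    {i : M.Num} (hi : i < (m + 1) + (m + 1)) :
    pfZ (m + 1) A = isum ((m + 1) + (m + 1)) fun j => if j = i then 0 else
      par i * par j * ord i j * (A i j * pfZ m (del i j A)) := by
  obtain ⟨F, hF, h⟩ := hA.exists_lift₂ ((m + 1) + (m + 1)) ((m + 1) + (m + 1))
  obtain ⟨W, hW⟩ := exists_mat hF ((m + 1) + (m + 1))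
  have hAW : ∀ i j, i < (m + 1) + (m + 1) → j < (m + 1) + (m + 1) →
      A i j = toZ (matCode W i j) := fun i j hi hj => by rw [h i j hi hj, hW i j hi hj]
  have hskew : Skew ((m + 1) + (m + 1)) (mat W) := by
    rw [skew_mat_iff]
    intro a b ha hb
    beta_reduce
    rw [← hAW a b ha hb, ← hAW b a hb ha]
    exact hs a b ha hb
  rw [pfZ_eq (F := matCode W) (by fun_prop) hAW, toZ_matCode_expand hPCE hskew hi]
  refine isum_congr (by fun_prop) (by fun_prop) fun j hj => ?_
  split_ifs with hji
  · rfl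
  rw [← hAW i j hi hj]
  congr 2
  refine (pfZ_eq (by fun_prop) fun a b ha hb => hAW _ _ ?_ ?_).symm <;>
  · rw [show m + 1 + (m + 1) = m + m + (1 + 1) by ring] at *
    rwa [skipTwo_lt_iff (Ne.symm hji) hi hj]

open Classical in
/-- The block matrix `(0, A; -Aᵀ, 0)` of order `2 n`. -/
noncomputable def double {R : Type*} [Zero R] [Neg R] (n : M.Num) (A : M.Num → M.Num → R)
    (i j : M.Num) : R :=
  if i < n then if j < n then 0 else A i (j - n) else if j < n then -A j (i - n) else 0

open Classical in
/-- The code of the block matrix `(0, A; -Aᵀ, 0)` of order `2 n`. -/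
noncomputable def doubleCode (n : M.Num) (A : M.Num → M.Num → Code M) (i j : M.Num) : Code M :=
  if i < n then if j < n then 0 else A i (j - n) else if j < n then (A j (i - n)).swap else 0

@[fun_prop]
theorem Mor.double {A : α → M.Num → M.Num → IntM M} {n a b : α → M.Num}
    (hA : Mor M fun x : α × M.Num × M.Num => A x.1 x.2.1 x.2.2) (hn : Mor M n)
    (ha : Mor M a) (hb : Mor M b) : Mor M fun x => double (n x) (A x) (a x) (b x) := by
  classical
  unfold VSharpL.double
  fun_prop

@[fun_prop]
theorem Mor.doubleCode {A : α → M.Num → M.Num → Code M} {n a b : α → M.Num}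
    (hA : Mor M fun x : α × M.Num × M.Num => A x.1 x.2.1 x.2.2) (hn : Mor M n)
    (ha : Mor M a) (hb : Mor M b) : Mor M fun x => doubleCode (n x) (A x) (a x) (b x) := by
  classical
  unfold VSharpL.doubleCode
  fun_prop

theorem matDouble_toInt (n : M.Num) (A : M.Num → M.Num → Code M) :
    matDouble n (fun a b => (A a b).toInt) = fun a b => (doubleCode n A a b).toInt := by
  classical
  funext i j
  have hex : ∀ (j : M.Num) (P : M.Num → Prop), (∃ c, j = n + c ∧ P c) ↔ ¬ j < n ∧ P (j - n) := by
    intro j P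
    constructor
    · rintro ⟨c, rfl, h⟩
      exact ⟨le_self_add.not_gt, by rwa [add_tsub_cancel_left]⟩
    · rintro ⟨h1, h2⟩
      exact ⟨j - n, (add_tsub_cancel_of_le (not_lt.1 h1)).symm, h2⟩
  have h0 : ∀ k, ¬ bits (0 : M.Str) k := fun k => by simp [bits]
  unfold matDouble doubleCode
  simp only [hex]
  unfold Code.toInt
  congr 1 <;> funext k <;> refine propext ?_ <;> split_ifs with h1 h2 h2 <;>
    simp [h1, h2, Code.swap, h0]

theorem toZ_doubleCode {n : M.Num} {A : M.Num → M.Num → Code M} (i j : M.Num) :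
    toZ (doubleCode n A i j) = double n (fun a b => toZ (A a b)) i j := by
  unfold doubleCode double
  split_ifs
  · exact map_zero _
  · rfl
  · exact toZ_swap _
  · exact map_zero _

theorem cayley_of_double (h : ∀ (n : M.Num) (A : M.Num → M.Num → IntM M),
    (Mor M fun x : M.Num × M.Num => A x.1 x.2) → SkewZ (n + n) A →
    pfZ (n + n) (double (n + n) A) = par n * (pfZ n A * pfZ n A)) : Cayley M := by
  classical
  intro n W hW
  have hWe : mat W = fun a b => (matCode W a b).toInt := by
    funext a b
    exact mat_eq W a b
  have H := h n (fun a b => toZ (matCode W a b)) (by fun_prop) (skew_mat_iff.1 hW)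
  rw [pfZ_eq (F := doubleCode (n + n) (matCode W)) (by fun_prop)
    fun i j _ _ => (toZ_doubleCode i j).symm, pfZ_eq (F := matCode W) (by fun_prop)
    fun i j _ _ => rfl] at H
  have hdet : (∃ h, (h + h) + (n + n) = (n + n) * (n + n) ∧ ∃ y, h = y + y) ↔ par n = 1 := by
    have hd : ∀ h, (h + h) + (n + n) = (n + n) * (n + n) → h + n = n * n + n * n := by
      intro h h1
      rcases lt_trichotomy (h + n) (n * n + n * n) with h2 | h2 | h2
      · exact absurd h1 (by
          have := add_lt_add h2 h2
          rw [show h + h + (n + n) = h + n + (h + n) by ring,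
            show (n + n) * (n + n) = n * n + n * n + (n * n + n * n) by ring]
          exact this.ne)
      · exact h2
      · exact absurd h1 (by
          have := add_lt_add h2 h2
          rw [show h + h + (n + n) = h + n + (h + n) by ring,
            show (n + n) * (n + n) = n * n + n * n + (n * n + n * n) by ring]
          exact this.ne')
    have hp : ∀ h, h + n = n * n + n * n → par h = par n := by
      intro h h1
      have h2 := congrArg par h1
      rw [par_add, par_add_self] at h2
      linear_combination par n * h2 - par h * par_mul_self n
    constructor
    · rintro ⟨h, h1, h2⟩
      rw [← hp h (hd h h1)]
      exact (par_eq_one_iff h).2 h2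
    · intro h1
      have hle : n ≤ n * n + n * n := by
        rcases Num.eq_zero_or_succ n with rfl | ⟨c, rfl⟩
        · simp
        · rw [show (c + 1) * (c + 1) + (c + 1) * (c + 1) =
            (c + 1) + ((c + 1) * c + (c + 1) * (c + 1)) by ring]
          exact le_self_add
      refine ⟨n * n + n * n - n, ?_, ?_⟩
      · have := tsub_add_cancel_of_le hle
        generalize n * n + n * n - n = x at this
        rw [show x + x + (n + n) = x + n + (x + n) by ring, this]
        ring
      · rw [← par_eq_one_iff, hp _ (tsub_add_cancel_of_le hle), h1]
  rw [det, hWe, matDouble_toInt, pf_toInt (by fun_prop), pf_toInt (by fun_prop), zMul_toInt,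
    zNeg_toInt]
  by_cases h1 : par n = 1
  · rw [if_pos (hdet.2 h1), same_iff, H, h1, one_mul, map_mul]
  · rw [if_neg fun h2 => h1 (hdet.1 h2), same_iff, toZ_swap, H, par_of_ne_one h1, map_mul]
    ring

end VSharpL

namespace VSharpL
universe u v w
variable {M : TwoSorted.{u}} [hM : Model M]

variable {α : Type v} [Space M α]

/-! ### Cofactors -/

/-- The inverse of `skip i`. -/
noncomputable def unskip (i x : M.Num) : M.Num := if x < i then x else x - 1

theorem unskip_skip (i a : M.Num) : unskip i (skip i a) = a := by
  unfold unskip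
  rcases lt_or_ge a i with h | h
  · rw [skip_of_lt h, if_pos h]
  · rw [skip_of_le h, if_neg (h.trans (lt_add_one a).le).not_gt, add_tsub_cancel_right]

@[fun_prop]
theorem Mor.unskip {f g : α → M.Num} (hf : Mor M f) (hg : Mor M g) :
    Mor M fun x => unskip (f x) (g x) := by
  unfold VSharpL.unskip
  fun_prop

/-- The inverse of `skipTwo i j`. -/
noncomputable def unskipTwo (i j x : M.Num) : M.Num :=
  if i < j then unskip i (unskip j x) else unskip j (unskip i x)

@[fun_prop]
theorem Mor.unskipTwo {f g h : α → M.Num} (hf : Mor M f) (hg : Mor M g) (hh : Mor M h) :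
    Mor M fun x => unskipTwo (f x) (g x) (h x) := by
  unfold VSharpL.unskipTwo
  fun_prop

theorem unskipTwo_skipTwo (i j a : M.Num) : unskipTwo i j (skipTwo i j a) = a := by
  unfold unskipTwo skipTwo
  split_ifs <;> rw [unskip_skip, unskip_skip]

theorem skipTwo_unskipTwo {i j x : M.Num} (h : i ≠ j) (hi : x ≠ i) (hj : x ≠ j) :
    skipTwo i j (unskipTwo i j x) = x := by
  obtain ⟨a, rfl⟩ := (exists_skipTwo_iff h).2 ⟨hi, hj⟩
  rw [unskipTwo_skipTwo]

theorem del_comm {R : Type*} {i j : M.Num} (h : i ≠ j) (A : M.Num → M.Num → R) :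
    del i j A = del j i A := by
  funext a b
  unfold del
  rw [skipTwo_comm h, skipTwo_comm h]

theorem two_mul_succ (m : M.Num) : m + 1 + (m + 1) = m + m + (1 + 1) := by ring

theorem SkewZ.del {m i j : M.Num} {A : M.Num → M.Num → IntM M}
    (hs : SkewZ ((m + 1) + (m + 1)) A) (hij : i ≠ j) (hi : i < (m + 1) + (m + 1))
    (hj : j < (m + 1) + (m + 1)) : SkewZ (m + m) (del i j A) := by
  rw [two_mul_succ] at *
  exact fun a b ha hb => hs _ _ ((skipTwo_lt_iff hij hi hj).2 ha) ((skipTwo_lt_iff hij hi hj).2 hb)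

/-- The signed Pfaffian of the submatrix without rows and columns `i` and `l`, for a matrix of order
`2 (m + 1)`. -/
noncomputable def cof (m : M.Num) (A : M.Num → M.Num → IntM M) (i l : M.Num) : IntM M :=
  if l = i then 0 else par i * par l * ord i l * pfZ m (del i l A)

@[fun_prop]
theorem Mor.cof {A : α → M.Num → M.Num → IntM M} {m a b : α → M.Num}
    (hA : Mor M fun x : α × M.Num × M.Num => A x.1 x.2.1 x.2.2) (hm : Mor M m)
    (ha : Mor M a) (hb : Mor M b) : Mor M fun x => cof (m x) (A x) (a x) (b x) := by
  unfold VSharpL.cof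
  fun_prop

theorem isum_cof_mul_self (hPCE : PCE M) {m : M.Num} {A : M.Num → M.Num → IntM M}
    (hA : Mor M fun x : M.Num × M.Num => A x.1 x.2) (hs : SkewZ ((m + 1) + (m + 1)) A)
    {i : M.Num} (hi : i < (m + 1) + (m + 1)) :
    isum ((m + 1) + (m + 1)) (fun l => cof m A i l * A i l) = pfZ (m + 1) A := by
  rw [pfZ_expand hPCE hA hs hi]
  refine isum_congr (by fun_prop) (by fun_prop) fun l hl => ?_
  unfold cof
  split_ifs
  · rw [zero_mul]
  · ring

/-- The terms of the expansion of `∑ l, cof i l * A j l` along row `j`. -/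
noncomputable def cofTerm (m : M.Num) (A : M.Num → M.Num → IntM M) (i j l k : M.Num) : IntM M :=
  if l = i ∨ l = j ∨ k = i ∨ k = j ∨ k = l then 0 else
    par i * par l * ord i l * par j * ord i j * ord l j * par k * ord i k * ord l k * ord j k *
      (A j l * A j k * pfZ m (del (unskipTwo i l j) (unskipTwo i l k) (del i l A)))

@[fun_prop]
theorem Mor.cofTerm {A : α → M.Num → M.Num → IntM M} {m i j a b : α → M.Num}
    (hA : Mor M fun x : α × M.Num × M.Num => A x.1 x.2.1 x.2.2) (hm : Mor M m) (hi : Mor M i)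
    (hj : Mor M j) (ha : Mor M a) (hb : Mor M b) :
    Mor M fun x => cofTerm (m x) (A x) (i x) (j x) (a x) (b x) := by
  unfold VSharpL.cofTerm
  fun_prop

theorem cofTerm_swap (m : M.Num) (A : M.Num → M.Num → IntM M) {i j : M.Num} (hij : i ≠ j)
    (l k : M.Num) : cofTerm m A i j l k = -cofTerm m A i j k l := by
  unfold cofTerm
  by_cases h : l = i ∨ l = j ∨ k = i ∨ k = j ∨ k = l
  · rw [if_pos h, if_pos (by tauto), neg_zero]
  rw [if_neg h, if_neg (by tauto)]
  push Not at h
  obtain ⟨hli, hlj, hki, hkj, hkl⟩ := h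
  rw [del_del_comm (k := k) (l := l) hli.symm hki.symm
    (skipTwo_unskipTwo hli.symm hij.symm hlj.symm) (skipTwo_unskipTwo hli.symm hki hkl)
    (skipTwo_unskipTwo hki.symm hij.symm hkj.symm) (skipTwo_unskipTwo hki.symm hli hkl.symm)
    hkj.symm hlj.symm, ord_swap hkl, ord_swap hkj.symm, ord_swap hlj]
  ring

theorem cof_mul_eq (hPCE : PCE M) {m : M.Num} {A : M.Num → M.Num → IntM M}
    (hA : Mor M fun x : M.Num × M.Num => A x.1 x.2)
    (hs : SkewZ ((m + 1 + 1) + (m + 1 + 1)) A) {i j l : M.Num} (hij : i ≠ j)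
    (hi : i < (m + 1 + 1) + (m + 1 + 1)) (hj : j < (m + 1 + 1) + (m + 1 + 1))
    (hl : l < (m + 1 + 1) + (m + 1 + 1)) :
    cof (m + 1) A i l * A j l = isum ((m + 1 + 1) + (m + 1 + 1)) (cofTerm m A i j l) := by
  by_cases hli : l = i
  · rw [cof, if_pos hli, zero_mul, isum_eq_zero (by fun_prop)]
    intro k hk
    exact if_pos (.inl hli)
  by_cases hlj : l = j
  · rw [hlj, hs.diag hj, mul_zero, isum_eq_zero (by fun_prop)]
    intro k hk
    exact if_pos (.inr (.inl rfl))
  obtain ⟨r, hr⟩ := (exists_skipTwo_iff (Ne.symm hli)).2 ⟨hij.symm, Ne.symm hlj⟩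
  have hlt : ∀ a, skipTwo i l a < (m + 1 + 1) + (m + 1 + 1) ↔ a < m + 1 + (m + 1) := fun a => by
    rw [two_mul_succ (m + 1)] at *
    exact skipTwo_lt_iff (Ne.symm hli) hi hl
  have hr' : r < m + 1 + (m + 1) := (hlt r).1 (hr ▸ hj)
  rw [cof, if_neg hli, pfZ_expand hPCE (by fun_prop) (hs.del (Ne.symm hli) hi hl) hr',
    isum_reindex (d := m + 1 + (m + 1)) (h := skipTwo i l) (by fun_prop) (by fun_prop)
      (fun a b _ _ h => (skipTwo_strictMono i l).injective h) (fun a ha => (hlt a).2 ha)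
      fun k hk h0 => ?_, ← isum_mul_left _ _ (by fun_prop), ← isum_mul_right _ _ (by fun_prop)]
  · refine isum_congr (by fun_prop) (by fun_prop) fun t ht => ?_
    obtain ⟨hti, htl⟩ := (exists_skipTwo_iff (Ne.symm hli) (x := skipTwo i l t)).1 ⟨t, rfl⟩
    by_cases htr : t = r
    · rw [if_pos htr, cofTerm, if_pos (by rw [htr, hr]; tauto), mul_zero, zero_mul]
    have htj : skipTwo i l t ≠ j := fun h => htr ((skipTwo_strictMono i l).injective (h.trans hr.symm))
    have hord : ord r t = ord j (skipTwo i l t) := by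
      unfold ord
      simp only [← hr, (skipTwo_strictMono i l).lt_iff_lt]
    have hu : unskipTwo i l j = r := by rw [← hr, unskipTwo_skipTwo]
    have hparj := par_skipTwo (Ne.symm hli) r
    rw [hr] at hparj
    rw [if_neg htr, cofTerm, if_neg (by tauto), unskipTwo_skipTwo, hu, hord, hparj,
      par_skipTwo (Ne.symm hli) t, VSharpL.del, hr]
    generalize skipTwo i l t = k
    have hsq : ord i j * ord i j * (ord l j * ord l j) * (ord i k * ord i k) *
        (ord l k * ord l k) = 1 := by simp only [ord_mul_self, mul_one]
    linear_combination (-(par i * par l * ord i l * par r * par t * ord j k *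
      (A j l * A j k * pfZ m (VSharpL.del r t (VSharpL.del i l A))))) * hsq
  · have h : ¬(l = i ∨ l = j ∨ k = i ∨ k = j ∨ k = l) := fun h => h0 (if_pos h)
    push Not at h
    obtain ⟨a, rfl⟩ := (exists_skipTwo_iff (Ne.symm hli)).2 ⟨h.2.2.1, h.2.2.2.2⟩
    exact ⟨a, (hlt a).1 hk, rfl⟩

theorem isum_cof_mul (hPCE : PCE M) {m : M.Num} {A : M.Num → M.Num → IntM M}
    (hA : Mor M fun x : M.Num × M.Num => A x.1 x.2) (hs : SkewZ ((m + 1) + (m + 1)) A)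
    {i j : M.Num} (hij : i ≠ j) (hi : i < (m + 1) + (m + 1)) (hj : j < (m + 1) + (m + 1)) :
    isum ((m + 1) + (m + 1)) (fun l => cof m A i l * A j l) = 0 := by
  rcases Num.eq_zero_or_succ m with rfl | ⟨m, rfl⟩
  · refine isum_eq_zero (by fun_prop) fun l hl => ?_
    by_cases hli : l = i
    · rw [cof, if_pos hli, zero_mul]
    have : l = j := by
      have hcase : ∀ x : M.Num, x < 0 + 1 + (0 + 1) → x = 0 ∨ x = 1 := fun x hx => by
        rw [zero_add, Num.lt_add_one_iff] at hx
        rcases hx.lt_or_eq with h | h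
        · left
          rw [← zero_add (1 : M.Num), Num.lt_add_one_iff] at h
          simpa using h
        · exact .inr h
      rcases hcase i hi with rfl | rfl <;> rcases hcase j hj with rfl | rfl <;>
        rcases hcase l hl with rfl | rfl <;> simp_all
    rw [this, hs.diag hj, mul_zero]
  · apply eq_zero_of_eq_neg
    rw [isum_congr (by fun_prop) (by fun_prop) fun l hl => cof_mul_eq hPCE hA hs hij hi hj hl]
    conv_lhs => rw [isum_comm _ _ (by fun_prop)]
    rw [← isum_neg _ (by fun_prop)]
    refine isum_congr (by fun_prop) (by fun_prop) fun l hl => ?_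
    rw [← isum_neg _ (by fun_prop)]
    exact isum_congr (by fun_prop) (by fun_prop) fun k hk => cofTerm_swap m A hij k l

/-- If the combination of the rows of `A` with coefficients `w` vanishes outside columns `i` and `p`,
then its entry in column `p` determines `w i * pf A`. -/
theorem mul_pfZ_eq_cof (hPCE : PCE M) {m : M.Num} {A : M.Num → M.Num → IntM M}
    (hA : Mor M fun x : M.Num × M.Num => A x.1 x.2) (hs : SkewZ ((m + 1) + (m + 1)) A)
    {w : M.Num → IntM M} (hw : Mor M w) {i p : M.Num} (hi : i < (m + 1) + (m + 1))
    (hp : p < (m + 1) + (m + 1)) (h : ∀ l, l < (m + 1) + (m + 1) → l ≠ i → l ≠ p →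
      isum ((m + 1) + (m + 1)) (fun a => w a * A a l) = 0) :
    w i * pfZ (m + 1) A = cof m A i p * isum ((m + 1) + (m + 1)) (fun a => w a * A a p) := by
  set D := (m + 1) + (m + 1) with hD
  have h1 : isum D (fun l => cof m A i l * isum D fun a => w a * A a l) =
      cof m A i p * isum D fun a => w a * A a p := by
    refine isum_eq_single (by fun_prop) hp fun l hl hlp => ?_
    by_cases hli : l = i
    · rw [cof, if_pos hli, zero_mul]
    · rw [h l hl hli hlp, mul_zero]
  have h2 : isum D (fun a => w a * isum D fun l => cof m A i l * A a l) = w i * pfZ (m + 1) A := by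
    rw [isum_eq_single (k := i) (by fun_prop) hi, isum_cof_mul_self hPCE hA hs hi]
    intro a ha hai
    rw [isum_cof_mul hPCE hA hs (Ne.symm hai) hi ha, mul_zero]
  rw [← h1, ← h2]
  calc isum D (fun a => w a * isum D fun l => cof m A i l * A a l)
      = isum D fun a => isum D fun l => cof m A i l * (w a * A a l) := by
        refine isum_congr (by fun_prop) (by fun_prop) fun a ha => ?_
        rw [← isum_mul_left _ _ (by fun_prop)]
        exact isum_congr (by fun_prop) (by fun_prop) fun l hl => by ring
    _ = isum D fun l => isum D fun a => cof m A i l * (w a * A a l) := isum_comm _ _ (by fun_prop)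
    _ = _ := isum_congr (by fun_prop) (by fun_prop) fun l hl => isum_mul_left _ _ (by fun_prop)

end VSharpL

namespace VSharpL
universe u v w
variable {M : TwoSorted.{u}} [hM : Model M]

variable {α : Type v} [Space M α]

/-! ### Pfaffians of congruent matrices -/

theorem exists_pfZ_add_mul (hPCE : PCE M) {n : M.Num} {A C : M.Num → M.Num → IntM M}
    (hA : Mor M fun x : M.Num × M.Num => A x.1 x.2) (hC : Mor M fun x : M.Num × M.Num => C x.1 x.2)
    (hsA : SkewZ (n + n) A) (hsC : SkewZ (n + n) C) (x : IntM M) :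
    ∃ z, pfZ n (fun i j => A i j + x * C i j) = pfZ n A + x * z := by
  rcases Num.eq_zero_or_succ n with rfl | ⟨m, rfl⟩
  · exact ⟨0, by rw [pfZ_zero, pfZ_zero, mul_zero, add_zero]⟩
  set D := (m + 1) + (m + 1) with hD
  let H : M.Num → M.Num → M.Num → IntM M := fun t i j =>
    if i < t ∨ j < t then A i j + x * C i j else A i j
  have hH : Mor M fun y : M.Num × M.Num × M.Num => H y.1 y.2.1 y.2.2 := by
    dsimp only [H]
    fun_prop
  have hHt : ∀ t, Mor M fun y : M.Num × M.Num => H t y.1 y.2 := fun t => by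
    dsimp only [H]
    fun_prop
  have hHs : ∀ t, SkewZ D (H t) := fun t i j hi hj => by
    dsimp only [H]
    rw [hsA i j hi hj, hsC i j hi hj]
    by_cases h : i < t ∨ j < t
    · rw [if_pos h, if_pos h.symm]; ring
    · rw [if_neg h, if_neg (mt Or.symm h)]
  let E : M.Num → IntM M := fun t => isum D fun j => if j = t then 0 else
    par t * par j * ord t j * ((if j < t then 0 else C t j) * pfZ m (del t j (H t)))
  have hE : Mor M E := by dsimp only [E]; fun_prop
  have hstep : ∀ t, t < D → pfZ (m + 1) (H (t + 1)) = pfZ (m + 1) (H t) + x * E t := by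
    intro t ht
    dsimp only [E]
    rw [pfZ_expand hPCE (hHt _) (hHs _) ht, pfZ_expand hPCE (hHt _) (hHs _) ht,
      ← isum_mul_left _ _ (by fun_prop), ← isum_add _ (by fun_prop) (by fun_prop)]
    refine isum_congr (by fun_prop) (by fun_prop) fun j hj => ?_
    by_cases hjt : j = t
    · simp [hjt]
    have hdel : del t j (H (t + 1)) = del t j (H t) := by
      funext a b
      have hne : ∀ a, skipTwo t j a < t + 1 ↔ skipTwo t j a < t := fun a => by
        rw [Num.lt_add_one_iff]
        exact ⟨fun h => h.lt_of_ne ((exists_skipTwo_iff (Ne.symm hjt)).1 ⟨a, rfl⟩).1, le_of_lt⟩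
      dsimp only [del, H]
      simp only [hne]
    have h1 : H (t + 1) t j = A t j + x * C t j := if_pos (.inl (lt_add_one t))
    have h2 : H t t j = if j < t then A t j + x * C t j else A t j := by
      dsimp only [H]
      simp only [lt_irrefl, false_or]
    rw [if_neg hjt, if_neg hjt, if_neg hjt, hdel, h1, h2]
    split_ifs <;> ring
  have hsum : ∀ t, t ≤ D → pfZ (m + 1) (H t) = pfZ (m + 1) A + x * isum t E := by
    refine induction_mor (.imp (by fun_prop) (by fun_prop)) ?_ fun t ih ht => ?_
    · intro _
      rw [isum_zero, mul_zero, add_zero]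
      congr 1
      funext i j
      dsimp only [H]
      rw [if_neg (by simp)]
    · have ht' := Num.add_one_le_iff.1 ht
      rw [hstep t ht', ih ht'.le, isum_succ hE]
      ring
  refine ⟨isum D E, ?_⟩
  rw [← hsum D le_rfl]
  refine pfZ_congr (by fun_prop) fun i j hi hj => ?_
  dsimp only [H]
  rw [if_pos (.inl hi)]

/-! ### The matrix `J` -/

/-- The entries of `J`. -/
noncomputable def intJ (i j : M.Num) : IntM M := toZ (codeJ i j)

@[fun_prop]
theorem Mor.intJ {f g : α → M.Num} (hf : Mor M f) (hg : Mor M g) :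
    Mor M fun x => intJ (f x) (g x) := by
  unfold VSharpL.intJ
  fun_prop

theorem codeJ_add_two (i j : M.Num) : codeJ (i + (1 + 1)) (j + (1 + 1)) = codeJ i j := by
  classical
  apply Code.toInt_injective
  rw [← matJ_eq, ← matJ_eq]
  unfold matJ
  have key : ∀ x y c d : M.Num, c ≤ 1 →
      ((∃ h, x + (1 + 1) = h + h + c ∧ y + (1 + 1) = h + h + d) ↔
        ∃ h, x = h + h + c ∧ y = h + h + d) := by
    intro x y c d hc
    constructor
    · rintro ⟨h, h1, h2⟩
      rcases Num.eq_zero_or_succ h with rfl | ⟨h, rfl⟩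
      · refine absurd h1 (ne_of_gt ?_)
        rw [add_zero, zero_add, ← add_assoc]
        exact Num.lt_add_one_iff.2 (hc.trans le_add_self)
      · refine ⟨h, add_right_cancel (b := 1 + 1) ?_, add_right_cancel (b := 1 + 1) ?_⟩
        · rw [h1]; ring
        · rw [h2]; ring
    · rintro ⟨h, rfl, rfl⟩
      exact ⟨h + 1, by ring, by ring⟩
  have k1 := key i j 0 1 zero_le
  have k2 := key i j 1 0 le_rfl
  simp only [add_zero] at k1 k2
  simp only [k1, k2]

theorem codeJ_zero_one : codeJ (0 : M.Num) 1 = 1 := by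
  classical
  unfold codeJ
  rw [if_pos ⟨0, by simp⟩, if_neg]
  · rfl
  · rintro ⟨h, -, h1, -⟩
    exact Num.add_one_ne_zero _ h1.symm

theorem codeJ_zero_of_ne {j : M.Num} (hj : j ≠ 1) : codeJ 0 j = 0 := by
  classical
  unfold codeJ
  rw [if_neg, if_neg]
  · rfl
  · rintro ⟨h, -, h1, -⟩
    exact Num.add_one_ne_zero _ h1.symm
  · rintro ⟨h, -, h1, h2⟩
    exact hj (by rw [h2, ← h1, zero_add])

theorem skewZ_intJ (d : M.Num) : SkewZ (M := M) d intJ := by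
  intro i j _ _
  unfold intJ
  rw [← toZ_swap]
  congr 1
  apply Code.toInt_injective
  rw [← zNeg_toInt, ← matJ_eq, ← matJ_eq]
  unfold matJ zNeg
  simp only [and_comm]

theorem pfZ_intJ (hPCE : PCE M) (n : M.Num) : pfZ n intJ = 1 := by
  revert n
  refine induction_mor (by fun_prop) pfZ_zero fun m ih => ?_
  have h0 : (0 : M.Num) < (m + 1) + (m + 1) := by positivity
  have h1 : (1 : M.Num) < (m + 1) + (m + 1) := by
    rw [two_mul_succ]
    exact lt_of_lt_of_le (lt_add_one 1) le_add_self
  have hdel : del 0 1 (intJ (M := M)) = intJ := by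
    funext a b
    have h : ∀ a : M.Num, skipTwo 0 1 a = a + (1 + 1) := fun a => by
      rw [skipTwo_of_lt zero_lt_one, skip_of_le (zero_le), skip_of_le le_add_self, add_assoc]
    rw [del, h, h, intJ, codeJ_add_two, intJ]
  rw [pfZ_expand hPCE (by fun_prop) (skewZ_intJ _) h0, isum_eq_single (k := 1) (by fun_prop) h1,
    if_neg one_ne_zero, hdel, ih, par_zero, par_one, ord_of_lt zero_lt_one]
  · have : intJ (0 : M.Num) 1 = 1 := by
      rw [intJ, codeJ_zero_one, map_one]
    rw [this]
    ring
  · intro j hj hj1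
    by_cases hj0 : j = 0
    · rw [if_pos hj0]
    have : intJ 0 j = 0 := by
      rw [intJ, codeJ_zero_of_ne hj1, map_zero]
    rw [if_neg hj0, this, zero_mul, mul_zero]

end VSharpL

namespace VSharpL
universe u v w
variable {M : TwoSorted.{u}} [hM : Model M]

variable {α : Type v} [Space M α]

/-! ### Cayley's theorem for matrices with nonzero leading Pfaffians -/

/-- A row `b` can be cleared by the rows of `A`. -/
theorem exists_isum_mul_eq (hPCE : PCE M) {k : M.Num} {A : M.Num → M.Num → IntM M}
    (hA : Mor M fun x : M.Num × M.Num => A x.1 x.2) (hs : SkewZ (k + k) A)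
    {b : M.Num → IntM M} (hb : Mor M b) : ∃ c : M.Num → IntM M, Mor M c ∧
      ∀ l, l < k + k → isum (k + k) (fun a => c a * A a l) = -(pfZ k A * b l) := by
  rcases Num.eq_zero_or_succ k with rfl | ⟨m, rfl⟩
  · refine ⟨fun _ => 0, by fun_prop, fun l hl => ?_⟩
    simp at hl
  set D := (m + 1) + (m + 1) with hD
  refine ⟨fun i => isum D fun a => b a * cof m A a i, by fun_prop, fun l hl => ?_⟩
  calc isum D (fun i => isum D (fun a => b a * cof m A a i) * A i l)
      = isum D fun i => isum D fun a => -(b a * (cof m A a i * A l i)) := by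
        refine isum_congr (by fun_prop) (by fun_prop) fun i hi => ?_
        rw [← isum_mul_right _ _ (by fun_prop)]
        refine isum_congr (by fun_prop) (by fun_prop) fun a ha => ?_
        rw [hs i l hi hl]
        ring
    _ = isum D fun a => isum D fun i => -(b a * (cof m A a i * A l i)) :=
        isum_comm _ _ (by fun_prop)
    _ = isum D fun a => -b a * isum D fun i => cof m A a i * A l i := by
        refine isum_congr (by fun_prop) (by fun_prop) fun a ha => ?_
        rw [← isum_mul_left _ _ (by fun_prop)]
        refine isum_congr (by fun_prop) (by fun_prop) fun i hi => by ring
    _ = -b l * pfZ (m + 1) A := by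
        rw [isum_eq_single (k := l) (by fun_prop) hl, isum_cof_mul_self hPCE hA hs hl]
        intro a ha hal
        rw [isum_cof_mul hPCE hA hs hal ha hl, mul_zero]
    _ = _ := by ring

theorem isum_isum_skew {d : M.Num} {A : M.Num → M.Num → IntM M}
    (hA : Mor M fun x : M.Num × M.Num => A x.1 x.2) (hs : SkewZ d A) {c : M.Num → IntM M}
    (hc : Mor M c) : isum d (fun l => isum d (fun a => c a * A a l) * c l) = 0 := by
  apply eq_zero_of_eq_neg
  have h1 : isum d (fun l => isum d (fun a => c a * A a l) * c l) =
      isum d fun l => isum d fun a => c a * A a l * c l :=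
    isum_congr (by fun_prop) (by fun_prop) fun l hl => (isum_mul_right _ _ (by fun_prop)).symm
  rw [h1]
  conv_lhs => rw [isum_comm _ _ (by fun_prop)]
  rw [← isum_neg _ (by fun_prop)]
  refine isum_congr (by fun_prop) (by fun_prop) fun a ha => ?_
  rw [← isum_neg _ (by fun_prop)]
  refine isum_congr (by fun_prop) (by fun_prop) fun l hl => ?_
  rw [hs a l ha hl]
  ring

/-- The new rows of a skew symmetric matrix of order `2 k + 2` can be combined with the old ones to
a row with a single nonzero entry, the Pfaffian of the matrix. -/
theorem exists_clearing_row (hPCE : PCE M) {k : M.Num} {A : M.Num → M.Num → IntM M}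
    (hA : Mor M fun x : M.Num × M.Num => A x.1 x.2)
    (hs : SkewZ ((k + 1) + (k + 1)) A) (h0 : pfZ k A ≠ 0) : ∃ w : M.Num → IntM M, Mor M w ∧
      w (k + k) = pfZ k A ∧ w (k + k + 1) = 0 ∧
      (∀ l, l < k + k + 1 → isum (k + k + 1) (fun a => w a * A a l) = 0) ∧
      isum (k + k + 1) (fun a => w a * A a (k + k + 1)) = pfZ (k + 1) A := by
  have hs' : SkewZ (k + k) A := hs.mono (by rw [two_mul_succ]; exact le_self_add)
  obtain ⟨c, hc, hcA⟩ := exists_isum_mul_eq hPCE hA hs' (b := A (k + k)) (by fun_prop)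
  set N := k + k with hN
  let w : M.Num → IntM M := fun a => if a < N then c a else if a = N then pfZ k A else 0
  have hw : Mor M w := by dsimp only [w]; fun_prop
  have hwN : w N = pfZ k A := by simp [w]
  have hwN1 : w (N + 1) = 0 := by
    dsimp only [w]
    rw [if_neg (lt_add_one N).not_gt, if_neg (lt_add_one N).ne']
  have hsum : ∀ l, isum (N + 1) (fun a => w a * A a l) =
      isum N (fun a => c a * A a l) + pfZ k A * A N l := fun l => by
    rw [isum_succ (by fun_prop), hwN]
    congr 1
    refine isum_congr (by fun_prop) (by fun_prop) fun a ha => ?_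
    dsimp only [w]
    rw [if_pos ha]
  have hord : (k + 1) + (k + 1) = N + 1 + 1 := by rw [two_mul_succ, ← add_assoc]
  have hNlt : N < N + 1 + 1 := (lt_add_one N).trans (lt_add_one _)
  have hlow : ∀ l, l < N + 1 → isum (N + 1) (fun a => w a * A a l) = 0 := by
    intro l hl
    rw [hsum]
    rcases (Num.lt_add_one_iff.1 hl).lt_or_eq with h | rfl
    · rw [hcA l h, neg_add_cancel]
    · rw [hs.diag (by rw [hord]; exact hNlt), mul_zero, add_zero]
      refine (mul_eq_zero.1 (?_ : pfZ k A * _ = 0)).resolve_left h0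
      rw [← isum_isum_skew hA hs' hc, ← isum_mul_left _ _ (by fun_prop)]
      refine isum_congr (by fun_prop) (by fun_prop) fun a ha => ?_
      rw [hcA a ha, hs a N (by rw [hord]; exact ha.trans hNlt) (by rw [hord]; exact hNlt)]
      ring
  refine ⟨w, hw, hwN, hwN1, hlow, ?_⟩
  have hlong : ∀ l, isum (k + 1 + (k + 1)) (fun a => w a * A a l) =
      isum (N + 1) fun a => w a * A a l := fun l => by
    rw [hord, isum_succ (by fun_prop), hwN1, zero_mul, add_zero]
  have hR := mul_pfZ_eq_cof hPCE hA hs hw (i := N) (p := N + 1) (by rw [hord]; exact hNlt)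
    (by rw [hord]; exact lt_add_one _) fun l hl h1 h2 => by
      rw [hlong]
      rw [hord] at hl
      exact hlow l ((Num.lt_add_one_iff.1 hl).lt_of_ne h2)
  have hdel : pfZ k (del N (N + 1) A) = pfZ k A := by
    refine pfZ_congr (by fun_prop) fun i j hi hj => ?_
    have h : ∀ i, i < N → skipTwo N (N + 1) i = i := fun i hi => by
      rw [skipTwo_of_lt (lt_add_one N), skip_of_lt hi, skip_of_lt (hi.trans (lt_add_one N))]
    rw [del, h i hi, h j hj]
  rw [hwN, hlong, cof, if_neg (lt_add_one N).ne', hdel, par_add_one, hN, par_add_self,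
    ord_of_lt (lt_add_one _)] at hR
  refine mul_left_cancel₀ h0 (?_ : pfZ k A * _ = _)
  rw [hR]
  ring

theorem skewZ_double (d n : M.Num) (A : M.Num → M.Num → IntM M) : SkewZ d (double n A) := by
  intro i j _ _
  unfold double
  split_ifs <;> simp

theorem double_of_lt_of_lt {n a b : M.Num} {A : M.Num → M.Num → IntM M} (ha : a < n) (hb : b < n) :
    double n A a b = 0 := by
  rw [double, if_pos ha, if_pos hb]

theorem double_of_le_of_le {n a b : M.Num} {A : M.Num → M.Num → IntM M} (ha : n ≤ a) (hb : n ≤ b) :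
    double n A a b = 0 := by
  rw [double, if_neg ha.not_gt, if_neg hb.not_gt]

theorem double_add_right {n a b : M.Num} {A : M.Num → M.Num → IntM M} (ha : a < n) :
    double n A a (n + b) = A a b := by
  rw [double, if_pos ha, if_neg le_self_add.not_gt, add_tsub_cancel_left]

theorem double_add_left {n a b : M.Num} {A : M.Num → M.Num → IntM M} (hb : b < n) :
    double n A (n + a) b = -A b a := by
  rw [double, if_neg le_self_add.not_gt, if_pos hb, add_tsub_cancel_left]

section Clearing

variable {N : M.Num} {A : M.Num → M.Num → IntM M} {w : M.Num → IntM M} {p : IntM M}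

/-- The doubled matrix of order `2 N + 4` without row `N` and the last row. -/
noncomputable def doubleDel (N : M.Num) (A : M.Num → M.Num → IntM M) : M.Num → M.Num → IntM M :=
  del N (N + 1 + 1 + (N + 1)) (double (N + 1 + 1) A)

theorem Mor.doubleDel (hA : Mor M fun x : M.Num × M.Num => A x.1 x.2) :
    Mor M fun x : M.Num × M.Num => doubleDel N A x.1 x.2 := by
  unfold VSharpL.doubleDel
  fun_prop

theorem skip_last_of_lt {a : M.Num} (ha : a < N) : skipTwo N (N + 1 + 1 + (N + 1)) a = a := by
  have h : N < N + 1 + 1 + (N + 1) :=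
    ((lt_add_one N).trans (lt_add_one _)).trans_le le_self_add
  rw [skipTwo_of_lt h, skip_of_lt ha, skip_of_lt (ha.trans h)]

theorem skip_last_of_le {a : M.Num} (ha : N ≤ a) (ha' : a < N + 1 + (N + 1)) :
    skipTwo N (N + 1 + 1 + (N + 1)) a = a + 1 := by
  have h : N < N + 1 + 1 + (N + 1) :=
    ((lt_add_one N).trans (lt_add_one _)).trans_le le_self_add
  rw [skipTwo_of_lt h, skip_of_le ha, skip_of_lt]
  rw [add_right_comm (N + 1) 1 (N + 1)]
  gcongr

theorem mul_pfZ_double (hPCE : PCE M) (hA : Mor M fun x : M.Num × M.Num => A x.1 x.2)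
    (hw : Mor M w) (hN : par N = 1)
    (hlow : ∀ l, l < N + 1 → isum (N + 1) (fun a => w a * A a l) = 0)
    (hlast : isum (N + 1) (fun a => w a * A a (N + 1)) = p) :
    w N * pfZ (N + 1 + 1) (double (N + 1 + 1) A) = pfZ (N + 1) (doubleDel N A) * p := by
  have hNN := lt_add_one N
  have hNN1 := lt_add_one (N + 1)
  let v : M.Num → IntM M := fun a => if a < N + 1 then w a else 0
  have hv : Mor M v := by dsimp only [v]; fun_prop
  have hvsum : ∀ l, isum (N + 1 + 1 + (N + 1 + 1)) (fun a => v a * double (N + 1 + 1) A a l) =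
      isum (N + 1) fun a => w a * double (N + 1 + 1) A a l := fun l => by
    rw [isum_of_le (d := N + 1) (by fun_prop) (hNN1.le.trans le_self_add)]
    · refine isum_congr (by fun_prop) (by fun_prop) fun a ha => ?_
      dsimp only [v]
      rw [if_pos ha]
    · intro a ha _
      dsimp only [v]
      rw [if_neg ha.not_gt, zero_mul]
  have hvN : v N = w N := if_pos hNN
  have hXsum : ∀ l, isum (N + 1) (fun a => w a * double (N + 1 + 1) A a (N + 1 + 1 + l)) =
      isum (N + 1) fun a => w a * A a l := fun l =>
    isum_congr (by fun_prop) (by fun_prop) fun a ha => by rw [double_add_right (ha.trans hNN1)]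
  have hNp : N < N + 1 + 1 + (N + 1) := (hNN.trans hNN1).trans_le le_self_add
  have hR := mul_pfZ_eq_cof hPCE (A := double (N + 1 + 1) A) (by fun_prop) (skewZ_double _ _ _) hv
    (m := N + 1) (i := N) (p := N + 1 + 1 + (N + 1)) ((hNN.trans hNN1).trans_le le_self_add)
    (by gcongr) fun l hl h1 h2 => by
      rw [hvsum]
      rcases lt_or_ge l (N + 1 + 1) with h | h
      · refine isum_eq_zero (by fun_prop) fun a ha => ?_
        rw [double_of_lt_of_lt (ha.trans hNN1) h, mul_zero]
      · obtain ⟨c, rfl⟩ := (Num.le_iff_exists _ _).1 h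
        have hc : c < N + 1 + 1 := by simpa using hl
        rw [hXsum]
        refine hlow c ((Num.lt_add_one_iff.1 hc).lt_of_ne ?_)
        rintro rfl
        exact h2 rfl
  have hpar : par (N + 1 + 1 + (N + 1)) = -1 := by
    rw [show N + 1 + 1 + (N + 1) = N + 1 + (N + 1) + 1 by ring, par_add_self_add_one]
  rw [hvN, hvsum, hXsum, hlast, cof, if_neg hNp.ne', ord_of_lt hNp, hN, hpar] at hR
  rw [hR, doubleDel]
  ring

theorem doubleDel_of_le_of_le {a l : M.Num} (ha : N < a) (hl : N < l)
    (ha' : a < N + 1 + (N + 1)) (hl' : l < N + 1 + (N + 1)) : doubleDel N A a l = 0 := by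
  rw [doubleDel, del, skip_last_of_le ha.le ha', skip_last_of_le hl.le hl', double_of_le_of_le]
  · have := Num.add_one_le_iff.2 ha
    gcongr
  · have := Num.add_one_le_iff.2 hl
    gcongr

theorem doubleDel_of_lt {c l : M.Num} (hc : c < N + 1) (hl : l < N) :
    doubleDel N A (N + 1 + c) l = -A l c := by
  rw [doubleDel, del, skip_last_of_le ((lt_add_one N).le.trans le_self_add) (by gcongr),
    skip_last_of_lt hl, add_right_comm (N + 1), double_add_left]
  exact hl.trans ((lt_add_one N).trans (lt_add_one _))

theorem doubleDel_self {c : M.Num} (hc : c < N + 1) :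
    doubleDel N A (N + 1 + c) N = -A (N + 1) c := by
  rw [doubleDel, del, skip_last_of_le ((lt_add_one N).le.trans le_self_add) (by gcongr),
    skip_last_of_le le_rfl ((lt_add_one N).trans_le le_self_add), add_right_comm (N + 1),
    double_add_left (lt_add_one _)]

theorem pfZ_del_doubleDel (hA : Mor M fun x : M.Num × M.Num => A x.1 x.2) :
    pfZ N (del (N + 1 + N) N (doubleDel N A)) = pfZ N (double N A) := by
  have hY := Mor.doubleDel (N := N) hA
  have hN : N < N + 1 + N := (lt_add_one N).trans_le le_self_add
  have h1 : ∀ a, a < N → skipTwo N (N + 1 + N) a = a := fun a ha => by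
    rw [skipTwo_of_lt hN, skip_of_lt ha, skip_of_lt (ha.trans hN)]
  have h2 : ∀ c, c < N → skipTwo N (N + 1 + N) (N + c) = N + 1 + c := fun c hc => by
    rw [skipTwo_of_lt hN, skip_of_le le_self_add, add_right_comm N c 1, skip_of_lt]
    gcongr
  have hlt : ∀ a, a < N → a < N + 1 + 1 := fun a ha =>
    ha.trans ((lt_add_one N).trans (lt_add_one _))
  have h3 : ∀ c, c < N → skipTwo N (N + 1 + 1 + (N + 1)) (N + 1 + c) = N + 1 + 1 + c :=
    fun c hc => by
      rw [skip_last_of_le ((lt_add_one N).le.trans le_self_add), add_right_comm (N + 1)]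
      have := hc.trans (lt_add_one N)
      gcongr
  refine pfZ_congr (by fun_prop) fun a b ha' hb' => ?_
  rw [del_comm hN.ne', del, doubleDel, del]
  have split : ∀ a, a < N + N → a < N ∨ ∃ c, a = N + c ∧ c < N := fun a ha => by
    rcases lt_or_ge a N with h | h
    · exact .inl h
    · obtain ⟨c, rfl⟩ := (Num.le_iff_exists _ _).1 h
      exact .inr ⟨c, rfl, by simpa using ha⟩
  rcases split a ha' with ha | ⟨a, rfl, ha⟩ <;> rcases split b hb' with hb | ⟨b, rfl, hb⟩
  · rw [h1 a ha, h1 b hb, skip_last_of_lt ha, skip_last_of_lt hb, double_of_lt_of_lt ha hb,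
      double_of_lt_of_lt (hlt a ha) (hlt b hb)]
  · rw [h1 a ha, h2 b hb, skip_last_of_lt ha, h3 b hb, double_add_right ha,
      double_add_right (hlt a ha)]
  · rw [h2 a ha, h1 b hb, skip_last_of_lt hb, h3 a ha, double_add_left hb,
      double_add_left (hlt b hb)]
  · rw [h2 a ha, h2 b hb, h3 a ha, h3 b hb, double_of_le_of_le le_self_add le_self_add,
      double_of_le_of_le le_self_add le_self_add]

theorem mul_pfZ_doubleDel (hPCE : PCE M) (hA : Mor M fun x : M.Num × M.Num => A x.1 x.2)
    (hs : SkewZ (N + 1 + 1) A) (hw : Mor M w) (hN : par N = 1)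
    (hlow : ∀ l, l < N + 1 → isum (N + 1) (fun a => w a * A a l) = 0)
    (hlast : isum (N + 1) (fun a => w a * A a (N + 1)) = p) :
    w N * pfZ (N + 1) (doubleDel N A) = -(pfZ N (double N A) * p) := by
  have hNN := lt_add_one N
  have hNN1 := lt_add_one (N + 1)
  have hY := Mor.doubleDel (N := N) hA
  let u : M.Num → IntM M := fun a => if a < N + 1 then 0 else w (a - (N + 1))
  have hu : Mor M u := by dsimp only [u]; fun_prop
  have huc : ∀ c, u (N + 1 + c) = w c := fun c => by
    dsimp only [u]
    rw [if_neg le_self_add.not_gt, add_tsub_cancel_left]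
  have husum : ∀ l, isum (N + 1 + (N + 1)) (fun a => u a * doubleDel N A a l) =
      isum (N + 1) fun c => w c * doubleDel N A (N + 1 + c) l := fun l => by
    rw [isum_reindex (d := N + 1) (h := fun c => N + 1 + c) (by fun_prop) (by fun_prop)
      (fun i j _ _ h => add_left_cancel h) (fun j hj => by gcongr)]
    · exact isum_congr (by fun_prop) (by fun_prop) fun c hc => by rw [huc]
    · intro a ha h
      have : N + 1 ≤ a := by
        by_contra! h'
        apply h
        dsimp only [u]
        rw [if_pos h', zero_mul]
      obtain ⟨c, rfl⟩ := (Num.le_iff_exists _ _).1 this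
      exact ⟨c, by simpa using ha, rfl⟩
  have hYsum : ∀ l r, r < N + 1 + 1 →
      (∀ c, c < N + 1 → doubleDel N A (N + 1 + c) l = -A r c) →
      isum (N + 1) (fun c => w c * doubleDel N A (N + 1 + c) l) =
        isum (N + 1) fun c => w c * A c r :=
    fun l r hr h => isum_congr (by fun_prop) (by fun_prop) fun c hc => by
      rw [h c hc, hs r c hr (hc.trans hNN1), neg_neg]
  have hskY : SkewZ (N + 1 + (N + 1)) (doubleDel N A) := fun i j _ _ =>
    skewZ_double (max _ _ + 1) _ _ _ _ (Num.lt_add_one_iff.2 (le_max_left _ _))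
      (Num.lt_add_one_iff.2 (le_max_right _ _))
  have hlt : N < N + 1 + N := hNN.trans_le le_self_add
  have hR := mul_pfZ_eq_cof hPCE hY hskY hu (i := N + 1 + N) (p := N) (by gcongr)
    (hNN.trans_le le_self_add) fun l hl h1 h2 => by
      rw [husum]
      rcases h2.lt_or_gt with h | h
      · rw [hYsum l l (h.trans (hNN.trans hNN1)) fun c hc => doubleDel_of_lt hc h,
          hlow l (h.trans hNN)]
      · refine isum_eq_zero (by fun_prop) fun c hc => ?_
        rw [doubleDel_of_le_of_le (hNN.trans_le le_self_add) h (by gcongr) hl, mul_zero]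
  have hpar : par (N + 1 + N) = -1 := by rw [add_right_comm, par_add_self_add_one]
  rw [huc, husum, hYsum N (N + 1) hNN1 fun c hc => doubleDel_self hc, hlast, cof, if_neg hlt.ne,
    ord_of_le hlt.le, hN, hpar, pfZ_del_doubleDel hA] at hR
  rw [hR]
  ring

end Clearing

theorem pfZ_double_succ (hPCE : PCE M) {k : M.Num} {A : M.Num → M.Num → IntM M}
    (hA : Mor M fun x : M.Num × M.Num => A x.1 x.2)
    (hs : SkewZ ((k + 1) + (k + 1)) A) (h0 : pfZ k A ≠ 0)
    (ih : pfZ (k + k) (double (k + k) A) = par k * (pfZ k A * pfZ k A)) :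
    pfZ ((k + 1) + (k + 1)) (double ((k + 1) + (k + 1)) A) =
      par (k + 1) * (pfZ (k + 1) A * pfZ (k + 1) A) := by
  obtain ⟨w, hw, hwN, -, hlow, hlast⟩ := exists_clearing_row hPCE hA hs h0
  have hord : (k + 1) + (k + 1) = k + k + 1 + 1 := by rw [two_mul_succ, ← add_assoc]
  rw [hord] at hs ⊢
  have h1 := mul_pfZ_double hPCE hA hw (par_add_self k) hlow hlast
  have h2 := mul_pfZ_doubleDel hPCE hA hs hw (par_add_self k) hlow hlast
  rw [hwN] at h1 h2
  rw [ih] at h2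
  refine mul_left_cancel₀ (mul_ne_zero h0 h0) ?_
  rw [par_add_one]
  linear_combination pfZ k A * h1 + pfZ (k + 1) A * h2

theorem pfZ_double_of_ne_zero (hPCE : PCE M) {n : M.Num} {A : M.Num → M.Num → IntM M}
    (hA : Mor M fun x : M.Num × M.Num => A x.1 x.2) (hs : SkewZ (n + n) A)
    (h0 : ∀ k, k ≤ n → pfZ k A ≠ 0) :
    pfZ (n + n) (double (n + n) A) = par n * (pfZ n A * pfZ n A) := by
  suffices H : ∀ k, k ≤ n → pfZ (k + k) (double (k + k) A) = par k * (pfZ k A * pfZ k A) from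
    H n le_rfl
  refine induction_mor (.imp (by fun_prop) (by fun_prop)) ?_ fun k ih hk => ?_
  · intro _
    rw [add_zero, pfZ_zero, pfZ_zero, par_zero, mul_one, mul_one]
  · have hk' := (lt_add_one k).le.trans hk
    exact pfZ_double_succ hPCE hA (hs.mono (add_le_add hk hk)) (h0 k hk') (ih hk')

/-! ### Cayley's theorem -/

theorem pfZ_add_odd_mul_ne_zero (hPCE : PCE M) {n : M.Num} {A : M.Num → M.Num → IntM M}
    (hA : Mor M fun x : M.Num × M.Num => A x.1 x.2) (hs : SkewZ (n + n) A) (y : IntM M) :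
    pfZ n (fun i j => A i j + (1 + (y + y)) * (A i j + intJ i j)) ≠ 0 := by
  obtain ⟨z, hz⟩ := exists_pfZ_add_mul hPCE (n := n) (A := intJ)
    (C := fun i j => A i j + y * (A i j + intJ i j)) (by fun_prop) (by fun_prop)
    (skewZ_intJ _) (fun i j hi hj => by beta_reduce; rw [hs i j hi hj, skewZ_intJ _ i j hi hj]; ring) (1 + 1)
  have h : (fun i j => A i j + (1 + (y + y)) * (A i j + intJ i j)) =
      fun i j => intJ i j + (1 + 1) * (A i j + y * (A i j + intJ i j)) := by
    funext i j
    ring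
  rw [h, hz, pfZ_intJ hPCE, add_mul, one_mul]
  exact odd_ne_zero z

theorem pfZ_double (hPCE : PCE M) {n : M.Num} {A : M.Num → M.Num → IntM M}
    (hA : Mor M fun x : M.Num × M.Num => A x.1 x.2) (hs : SkewZ (n + n) A) :
    pfZ (n + n) (double (n + n) A) = par n * (pfZ n A * pfZ n A) := by
  rw [← sub_eq_zero]
  refine eq_zero_of_odd_dvd _ fun y => ?_
  set x : IntM M := 1 + (y + y) with hx
  have hs' : SkewZ (n + n) fun i j => A i j + intJ i j := fun i j hi hj => by
    beta_reduce
    rw [hs i j hi hj, skewZ_intJ _ i j hi hj]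
    ring
  obtain ⟨z, hz⟩ := exists_pfZ_add_mul hPCE hA (C := fun i j => A i j + intJ i j) (by fun_prop)
    hs hs' x
  obtain ⟨z', hz'⟩ := exists_pfZ_add_mul hPCE (n := n + n) (A := double (n + n) A)
    (C := double (n + n) fun i j => A i j + intJ i j) (by fun_prop) (by fun_prop)
    (skewZ_double _ _ _) (skewZ_double _ _ _) x
  have H := pfZ_double_of_ne_zero hPCE (n := n) (A := fun i j => A i j + x * (A i j + intJ i j))
    (by fun_prop) (fun i j hi hj => by beta_reduce; rw [hs i j hi hj, skewZ_intJ _ i j hi hj]; ring)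
    fun k hk => pfZ_add_odd_mul_ne_zero hPCE hA (hs.mono (add_le_add hk hk)) y
  have hd : (double (n + n) fun i j => A i j + x * (A i j + intJ i j)) = fun i j =>
      double (n + n) A i j + x * double (n + n) (fun i j => A i j + intJ i j) i j := by
    funext i j
    unfold double
    split_ifs <;> ring
  rw [hd, hz, hz'] at H
  exact ⟨par n * (pfZ n A * z + z * pfZ n A + x * (z * z)) - z', by linear_combination H⟩

end VSharpL

/-- `V#L` proves that Pfaffian cofactor expansion implies Cayley's theorem. -/
theorem mainTheorem11 (M : VSharpL.TwoSorted) (hM : VSharpL.IsModel M)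
    (hPCE : VSharpL.PCE M) : VSharpL.Cayley M := by
  intro n A
  have : VSharpL.Model M := ⟨hM, ⟨A⟩⟩
  exact VSharpL.cayley_of_double (fun _ _ hA hs => VSharpL.pfZ_double hPCE hA hs) n A
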